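/- **Conventions.** Let $\Bbbk$ be a commutative ring. A graded $\Bbbk$-quiver $\mathcal A$ consists of a set of objects and of $\mathbb Z$-graded $\Bbbk$-modules $\mathcal A(X,Y)$; $s\mathcal A=\mathcal A[1]$, where $M[m]^d=M^{d+m}$; $(\mathcal A\otimes\mathcal B)(X,Y)=\bigoplus_Z\mathcal A(X,Z)\otimes\mathcal B(Z,Y)$ for quivers with the same objects, and $T^n\mathcal A=\mathcal A^{\otimes n}$. Operators act on the right and the Koszul rule $(x\otimes y)(f\otimes g)=(-1)^{\deg y\deg f}xf\otimes yg$ is used. A differential graded quiver $\mathcal Q$ is a graded quiver with a differential $d$ of degree $1$, $d^2=0$, on every $\mathcal Q(X,Y)$, and $s\mathcal Q$ has the differential of $\mathcal Q[1]$. An $A_\infty$-category is a graded quiver $\mathcal A$ with maps $b_n:T^ns\mathcal A\to s\mathcal A$, $n\ge1$, of degree $1$, identical on objects, such that $\sum_{r+m+t=n}(1^{\otimes r}\otimes b_m\otimes1^{\otimes t})b_{r+1+t}=0$ for all $n\ge1$. An $A_\infty$-functor $f:\mathcal A\to\mathcal B$ is a map $\mathrm{Ob} f$ of objects with maps $f_n:T^ns\mathcal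 A\to s\mathcal B$, $n\ge1$, of degree $0$ over $\mathrm{Ob} f$ such that for all $n\ge1$ $$\sum_{l>0,\ i_1+\dots+i_l=n}(f_{i_1}\otimes\dots\otimes f_{i_l})b_l=\sum_{r+m+t=n}(1^{\otimes r}\otimes b_m\otimes1^{\otimes t})f_{r+1+t}\qquad(i_j\ge1,\ m\ge1).$$ **The free $A_\infty$-category.** Let $\mathcal Q$ be a differential graded quiver. For a plane rooted tree $t$ with $n\ge1$ input vertices and $|t|$ internal vertices, each of which has at least two incoming edges, put $s\mathcal F_t\mathcal Q=T^ns\mathcal Q[-|t|]$, where the shift is applied to the last tensor factor. The quiver $\mathcal F\mathcal Q$ has the objects of $\mathcal Q$ and $s\mathcal F\mathcal Q=\bigoplus_ts\mathcal F_t\mathcal Q$; for the tree $|$ without internal vertices, $s\mathcal F_|\mathcal Q=s\mathcal Q$. For $n\ge2$, $b_n$ is the direct sum of the maps $$s^{|t_1|}\otimes\dots\otimes s^{|t_{n-1}|}\otimes s^{|t_n|-|t|}:s\mathcal F_{t_1}\mathcal Q\otimes\dots\otimes s\mathcal F_{t_n}\mathcal Q\to s\mathcal F_t\mathcal Q,$$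 where $t$ is obtained by joining the roots of $t_1,\dots,t_n$ to a new lowest internal vertex. On $s\mathcal F_t\mathcal Q$ the map $b_1$ is the sum of the differential of $T^ns\mathcal Q[-|t|]$ and of the maps $(-1)^{1+h}s^{-1}:s\mathcal F_t\mathcal Q\to s\mathcal F_{t'}\mathcal Q$ over all trees $t'$ of the same kind with a distinguished internal edge $e$ whose contraction gives $t$; here $h$ is the number, starting from $1$, of the end of $e$ most distant from the root in the linear order of the internal vertices of $t'$ in which the lowest vertex of a tree precedes the subtrees growing from it, taken from left to right. **Proposition ($A_\infty$-functors from a free $A_\infty$-category).** $\mathcal F\mathcal Q$ is an $A_\infty$-category, and the following holds. Let $\mathcal A$ be an $A_\infty$-category, and let $f_1:s\mathcal Q\to(s\mathcal A,b_1)$ be a chain morphism of differential graded quivers (of degree $0$) with the underlying map of objects $\mathrm{Ob} f:\mathrm{Ob}\,\mathcal Q\to\mathrm{Ob}\,\mathcal A$. For all $k>1$ let $f_k:T^ks\mathcal F\mathcal Q\to s\mathcal A$ be $\Bbbk$-quiver morphisms of degree $0$ with the same underlying map $\mathrm{Ob} f$. Then there exists a unique extension of $f_1$ to a quiver morphism $f_1:s\mathcal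 F\mathcal Q\to s\mathcal A$ such that $(f_1,f_2,\dots)$ are the components of an $A_\infty$-functor $f:\mathcal F\mathcal Q\to\mathcal A$. -/

import Mathlib

open scoped TensorProduct DirectSum

universe u

noncomputable section

/-! ## Graded quivers and their tensor powers -/

/-- A graded `k`-linear quiver with set of objects `O`: every `Hom X Y` is a `ℤ`-graded
`k`-module, i.e. a `k`-module that is the internal direct sum of its homogeneous components
`gr X Y d`, `d : ℤ`. -/
structure GQuiv (k : Type u) [CommRing k] (O : Type u) where
  Hom : O → O → Type u
  [acg : ∀ X Y, AddCommGroup (Hom X Y)]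
  [mod : ∀ X Y, Module k (Hom X Y)]
  gr : ∀ X Y, ℤ → Submodule k (Hom X Y)
  internal : ∀ X Y, DirectSum.IsInternal (gr X Y)

attribute [instance] GQuiv.acg GQuiv.mod

/-- A criterion for a family of submodules to be a grading. -/
theorem isInternal_of_linearMap {k : Type u} [CommRing k] {M : Type u} [AddCommGroup M]
    [Module k M] (gr : ℤ → Submodule k M) (D : M →ₗ[k] ⨁ d, gr d)
    (h1 : ∀ x, DirectSum.coeLinearMap gr (D x) = x)
    (h2 : ∀ d (x : gr d), D x = DirectSum.lof k ℤ (fun d => gr d) d x) :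
    DirectSum.IsInternal gr := by
  have h3 : D ∘ₗ DirectSum.coeLinearMap gr = LinearMap.id := by
    refine DirectSum.linearMap_ext _ (fun d => ?_)
    ext1 x
    simp [DirectSum.coeLinearMap_lof, h2]
  refine ⟨fun x y hxy => ?_, fun x => ⟨D x, h1 x⟩⟩
  have hx := LinearMap.congr_fun h3 x
  have hy := LinearMap.congr_fun h3 y
  change D (DirectSum.coeLinearMap gr x) = x at hx
  change D (DirectSum.coeLinearMap gr y) = y at hy
  have hxy' : DirectSum.coeLinearMap gr x = DirectSum.coeLinearMap gr y := hxy
  rw [← hx, ← hy, hxy']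

namespace GQuiv

variable {k : Type u} [CommRing k] {O P : Type u}

/-- The decomposition of an element into its homogeneous components. -/
def dec (A : GQuiv k O) (X Y : O) : A.Hom X Y ≃ₗ[k] ⨁ d, A.gr X Y d :=
  (LinearEquiv.ofBijective (DirectSum.coeLinearMap (A.gr X Y)) (A.internal X Y)).symm

theorem coe_dec (A : GQuiv k O) (X Y : O) (x : A.Hom X Y) :
    DirectSum.coeLinearMap (A.gr X Y) (A.dec X Y x) = x :=
  (LinearEquiv.ofBijective (DirectSum.coeLinearMap (A.gr X Y)) (A.internal X Y)).apply_symm_apply x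

theorem dec_of_mem (A : GQuiv k O) (X Y : O) (d : ℤ) (x : A.Hom X Y) (hx : x ∈ A.gr X Y d) :
    A.dec X Y x = DirectSum.lof k ℤ (fun d => A.gr X Y d) d ⟨x, hx⟩ := by
  apply (A.dec X Y).symm.injective
  rw [LinearEquiv.symm_apply_apply]
  exact (DirectSum.coeLinearMap_lof (A.gr X Y) d ⟨x, hx⟩).symm

/-- Induction on homogeneous elements. -/
theorem hom_induction (A : GQuiv k O) {X Y : O} {p : A.Hom X Y → Prop} (h0 : p 0)
    (hh : ∀ d x, x ∈ A.gr X Y d → p x) (ha : ∀ x y, p x → p y → p (x + y)) (x) : p x := by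
  rw [← A.coe_dec X Y x]
  induction A.dec X Y x using DirectSum.induction_on with
  | zero => simpa using h0
  | of d x =>
    have : DirectSum.coeLinearMap (A.gr X Y) (DirectSum.of (fun d => A.gr X Y d) d x) = x :=
      DirectSum.coeLinearMap_lof _ d x
    rw [this]
    exact hh d _ x.2
  | add x y hx hy => rw [map_add]; exact ha _ _ hx hy

/-- The parity operator, equal to `(-1) ^ d` on elements of degree `d`; all Koszul signs are
expressed through it. -/
def eps (A : GQuiv k O) (X Y : O) : A.Hom X Y →ₗ[k] A.Hom X Y :=
  DirectSum.toModule k ℤ (A.Hom X Y) (fun d => (d.negOnePow : ℤ) • (A.gr X Y d).subtype) ∘ₗ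
    (A.dec X Y).toLinearMap

theorem eps_of_mem (A : GQuiv k O) (X Y : O) (d : ℤ) (x : A.Hom X Y) (hx : x ∈ A.gr X Y d) :
    A.eps X Y x = (d.negOnePow : ℤ) • x := by
  simp [eps, dec_of_mem A X Y d x hx, DirectSum.toModule_lof]

/-- A `k`-linear map of quivers `A → B` with underlying map of objects `φ`. -/
abbrev QHom (φ : O → P) (A : GQuiv k O) (B : GQuiv k P) : Type u :=
  ∀ X Y, A.Hom X Y →ₗ[k] B.Hom (φ X) (φ Y)

/-- `f` is homogeneous of degree `e`. -/
def HasDegree {φ : O → P} {A : GQuiv k O} {B : GQuiv k P} (f : QHom φ A B) (e : ℤ) : Prop :=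
  ∀ X Y d x, x ∈ A.gr X Y d → f X Y x ∈ B.gr (φ X) (φ Y) (d + e)

/-- The shift `A[m]`: the same modules with the grading `A[m]^d = A^{d+m}`. In particular
`A.shift 1` is the suspension `sA`. -/
abbrev shift (A : GQuiv k O) (m : ℤ) : GQuiv k O where
  Hom := A.Hom
  gr X Y d := A.gr X Y (d + m)
  internal X Y := by
    have h := (DirectSum.isInternal_submodule_iff_iSupIndep_and_iSup_eq_top _).1 (A.internal X Y)
    refine (DirectSum.isInternal_submodule_iff_iSupIndep_and_iSup_eq_top _).2 ⟨?_, ?_⟩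
    · exact h.1.comp (add_left_injective m)
    · rw [← h.2]
      exact (Equiv.addRight m).iSup_comp (g := A.gr X Y)

/-- The unit quiver `T⁰`: `k` on the diagonal (in degree `0`) and `0` elsewhere. -/
def unit (k : Type u) [CommRing k] (O : Type u) : GQuiv k O where
  Hom X Y := PLift (X = Y) → k
  gr _ _ d := if d = 0 then ⊤ else ⊥
  internal X Y := by
    refine isInternal_of_linearMap _
      (DirectSum.lof k ℤ (fun d => ((if d = 0 then ⊤ else ⊥ :
        Submodule k (PLift (X = Y) → k)))) 0 ∘ₗ
        (LinearMap.id.codRestrict _ (fun x => by simp))) (fun x => ?_) (fun d x => ?_)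
    · simp [DirectSum.coeLinearMap_lof]
    · by_cases hd : d = 0
      · subst hd; rfl
      · obtain ⟨x, hx⟩ := x
        have hx0 : x = 0 := by simpa [hd] using hx
        subst hx0
        have e : (⟨0, hx⟩ : ((if d = 0 then ⊤ else ⊥ :
          Submodule k (PLift (X = Y) → k)))) = 0 := rfl
        rw [e, map_zero]
        exact map_zero _

open Classical in
/-- The homogeneous component of degree `d` of the tensor product of quivers is generated by the
tensors `a ⊗ b` with `deg a + deg b = d`. -/
def tensGr (A B : GQuiv k O) (X Y : O) (d : ℤ) :
    Submodule k (⨁ Z, A.Hom X Z ⊗[k] B.Hom Z Y) :=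
  Submodule.span k {x | ∃ (Z : O) (i j : ℤ) (a : A.Hom X Z) (b : B.Hom Z Y),
    a ∈ A.gr X Z i ∧ b ∈ B.gr Z Y j ∧ i + j = d ∧
    x = DirectSum.lof k O (fun Z => A.Hom X Z ⊗[k] B.Hom Z Y) Z (a ⊗ₜ[k] b)}

open Classical in
theorem tensGr_mem (A B : GQuiv k O) (X Y Z : O) (i j : ℤ) (t : A.gr X Z i ⊗[k] B.gr Z Y j) :
    DirectSum.lof k O (fun Z => A.Hom X Z ⊗[k] B.Hom Z Y) Z
      (TensorProduct.map (A.gr X Z i).subtype (B.gr Z Y j).subtype t) ∈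
      tensGr A B X Y (i + j) := by
  induction t using TensorProduct.induction_on with
  | zero => simp
  | tmul a b => exact Submodule.subset_span ⟨Z, i, j, a, b, a.2, b.2, rfl, by simp⟩
  | add x y hx hy => rw [map_add, map_add]; exact Submodule.add_mem _ hx hy

open Classical in
/-- The decomposition map of the tensor product. -/
def tensDec (A B : GQuiv k O) (X Y : O) :
    (⨁ Z, A.Hom X Z ⊗[k] B.Hom Z Y) →ₗ[k] ⨁ d, tensGr A B X Y d :=
  DirectSum.toModule k O _ fun Z =>
    DirectSum.toModule k (ℤ × ℤ) _ (fun p =>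
      DirectSum.lof k ℤ (fun d => tensGr A B X Y d) (p.1 + p.2) ∘ₗ
        LinearMap.codRestrict _
          (DirectSum.lof k O (fun Z => A.Hom X Z ⊗[k] B.Hom Z Y) Z ∘ₗ
            TensorProduct.map (A.gr X Z p.1).subtype (B.gr Z Y p.2).subtype)
          (fun t => tensGr_mem A B X Y Z p.1 p.2 t)) ∘ₗ
    (TensorProduct.directSum k k (fun i => A.gr X Z i) (fun j => B.gr Z Y j)).toLinearMap ∘ₗ
    TensorProduct.map (A.dec X Z).toLinearMap (B.dec Z Y).toLinearMap

open Classical in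
theorem tensDec_tmul (A B : GQuiv k O) (X Y Z : O) (i j d : ℤ) (a : A.Hom X Z) (b : B.Hom Z Y)
    (ha : a ∈ A.gr X Z i) (hb : b ∈ B.gr Z Y j) (hd : i + j = d)
    (hm : DirectSum.lof k O (fun Z => A.Hom X Z ⊗[k] B.Hom Z Y) Z (a ⊗ₜ[k] b) ∈
      tensGr A B X Y d) :
    tensDec A B X Y (DirectSum.lof k O (fun Z => A.Hom X Z ⊗[k] B.Hom Z Y) Z (a ⊗ₜ[k] b)) =
      DirectSum.lof k ℤ (fun d => tensGr A B X Y d) d ⟨_, hm⟩ := by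
  subst hd
  simp only [tensDec, DirectSum.toModule_lof, LinearMap.comp_apply, TensorProduct.map_tmul,
    LinearEquiv.coe_coe, dec_of_mem A X Z i a ha, dec_of_mem B Z Y j b hb,
    TensorProduct.directSum_lof_tmul_lof]
  rfl

open Classical in
/-- The tensor product of quivers with the same set of objects:
`(A ⊗ B)(X, Y) = ⨁ Z, A(X, Z) ⊗ B(Z, Y)`. -/
def tens (A B : GQuiv k O) : GQuiv k O where
  Hom X Y := ⨁ Z, A.Hom X Z ⊗[k] B.Hom Z Y
  gr X Y d := tensGr A B X Y d
  internal X Y := by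
    refine isInternal_of_linearMap _ (tensDec A B X Y) (fun x => ?_) (fun d x => ?_)
    · induction x using DirectSum.induction_on with
      | zero => simp
      | add x y hx hy => rw [map_add, map_add, hx, hy]
      | of Z x =>
        change DirectSum.coeLinearMap _ (tensDec A B X Y (DirectSum.lof k O
          (fun Z => A.Hom X Z ⊗[k] B.Hom Z Y) Z x)) = DirectSum.lof k O
          (fun Z => A.Hom X Z ⊗[k] B.Hom Z Y) Z x
        induction x using TensorProduct.induction_on with
        | zero => simp
        | add x y hx hy => simp only [map_add, hx, hy]
        | tmul a b =>
          induction a using A.hom_induction with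
          | h0 => simp
          | ha x y hx hy => simp only [TensorProduct.add_tmul, map_add, hx, hy]
          | hh i a ha =>
            induction b using B.hom_induction with
            | h0 => simp
            | ha x y hx hy => simp only [TensorProduct.tmul_add, map_add, hx, hy]
            | hh j b hb =>
              rw [tensDec_tmul A B X Y Z i j _ a b ha hb rfl
                (Submodule.subset_span ⟨Z, i, j, a, b, ha, hb, rfl, rfl⟩),
                DirectSum.coeLinearMap_lof]
    · obtain ⟨x, hx⟩ := x
      change tensDec A B X Y x = _
      induction hx using Submodule.span_induction with
      | mem x h =>
        obtain ⟨Z, i, j, a, b, ha, hb, hd, rfl⟩ := h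
        exact tensDec_tmul A B X Y Z i j d a b ha hb hd _
      | zero => rw [map_zero]; exact (map_zero _).symm
      | add x y hx hy h1 h2 => rw [map_add, h1, h2, ← map_add]; rfl
      | smul c x hx h1 => rw [map_smul, h1, ← map_smul]; rfl

/-- The tensor power `TⁿA` of a quiver. -/
def pow (A : GQuiv k O) : ℕ → GQuiv k O
  | 0 => unit k O
  | n + 1 => tens (pow A n) A

open Classical in
/-- The direct sum of a family of quivers. -/
def dsum {ι : Type} (A : ι → GQuiv k O) : GQuiv k O where
  Hom X Y := ⨁ i, (A i).Hom X Y
  gr X Y d :=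
    { carrier := {x | ∀ i, x i ∈ (A i).gr X Y d}
      add_mem' := fun hx hy i => Submodule.add_mem _ (hx i) (hy i)
      zero_mem' := fun i => Submodule.zero_mem _
      smul_mem' := fun c x hx i => Submodule.smul_mem _ c (hx i) }
  internal X Y := by
    set G : ℤ → Submodule k (⨁ i, (A i).Hom X Y) := fun d =>
      { carrier := {x | ∀ i, x i ∈ (A i).gr X Y d}
        add_mem' := fun hx hy i => Submodule.add_mem _ (hx i) (hy i)
        zero_mem' := fun i => Submodule.zero_mem _
        smul_mem' := fun c x hx i => Submodule.smul_mem _ c (hx i) } with hG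
    have hmem : ∀ (i : ι) (d : ℤ) (x : (A i).Hom X Y), x ∈ (A i).gr X Y d →
        DirectSum.lof k ι (fun i => (A i).Hom X Y) i x ∈ G d := by
      intro i d x hx j
      by_cases h : i = j
      · subst h
        rw [DirectSum.lof_apply]; exact hx
      · rw [DirectSum.lof_eq_of, DirectSum.of_eq_of_ne _ _ _ (Ne.symm h)]
        exact Submodule.zero_mem _
    let D : (⨁ i, (A i).Hom X Y) →ₗ[k] ⨁ d, G d :=
      DirectSum.toModule k ι _ fun i =>
        DirectSum.toModule k ℤ _ (fun d =>
          DirectSum.lof k ℤ (fun d => G d) d ∘ₗ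
            LinearMap.codRestrict (G d)
              (DirectSum.lof k ι (fun i => (A i).Hom X Y) i ∘ₗ ((A i).gr X Y d).subtype)
              (fun x => hmem i d x x.2)) ∘ₗ ((A i).dec X Y).toLinearMap
    have hD : ∀ (i : ι) (d : ℤ) (x : (A i).Hom X Y) (hx : x ∈ (A i).gr X Y d),
        D (DirectSum.lof k ι (fun i => (A i).Hom X Y) i x) =
          DirectSum.lof k ℤ (fun d => G d) d ⟨_, hmem i d x hx⟩ := by
      intro i d x hx
      simp only [D, DirectSum.toModule_lof, LinearMap.comp_apply, LinearEquiv.coe_coe,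
        dec_of_mem _ X Y d x hx]
      rfl
    refine isInternal_of_linearMap G D (fun x => ?_) (fun d x => ?_)
    · induction x using DirectSum.induction_on with
      | zero => simp
      | add x y hx hy => rw [map_add, map_add, hx, hy]
      | of i x =>
        change DirectSum.coeLinearMap G (D (DirectSum.lof k ι (fun i => (A i).Hom X Y) i x)) =
          DirectSum.lof k ι (fun i => (A i).Hom X Y) i x
        induction x using (A i).hom_induction with
        | h0 => simp
        | ha x y hx hy => simp only [map_add, hx, hy]
        | hh d x hx => rw [hD i d x hx, DirectSum.coeLinearMap_lof]
    · obtain ⟨x, hx⟩ := x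
      change D x = _
      have hs : x = ∑ i ∈ DFinsupp.support x,
          DirectSum.lof k ι (fun i => (A i).Hom X Y) i (x i) :=
        (DirectSum.sum_support_of x).symm
      have hs' : (⟨x, hx⟩ : G d) = ∑ i ∈ DFinsupp.support x,
          (⟨DirectSum.lof k ι (fun i => (A i).Hom X Y) i (x i), hmem i d _ (hx i)⟩ : G d) := by
        apply Subtype.ext
        rw [AddSubmonoidClass.coe_finsetSum]
        exact hs
      rw [hs', map_sum]
      conv_lhs => rw [hs]
      rw [map_sum]
      exact Finset.sum_congr rfl (fun i _ => hD i d _ (hx i))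

/-! ## Maps between tensor powers -/

open Classical in
/-- The canonical map `A(X, Z) ⊗ B(Z, Y) → (A ⊗ B)(X, Y)`. -/
def tmk (A B : GQuiv k O) (X Z Y : O) :
    A.Hom X Z ⊗[k] B.Hom Z Y →ₗ[k] (tens A B).Hom X Y :=
  DirectSum.lof k O (fun Z => A.Hom X Z ⊗[k] B.Hom Z Y) Z

open Classical in
/-- The linear map out of `(A ⊗ B)(X, Y)` given by a family of bilinear maps. -/
def tlift {A B : GQuiv k O} {X Y : O} {M : Type u} [AddCommGroup M] [Module k M]
    (g : ∀ Z, A.Hom X Z →ₗ[k] B.Hom Z Y →ₗ[k] M) : (tens A B).Hom X Y →ₗ[k] M :=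
  DirectSum.toModule k O M (fun Z => TensorProduct.lift (g Z))

/-- The tensor product `f ⊗ g` of linear maps of quivers. It carries no sign: whenever a sign is
needed, it is supplied by `eps`. -/
def tmap {φ : O → P} {A A' : GQuiv k O} {B B' : GQuiv k P} (f : QHom φ A B) (g : QHom φ A' B') :
    QHom φ (tens A A') (tens B B') := fun X Y =>
  tlift fun Z => TensorProduct.curry
    (tmk B B' (φ X) (φ Z) (φ Y) ∘ₗ TensorProduct.map (f X Z) (g Z Y))

/-- A linear map of quivers which is the identity on objects. -/
abbrev QMap (A B : GQuiv k O) : Type u := QHom (fun X : O => X) A B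

/-- The identity of a quiver. -/
def idMap (A : GQuiv k O) : QMap A A := fun _ _ => LinearMap.id

/-- Composition, in diagrammatic order, of a map which is the identity on objects with
another map. -/
def QMap.then {φ : O → P} {A B : GQuiv k O} {C : GQuiv k P} (f : QMap A B) (g : QHom φ B C) :
    QHom φ A C := fun X Y => g X Y ∘ₗ f X Y

/-- The element `1` of `T⁰(X, X) = k`. -/
def unitOne (X : O) : (unit k O).Hom X X := fun _ => 1

/-- The isomorphism `T⁰(X, Y) → k` for `X = Y`. -/
def unitCoeff {X Y : O} (h : X = Y) : (unit k O).Hom X Y →ₗ[k] k :=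
  LinearMap.proj (R := k) (φ := fun _ : PLift (X = Y) => k) ⟨h⟩

open Classical in
/-- The linear map out of `T⁰(X, Y)` with value `g h` on `1` if `h : X = Y` (for `X ≠ Y` the
source is zero). -/
def unitElim {X Y : O} {M : Type u} [AddCommGroup M] [Module k M] (g : X = Y → M) :
    (unit k O).Hom X Y →ₗ[k] M :=
  if h : X = Y then (unitCoeff h).smulRight (g h) else 0

/-- The map `T⁰A → T⁰B` induced by a map of objects. -/
def unitMap (φ : O → P) : QHom φ (unit k O) (unit k P) := fun X Y =>
  unitElim fun h : X = Y => (h ▸ unitOne (φ X) : (unit k P).Hom (φ X) (φ Y))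

/-- The canonical isomorphism `A → T¹A`. -/
def toPowOne (A : GQuiv k O) : QMap A (pow A 1) := fun X Y =>
  tmk (unit k O) A X X Y ∘ₗ TensorProduct.mk k ((unit k O).Hom X X) (A.Hom X Y) (unitOne X)

/-- The canonical isomorphism `T¹A → A`. -/
def ofPowOne (A : GQuiv k O) : QMap (pow A 1) A := fun X Y =>
  tlift (A := unit k O) (B := A) fun Z =>
    unitElim fun h : X = Z => (h ▸ LinearMap.id : A.Hom Z Y →ₗ[k] A.Hom X Y)

/-- The right unit isomorphism `A ⊗ T⁰ → A`. -/
def runit (A : GQuiv k O) : QMap (tens A (unit k O)) A := fun X Y =>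
  tlift fun Z =>
    (unitElim fun h : Z = Y => (h ▸ LinearMap.id : A.Hom X Z →ₗ[k] A.Hom X Y)).flip

/-- The inverse `A → A ⊗ T⁰` of the right unit isomorphism. -/
def runitInv (A : GQuiv k O) : QMap A (tens A (unit k O)) := fun X Y =>
  tmk A (unit k O) X Y Y ∘ₗ
    (TensorProduct.mk k (A.Hom X Y) ((unit k O).Hom Y Y)).flip (unitOne Y)

/-- The associativity isomorphism `(A ⊗ B) ⊗ C → A ⊗ (B ⊗ C)`. -/
def tassoc (A B C : GQuiv k O) : QMap (tens (tens A B) C) (tens A (tens B C)) := fun X Y =>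
  tlift fun W => tlift fun Z => TensorProduct.curry <| TensorProduct.curry <|
    tmk A (tens B C) X Z Y ∘ₗ TensorProduct.map LinearMap.id (tmk B C Z W Y) ∘ₗ
      (TensorProduct.assoc k (A.Hom X Z) (B.Hom Z W) (C.Hom W Y)).toLinearMap

/-- The inverse associativity isomorphism `A ⊗ (B ⊗ C) → (A ⊗ B) ⊗ C`. -/
def tassocInv (A B C : GQuiv k O) : QMap (tens A (tens B C)) (tens (tens A B) C) := fun X Y =>
  tlift fun Z => LinearMap.flip <| tlift fun W => TensorProduct.curry <| LinearMap.flip <|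
    TensorProduct.curry <|
      tmk (tens A B) C X W Y ∘ₗ TensorProduct.map (tmk A B X Z W) LinearMap.id ∘ₗ
        (TensorProduct.assoc k (A.Hom X Z) (B.Hom Z W) (C.Hom W Y)).symm.toLinearMap

/-- Concatenation `TʳA ⊗ TˢA → Tʳ⁺ˢA`. -/
def cat (A : GQuiv k O) (r : ℕ) : (s : ℕ) → QMap (tens (pow A r) (pow A s)) (pow A (r + s))
  | 0 => runit (pow A r)
  | s + 1 => (tassocInv (pow A r) (pow A s) A).then (tmap (cat A r s) (idMap A))

/-- The component `Tʳ⁺ˢA → TʳA ⊗ TˢA` of the cut comultiplication. -/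
def cut (A : GQuiv k O) (r : ℕ) : (s : ℕ) → QMap (pow A (r + s)) (tens (pow A r) (pow A s))
  | 0 => runitInv (pow A r)
  | s + 1 => QMap.then (A := tens (pow A (r + s)) A) (tmap (cut A r s) (idMap A))
      (tassoc (pow A r) (pow A s) A)

/-- The identity `TᵐA → TⁿA` for `m = n`. -/
def castPow (A : GQuiv k O) {m n : ℕ} (h : m = n) : QMap (pow A m) (pow A n) :=
  h ▸ idMap (pow A m)

/-- The matrix coefficient `TⁿA → TʳA ⊗ TˢA` of the cut comultiplication; it is zero unless
`r + s = n`. -/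
def comul (A : GQuiv k O) (n r s : ℕ) : QMap (pow A n) (tens (pow A r) (pow A s)) :=
  if h : r + s = n then (castPow A h.symm).then (cut A r s) else 0

/-- For maps `b m : TᵐA → A` of degree `1`, this is `1^{⊗ r} ⊗ b m ⊗ 1^{⊗ t} : TⁿA → Tʳ⁺¹⁺ᵗA`, where
`n = r + m + t`. Operators act on the right, so `b m` contributes the Koszul sign
`(-1) ^ deg z`, where `z ∈ TᵗA` is the part of the tensor standing to the right of its
arguments. -/
def ins {A : GQuiv k O} (b : ∀ m, QMap (pow A m) A) (n r m t : ℕ) :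
    QMap (pow A n) (pow A (r + 1 + t)) :=
  (comul A n (r + m) t).then <|
    QMap.then (tmap (φ := fun X : O => X) (B := pow A (r + 1))
      (QMap.then (cut A r m) (tmap (φ := fun X : O => X) (idMap (pow A r)) (b m)))
      (eps (pow A t))) (cat A (r + 1) t)

/-- For maps `f n : TⁿA → B` of degree `0`, this is the matrix coefficient
`f_{nl} = ∑_{i₁ + ⋯ + i_l = n} f_{i₁} ⊗ ⋯ ⊗ f_{i_l} : TⁿA → TˡB`
of the cocategory homomorphism with the components `f n`. -/
def coeff {φ : O → P} {A : GQuiv k O} {B : GQuiv k P} (f : ∀ n, QHom φ (pow A n) B) :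
    (l n : ℕ) → QHom φ (pow A n) (pow B l)
  | 0, 0 => unitMap φ
  | 0, _ + 1 => 0
  | l + 1, n => ∑ p ∈ Finset.HasAntidiagonal.antidiagonal n,
      (comul A n p.1 p.2).then (tmap (coeff f l p.1) (f p.2))

/-- The derivation `∑ 1^{⊗ r} ⊗ d ⊗ 1^{⊗ t}` of `TⁿA` given by a map `d : A → A` of degree `1`. -/
def der {A : GQuiv k O} (d : QMap A A) : (n : ℕ) → QMap (pow A n) (pow A n)
  | 0 => 0
  | n + 1 => tmap (der d n) (eps A) + tmap (idMap (pow A n)) d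

open Classical in
/-- The inclusion of a summand in a direct sum of quivers. -/
def dinc {ι : Type} (A : ι → GQuiv k O) (i : ι) : QMap (A i) (dsum A) := fun X Y =>
  DirectSum.lof k ι (fun i => (A i).Hom X Y) i

open Classical in
/-- The linear map out of a direct sum of quivers given by a family of linear maps. -/
def dlift {ι : Type} {A : ι → GQuiv k O} {X Y : O} {M : Type u} [AddCommGroup M] [Module k M]
    (g : ∀ i, (A i).Hom X Y →ₗ[k] M) : (dsum A).Hom X Y →ₗ[k] M :=
  DirectSum.toModule k ι M g

end GQuiv

open GQuiv

/-! ## Differential graded quivers, `A∞`-categories and `A∞`-functors -/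

/-- A differential graded `k`-quiver with set of objects `O`. -/
structure DGQuiv (k : Type u) [CommRing k] (O : Type u) where
  quiv : GQuiv k O
  d : QMap quiv quiv
  d_deg : HasDegree d 1
  d_sq : ∀ X Y x, d X Y (d X Y x) = 0

/-- The suspension `sQ` of a differential graded quiver. -/
abbrev DGQuiv.s {k : Type u} [CommRing k] {O : Type u} (Q : DGQuiv k O) : GQuiv k O :=
  Q.quiv.shift 1

/-- The differential of `sQ = Q[1]`, `(ps)d = -(pd)s`. -/
def DGQuiv.sd {k : Type u} [CommRing k] {O : Type u} (Q : DGQuiv k O) : QMap Q.s Q.s :=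
  fun X Y => -Q.d X Y

/-- The data of an `A∞`-category `A`: a graded quiver and maps `b n : Tⁿ sA → sA`. -/
structure AInfData (k : Type u) [CommRing k] (O : Type u) where
  quiv : GQuiv k O
  b : ∀ n, QMap (pow (quiv.shift 1) n) (quiv.shift 1)

/-- The suspension `sA`. -/
abbrev AInfData.s {k : Type u} [CommRing k] {O : Type u} (A : AInfData k O) : GQuiv k O :=
  A.quiv.shift 1

/-- The data `A` form an `A∞`-category: the maps `b n` have degree `1` and
`∑_{r+m+t=n} (1^{⊗ r} ⊗ b m ⊗ 1^{⊗ t}) b_{r+1+t} = 0` for all `n ≥ 1`. There is no operation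
`b 0`, which is expressed by `b 0 = 0`. -/
structure AInfData.IsAInfCat {k : Type u} [CommRing k] {O : Type u} (A : AInfData k O) :
    Prop where
  b_zero : A.b 0 = 0
  b_deg : ∀ n, HasDegree (A.b n) 1
  rel : ∀ n, 1 ≤ n → ∑ p ∈ Finset.HasAntidiagonal.antidiagonal n, ∑ q ∈ Finset.HasAntidiagonal.antidiagonal p.1,
    (ins A.b n q.1 q.2 p.2).then (A.b (q.1 + 1 + p.2)) = 0

/-- The map `φ` of objects and the maps `f n : Tⁿ sA → sB` are the components of an `A∞`-functor
`A → B`: the maps `f n` have degree `0` and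
`∑_{l>0, i₁+⋯+i_l=n} (f_{i₁} ⊗ ⋯ ⊗ f_{i_l}) b_l = ∑_{r+m+t=n} (1^{⊗ r} ⊗ b m ⊗ 1^{⊗ t}) f_{r+1+t}`
for all `n ≥ 1`. There is no component `f 0`, which is expressed by `f 0 = 0`. -/
structure IsAInfFunctor {k : Type u} [CommRing k] {O P : Type u} (A : AInfData k O)
    (B : AInfData k P) (φ : O → P) (f : ∀ n, QHom φ (pow A.s n) B.s) : Prop where
  source : A.IsAInfCat
  target : B.IsAInfCat
  f_zero : f 0 = 0
  f_deg : ∀ n, HasDegree (f n) 0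
  rel : ∀ n, 1 ≤ n → ∀ X Y,
    ∑ l ∈ Finset.Icc 1 n, B.b l (φ X) (φ Y) ∘ₗ coeff f l n X Y =
      ∑ p ∈ Finset.HasAntidiagonal.antidiagonal n, ∑ q ∈ Finset.HasAntidiagonal.antidiagonal p.1,
        f (q.1 + 1 + p.2) X Y ∘ₗ ins A.b n q.1 q.2 p.2 X Y

/-! ## Trees -/

/-- Plane rooted trees all of whose internal vertices have at least two incoming edges:
`leaf` is the tree `|` without internal vertices and `node n _ c` is
`(c 0 ⊔ ⋯ ⊔ c (n - 1)) · 𝔱ₙ`. -/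
inductive PTree : Type
  | leaf : PTree
  | node (n : ℕ) (hn : 2 ≤ n) (c : Fin n → PTree) : PTree

namespace PTree

/-- The number of input vertices. -/
def leaves : PTree → ℕ
  | leaf => 1
  | node _ _ c => ∑ i, (c i).leaves

/-- The number `|t|` of internal vertices. -/
def verts : PTree → ℕ
  | leaf => 0
  | node _ _ c => 1 + ∑ i, (c i).verts

/-- The blocks of `m` consecutive elements, starting with the element `a`, in an `n`-element
ordered set, where `2 ≤ m < n`; a block is given by `(a, m)`. -/
abbrev Block (n : ℕ) : Type := {p : Fin n × Fin n // 2 ≤ p.2.val ∧ p.1.val + p.2.val ≤ n}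

/-- Given children `c` and a block, the children obtained by joining the children from the block
to a new vertex. -/
def group {n : ℕ} (c : Fin n → PTree) (p : Block n) (j : Fin (n - p.1.2.val + 1)) : PTree :=
  if h : j.val < p.1.1.val then c ⟨j, by omega⟩
  else if j.val = p.1.1.val then
    node p.1.2 p.2.1 fun i => c ⟨p.1.1.val + i.val, by have := p.2; omega⟩
  else c ⟨j.val + p.1.2.val - 1, by have := p.2; omega⟩

/-- The ways to insert an edge into the tree `t`, that is, the trees `t' = t + edge` with a
distinguished (internal) edge whose contraction gives `t`. The contracted edge becomes a vertex
of `t`. If this is the lowest vertex of `t`, then the higher end of the edge collects a block of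
children of this vertex (at least two of them, but not all); otherwise the edge is inserted in
one of the subtrees growing from the lowest vertex. -/
def Insertion : PTree → Type
  | leaf => Empty
  | node n _ c => Block n ⊕ (Σ i : Fin n, (c i).Insertion)

instance instFintypeInsertion : (t : PTree) → Fintype t.Insertion
  | leaf => inferInstanceAs (Fintype Empty)
  | node n _ c =>
    have := fun i : Fin n => instFintypeInsertion (c i)
    inferInstanceAs (Fintype (Block n ⊕ (Σ i : Fin n, (c i).Insertion)))

/-- The tree `t' = t + edge`. -/
def insert : (t : PTree) → t.Insertion → PTree
  | leaf, e => e.elim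
  | node n _ c, .inl p => node (n - p.1.2.val + 1) (by have := p.1.2.isLt; omega) (group c p)
  | node n hn c, .inr ⟨i, e⟩ => node n hn (Function.update c i ((c i).insert e))

/-- The height, in `t' = t + edge`, of the highest (most distant from the root) vertex of the
inserted edge, i.e. its number, starting with `1`, in the canonical linear order on the internal
vertices of `t'`. In this order the lowest vertex of a tree comes first, followed by the vertices
of the subtrees growing from it, from left to right. -/
def height : (t : PTree) → t.Insertion → ℕ
  | leaf, e => e.elim
  | node _ _ c, .inl p => 2 + ∑ j with j < p.1.1, (c j).verts
  | node _ _ c, .inr ⟨i, e⟩ => 1 + (∑ j with j < i, (c j).verts) + (c i).height e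

theorem sum_group {n : ℕ} (c : Fin n → PTree) (p : Block n) :
    ∑ j, (group c p j).leaves = ∑ i, (c i).leaves := by
  obtain ⟨⟨⟨a, ha⟩, ⟨m, hm⟩⟩, h2, h3⟩ := p
  dsimp only at h2 h3
  set w : ℕ → ℕ := fun j => if h : j < n then (c ⟨j, h⟩).leaves else 0 with hw
  have hc : ∀ i : Fin n, (c i).leaves = w i := fun i => by simp [hw]
  obtain ⟨r, rfl⟩ : ∃ r, n = a + m + r := ⟨n - (a + m), by omega⟩
  have hl : ∀ j : Fin (a + m + r - m + 1), (group c ⟨⟨⟨a, ha⟩, ⟨m, hm⟩⟩, h2, h3⟩ j).leaves =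
      (fun j : ℕ => if j < a then w j else if j = a then ∑ i ∈ Finset.range m, w (a + i)
        else w (j + m - 1)) j := by
    intro j
    simp only [group]
    split_ifs with h4 h5
    · exact hc _
    · simp only [leaves, hc]
      exact Fin.sum_univ_eq_sum_range (fun i => w (a + i)) m
    · exact hc _
  rw [Finset.sum_congr rfl fun j _ => hl j, Finset.sum_congr rfl fun i _ => hc i,
    Fin.sum_univ_eq_sum_range w, Fin.sum_univ_eq_sum_range (fun j => if j < a then w j
      else if j = a then ∑ i ∈ Finset.range m, w (a + i) else w (j + m - 1)),
    show a + m + r - m + 1 = a + 1 + r by omega, Finset.sum_range_add, Finset.sum_range_succ,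
    Finset.sum_range_add, Finset.sum_range_add]
  simp only [lt_irrefl, if_false, if_true]
  congr 1
  · congr 1
    refine Finset.sum_congr rfl fun j hj => ?_
    rw [if_pos (Finset.mem_range.1 hj)]
  · refine Finset.sum_congr rfl fun j _ => ?_
    rw [if_neg (by omega), if_neg (by omega)]
    congr 1
    omega

theorem leaves_insert : (t : PTree) → (e : t.Insertion) → t.leaves = (t.insert e).leaves
  | leaf, e => e.elim
  | node n _ c, .inl p => (sum_group c p).symm
  | node n hn c, .inr ⟨i, e⟩ => by
    have h := leaves_insert (c i) e
    simp only [insert, leaves]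
    refine Finset.sum_congr rfl fun j _ => ?_
    by_cases hj : j = i
    · subst hj; simpa using h
    · simp [Function.update_of_ne hj]

end PTree

/-! ## The free `A∞`-category -/

namespace FreeAInf

variable {k : Type u} [CommRing k] {O : Type u} (Q : DGQuiv k O)

/-- The graded quiver `FQ` with `sFQ = ⨁ t, sF_t Q`, where `sF_t Q = Tⁿ sQ [-|t|]` for a tree `t`
with `n` input vertices and `|t|` internal vertices. -/
def quiv : GQuiv k O :=
  dsum fun t : PTree => (pow Q.s t.leaves).shift (-(t.verts : ℤ) - 1)

/-- The inclusion `Tⁿ sQ [-|t|] = sF_t Q → sFQ`. On modules, the shift `Tⁿ sQ → sF_t Q` is the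
identity map. -/
def inc (t : PTree) : QMap (pow Q.s t.leaves) ((quiv Q).shift 1) :=
  dinc (fun t : PTree => (pow Q.s t.leaves).shift (-(t.verts : ℤ) - 1)) t

/-- The linear map out of `sFQ(X, Y)` given by a family of linear maps. -/
def lift {X Y : O} {M : Type u} [AddCommGroup M] [Module k M]
    (g : ∀ t : PTree, (pow Q.s t.leaves).Hom X Y →ₗ[k] M) :
    ((quiv Q).shift 1).Hom X Y →ₗ[k] M :=
  dlift (A := fun t : PTree => (pow Q.s t.leaves).shift (-(t.verts : ℤ) - 1)) g

/-- The inclusion `sQ = sF_| Q → sFQ` of generators. -/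
def gen : QMap Q.s ((quiv Q).shift 1) :=
  (toPowOne Q.s).then (inc Q PTree.leaf)

/-- The operation `b₁` of `FQ`. On `sF_t Q` it is the sum of the differential
of `Tⁿ sQ [-|t|]`, which is `(-1)^|t|` times the differential of `Tⁿ sQ`, and of the maps
`(-1)^β s⁻¹ : sF_t Q → sF_t' Q` for all `t' = t + edge`, where `β - 1` is the height of the highest
vertex of the edge. -/
def b1 : QMap ((quiv Q).shift 1) ((quiv Q).shift 1) := fun X Y =>
  lift Q fun t =>
    (-1 : k) ^ t.verts • (inc Q t X Y ∘ₗ der Q.sd t.leaves X Y) +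
    ∑ e : t.Insertion, (-1 : k) ^ (1 + t.height e) •
      (inc Q (t.insert e) X Y ∘ₗ castPow Q.s (t.leaves_insert e) X Y)

/-- The sum, over all sequences `c` of `n` trees, of the modules `T^{n₁ + ⋯ + nₙ} sQ`, where `nᵢ` is
the number of input vertices of `c i`. -/
def forest (n : ℕ) : GQuiv k O :=
  dsum fun c : Fin n → PTree => pow Q.s (∑ i, (c i).leaves)

/-- The direct sum of the maps
`s^{|t₁|} ⊗ ⋯ ⊗ s^{|tₙ|} : sF_{t₁} Q ⊗ ⋯ ⊗ sF_{tₙ} Q → T^{n₁} sQ ⊗ ⋯ ⊗ T^{nₙ} sQ = T^{n₁ + ⋯ + nₙ} sQ`.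
As operators act on the right, `s^{|tᵢ|}` has to pass through the `j`-th argument for all `j > i`.
Hence, the `j`-th argument is multiplied by `(-1)` to the power of its degree times
`|t₁| + ⋯ + |t_{j-1}|`. -/
def join : (n : ℕ) → QMap (pow ((quiv Q).shift 1) n) (forest Q n)
  | 0 => fun X Y =>
    dinc (fun c : Fin 0 → PTree => pow Q.s (∑ i, (c i).leaves)) Fin.elim0 X Y ∘ₗ
      castPow Q.s (m := 0) (by simp) X Y
  | n + 1 => fun X Y => tlift (A := pow ((quiv Q).shift 1) n) fun Z =>
    (dlift (A := fun c : Fin n → PTree => pow Q.s (∑ i, (c i).leaves)) fun c =>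
      ((lift Q fun t =>
        (TensorProduct.curry
          (dinc (fun c : Fin (n + 1) → PTree => pow Q.s (∑ i, (c i).leaves))
              (Fin.snoc (α := fun _ => PTree) c t) X Y ∘ₗ
            castPow Q.s (by simp [Fin.sum_univ_castSucc]) X Y ∘ₗ
            cat Q.s (∑ i, (c i).leaves) t.leaves X Y ∘ₗ
            tmk (pow Q.s (∑ i, (c i).leaves)) (pow Q.s t.leaves) X Z Y)).flip) ∘ₗ
        (eps ((quiv Q).shift 1) Z Y) ^ (∑ i, (c i).verts)).flip) ∘ₗ
    join n X Z

/-- The operations `b n` of `FQ`. For `n ≥ 2`, `b n` restricts to the maps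
`s^{|t₁|} ⊗ ⋯ ⊗ s^{|t_{n-1}|} ⊗ s^{|tₙ|-|t|} : sF_{t₁} Q ⊗ ⋯ ⊗ sF_{tₙ} Q → sF_t Q`,
where `t = (t₁ ⊔ ⋯ ⊔ tₙ) · 𝔱ₙ`. -/
def b : (n : ℕ) → QMap (pow ((quiv Q).shift 1) n) ((quiv Q).shift 1)
  | 0 => 0
  | 1 => (ofPowOne ((quiv Q).shift 1)).then (b1 Q)
  | n + 2 => (join Q (n + 2)).then fun X Y =>
    dlift (A := fun c : Fin (n + 2) → PTree => pow Q.s (∑ i, (c i).leaves)) fun c =>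
      inc Q (PTree.node (n + 2) (Nat.le_add_left 2 n) c) X Y

end FreeAInf

/-- The free `A∞`-category `FQ` generated by a differential graded quiver `Q`. -/
def freeAInf {k : Type u} [CommRing k] {O : Type u} (Q : DGQuiv k O) : AInfData k O where
  quiv := FreeAInf.quiv Q
  b := FreeAInf.b Q

/-- The sequence of components with `0`-th component `0`, first component `f₁` and higher
components `f`. -/
def components {k : Type u} [CommRing k] {O P : Type u} {φ : O → P} {A : GQuiv k O}
    {B : GQuiv k P} (f₁ : QHom φ A B) (f : ∀ n, 1 < n → QHom φ (pow A n) B) :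
    (n : ℕ) → QHom φ (pow A n) B
  | 0 => 0
  | 1 => (ofPowOne A).then f₁
  | n + 2 => f (n + 2) (by omega)

end

/-! Everything is translated to the tensor coalgebra `TT A`, the sum of all tensor powers with the
cut comultiplication. Let ⋆ be the convolution product and ε the parity operator. Operations b_n add
up to a map b : TT A → A and define the coderivation B = `coder b` = id ⋆ b ⋆ ε, where ε supplies
the Koszul sign. Components f_n define the homomorphism `cohom f` = ∑ f^{⋆l}. The A∞-relations
become b ∘ B = 0, and the functor equations become D = 0 for the defect D = f ∘ B − b' ∘ `cohom f`.

The free category is free because its operations with at least two arguments only graft: up to a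
sign, b_n concatenates tensors and joins the labelling trees (`bT_val`). Every summand other than
that of the tree | is reached in this way (`apply_inc_node_eq`), and grafting can be undone
(`unjoin_bT`). In the functor equation on a word w of n ≥ 2 letters, the unknown first component F
occurs once as F(b_n w) and otherwise only on single letters of w, whose trees have fewer internal
vertices (`target_congr`). These equations are therefore a recursion over trees starting with f₁. It
is written as F = `step` F and has exactly one solution, obtained by iterating `step`.

The equation with one argument is not part of the recursion; on generators it is the hypothesis that
f₁ is a chain map. In general, put Φ = `cohom f`. Then Φ B − B' Φ = Φ ⋆ D ⋆ Φε
(`cohom_pre_coder_sub`), and B² = 0, b' B' = 0 give D ∘ B = −b'(Φ ⋆ D ⋆ Φε) (`defect_coder`). As D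
vanishes outside T¹, the left side at w is D(b_n w), while the right side evaluates D only on single
letters of w. Hence D = 0 by induction over trees (`defect_inc`).

The A∞-relations of the free category have the same structure. For n ≥ 2 arguments they are a
cancellation of signs: an inner b_m with 1 < m < n cancels the insertion of an edge at the lowest
vertex (`bMid_block`), and an inner b₁ cancels a term of the differential together with the
insertions in one subtree (`bMid_letter`). Then b₁² = 0 follows by induction over trees from B² = id
⋆ (b ∘ B) ⋆ id (`b1_b1_inc`). -/

noncomputable section

open GQuiv

/-! ## Words -/

namespace GQuiv

/-- Words of composable letters from the family `H`. -/
inductive Word {O : Type u} (H : O → O → Type u) (X : O) : O → Type u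
  | nil : Word H X X
  | snoc {Z Y : O} (w : Word H X Z) (x : H Z Y) : Word H X Y

namespace Word

variable {O : Type u} {H H' : O → O → Type u} {M N : Type*} [AddCommMonoid M] [AddCommMonoid N]

/-- The number of letters. -/
def length {X Y : O} : Word H X Y → ℕ
  | nil => 0
  | snoc w _ => w.length + 1

/-- Concatenation of words. -/
def append {X Y : O} (u : Word H X Y) : {Z : O} → Word H Y Z → Word H X Z
  | _, nil => u
  | _, snoc w x => snoc (u.append w) x

/-- The word obtained by transforming all letters. -/
def map (g : ∀ X Y, H X Y → H' X Y) {X Y : O} : Word H X Y → Word H' X Y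
  | nil => nil
  | snoc w x => snoc (w.map g) (g _ _ x)

/-- The word with a single letter. -/
abbrev single {X Y : O} (x : H X Y) : Word H X Y := snoc nil x

@[simp] theorem length_nil {X : O} : (nil : Word H X X).length = 0 := rfl
@[simp] theorem length_snoc {X Y Z : O} (w : Word H X Z) (x : H Z Y) :
    (snoc w x).length = w.length + 1 := rfl
@[simp] theorem append_nil {X Y : O} (w : Word H X Y) : w.append nil = w := rfl
@[simp] theorem append_snoc {X Y Z W : O} (u : Word H X Y) (w : Word H Y Z) (x : H Z W) :
    u.append (snoc w x) = snoc (u.append w) x := rfl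
@[simp] theorem map_nil (g : ∀ X Y, H X Y → H' X Y) {X : O} :
    (nil : Word H X X).map g = nil := rfl
@[simp] theorem map_snoc (g : ∀ X Y, H X Y → H' X Y) {X Y Z : O} (w : Word H X Z) (x : H Z Y) :
    (snoc w x).map g = snoc (w.map g) (g _ _ x) := rfl

@[simp] theorem nil_append {X Y : O} (w : Word H X Y) : nil.append w = w := by
  induction w with
  | nil => rfl
  | snoc w x ih => rw [append_snoc, ih]

theorem append_assoc {X Y Z W : O} (u : Word H X Y) (v : Word H Y Z) (w : Word H Z W) :
    (u.append v).append w = u.append (v.append w) := by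
  induction w with
  | nil => rfl
  | snoc w x ih => simp only [append_snoc, ih]

@[simp] theorem length_append {X Y Z : O} (u : Word H X Y) (v : Word H Y Z) :
    (u.append v).length = u.length + v.length := by
  induction v with
  | nil => rfl
  | snoc w x ih => simp only [append_snoc, length_snoc, ih, add_assoc]

@[simp] theorem map_append (g : ∀ X Y, H X Y → H' X Y) {X Y Z : O} (u : Word H X Y)
    (v : Word H Y Z) : (u.append v).map g = (u.map g).append (v.map g) := by
  induction v with
  | nil => rfl
  | snoc w x ih => simp only [append_snoc, map_snoc, ih]

@[simp] theorem length_map (g : ∀ X Y, H X Y → H' X Y) {X Y : O} (u : Word H X Y) :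
    (u.map g).length = u.length := by
  induction u with
  | nil => rfl
  | snoc w x ih => simp only [map_snoc, length_snoc, ih]

/-- The sum of `β u v` over all factorizations `w = u v`. -/
def ssum {X Y : O} : (w : Word H X Y) → (∀ Z, Word H X Z → Word H Z Y → M) → M
  | nil, β => β X nil nil
  | snoc w x, β => β _ (snoc w x) nil + w.ssum fun Z u v => β Z u (v.snoc x)

theorem ssum_nil {X : O} (β : ∀ Z, Word H X Z → Word H Z X → M) :
    (nil : Word H X X).ssum β = β X nil nil := rfl

theorem ssum_snoc {X Y Z : O} (w : Word H X Z) (x : H Z Y)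
    (β : ∀ Z, Word H X Z → Word H Z Y → M) :
    (snoc w x).ssum β = β _ (snoc w x) nil + w.ssum fun Z u v => β Z u (v.snoc x) := rfl

theorem ssum_congr {X Y : O} (w : Word H X Y) {β γ : ∀ Z, Word H X Z → Word H Z Y → M}
    (h : ∀ Z u v, u.append v = w → β Z u v = γ Z u v) : w.ssum β = w.ssum γ := by
  induction w with
  | nil => exact h _ _ _ rfl
  | snoc w x ih =>
    rw [ssum_snoc, ssum_snoc, h _ (snoc w x) nil rfl, ih fun Z u v e => h _ _ _ (by simp [e])]

theorem ssum_zero {X Y : O} (w : Word H X Y) :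
    (w.ssum fun _ _ _ => (0 : M)) = 0 := by
  induction w with
  | nil => rfl
  | snoc w x ih => rw [ssum_snoc, ih, add_zero]

theorem ssum_add {X Y : O} (w : Word H X Y) (β γ : ∀ Z, Word H X Z → Word H Z Y → M) :
    (w.ssum fun Z u v => β Z u v + γ Z u v) = w.ssum β + w.ssum γ := by
  induction w with
  | nil => rfl
  | snoc w x ih => rw [ssum_snoc, ssum_snoc, ssum_snoc, ih]; abel

theorem map_ssum {X Y : O} {F : Type*} [FunLike F M N] [AddMonoidHomClass F M N] (g : F)
    (w : Word H X Y) (β : ∀ Z, Word H X Z → Word H Z Y → M) :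
    g (w.ssum β) = w.ssum fun Z u v => g (β Z u v) := by
  induction w with
  | nil => rfl
  | snoc w x ih => rw [ssum_snoc, ssum_snoc, map_add, ih]

theorem ssum_map (g : ∀ X Y, H X Y → H' X Y) {X Y : O} (w : Word H X Y)
    (β : ∀ Z, Word H' X Z → Word H' Z Y → M) :
    (w.map g).ssum β = w.ssum fun Z u v => β Z (u.map g) (v.map g) := by
  induction w with
  | nil => rfl
  | snoc w x ih => rw [map_snoc, ssum_snoc, ssum_snoc, ih]; rfl

/-- Coassociativity of the cut comultiplication. -/
theorem ssum_ssum {X Y : O} (w : Word H X Y)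
    (F : ∀ Z W, Word H X Z → Word H Z W → Word H W Y → M) :
    (w.ssum fun W p x => p.ssum fun Z u v => F Z W u v x) =
      w.ssum fun Z u q => q.ssum fun W v x => F Z W u v x := by
  induction w with
  | nil => rfl
  | snoc w x ih =>
    rw [ssum_snoc, ssum_snoc, ssum_snoc, ih, ssum_nil]
    simp only [ssum_snoc]
    rw [ssum_add, add_assoc]

/-- A letter cannot be cut, so each cut of `p a q` falls either before `a`, inside `p`, or after
`a`, inside `q`. -/
theorem ssum_append {X Y Z W : O} (p : Word H X Y) (a : H Y Z) (q : Word H Z W)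
    (β : ∀ V, Word H X V → Word H V W → M) :
    ((p.snoc a).append q).ssum β =
      (p.ssum fun V u v => β V u ((v.snoc a).append q)) +
        q.ssum fun V u v => β V ((p.snoc a).append u) v := by
  induction q with
  | nil => rw [append_nil, ssum_snoc, add_comm]; rfl
  | snoc q x ih =>
    rw [append_snoc, ssum_snoc, ih, ssum_snoc]
    simp only [append_snoc]
    abel

theorem ssum_eq_right {X Y : O} (w : Word H X Y) (β : ∀ Z, Word H X Z → Word H Z Y → M)
    (h : ∀ Z u v, v.length ≠ 0 → β Z u v = 0) : w.ssum β = β Y w nil := by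
  cases w with
  | nil => rfl
  | snoc w x =>
    rw [ssum_snoc, ssum_congr w (γ := fun _ _ _ => 0) fun Z u v _ => h _ _ _ (by simp), ssum_zero,
      add_zero]

theorem ssum_eq_left {X Y : O} (w : Word H X Y) (β : ∀ Z, Word H X Z → Word H Z Y → M)
    (h : ∀ Z u v, u.length ≠ 0 → β Z u v = 0) : w.ssum β = β X nil w := by
  induction w with
  | nil => rfl
  | snoc w x ih =>
    rw [ssum_snoc, h _ _ _ (by simp), zero_add, ih]
    exact fun Z u v hu => h _ _ _ hu

/-- The factorization of a word whose first factor has `a` letters. -/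
def cutAt {X : O} : {Y : O} → Word H X Y → ℕ → Σ Z, Word H X Z × Word H Z Y
  | _, nil, _ => ⟨X, nil, nil⟩
  | Y, snoc w x, a =>
    if w.length + 1 ≤ a then ⟨Y, snoc w x, nil⟩
    else ⟨(w.cutAt a).1, (w.cutAt a).2.1, (w.cutAt a).2.2.snoc x⟩

/-- Cuts are indexed by their position, so that sums over factorizations can be compared with sums
over blocks of children of a vertex. -/
theorem ssum_eq_sum_range {X Y : O} (w : Word H X Y) (β : ∀ Z, Word H X Z → Word H Z Y → M) :
    w.ssum β = ∑ a ∈ Finset.range (w.length + 1),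
      β (w.cutAt a).1 (w.cutAt a).2.1 (w.cutAt a).2.2 := by
  induction w with
  | nil => simp [ssum_nil, cutAt]
  | snoc w x ih =>
    rw [ssum_snoc, length_snoc, Finset.sum_range_succ, ih, add_comm]
    congr 1
    · refine Finset.sum_congr rfl fun a ha => ?_
      have : ¬ (w.length + 1 ≤ a) := by simpa using ha
      rw [cutAt, if_neg this]
    · rw [cutAt, if_pos le_rfl]

theorem cutAt_append {X Y Z : O} (u : Word H X Y) (v : Word H Y Z) :
    (u.append v).cutAt u.length = ⟨Y, u, v⟩ := by
  induction v with
  | nil => cases u <;> simp [cutAt]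
  | snoc v x ih =>
    rw [append_snoc, cutAt, if_neg (by simp), ih]

theorem exists_append {X Y : O} (w : Word H X Y) {a b : ℕ} (h : w.length = a + b) :
    ∃ (Z : O) (u : Word H X Z) (v : Word H Z Y), u.append v = w ∧ u.length = a ∧ v.length = b := by
  induction w generalizing b with
  | nil =>
    simp only [length_nil] at h
    exact ⟨X, nil, nil, rfl, by simp; omega, by simp; omega⟩
  | snoc w x ih =>
    rcases b with _ | b
    · exact ⟨_, snoc w x, nil, rfl, by simpa using h, rfl⟩
    · obtain ⟨Z, u, v, e, hu, hv⟩ := ih (b := b) (by simp at h; omega)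
      exact ⟨Z, u, v.snoc x, by simp [e], hu, by simp [hv]⟩

/-- The total degree of a word with respect to a degree function on letters. -/
def deg (dg : ∀ X Y, H X Y → ℤ) {X Y : O} : Word H X Y → ℤ
  | nil => 0
  | snoc w x => w.deg dg + dg _ _ x

@[simp] theorem deg_nil (dg : ∀ X Y, H X Y → ℤ) {X : O} : (nil : Word H X X).deg dg = 0 := rfl

@[simp] theorem deg_snoc (dg : ∀ X Y, H X Y → ℤ) {X Y Z : O} (w : Word H X Z) (x : H Z Y) :
    (snoc w x).deg dg = w.deg dg + dg _ _ x := rfl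

@[simp] theorem deg_append (dg : ∀ X Y, H X Y → ℤ) {X Y Z : O} (u : Word H X Y)
    (v : Word H Y Z) : (u.append v).deg dg = u.deg dg + v.deg dg := by
  induction v with
  | nil => simp
  | snoc w x ih => simp only [append_snoc, deg_snoc, ih, add_assoc]

end Word

/-! ## The tensor coalgebra of a quiver -/

section TT

variable {k : Type u} [CommRing k] {O P : Type u} (A : GQuiv k O)

/-- The direct sum of all tensor powers. -/
abbrev TT (X Y : O) : Type u := ⨁ n, (pow A n).Hom X Y

/-- The inclusion of a tensor power. -/
def tin (n : ℕ) (X Y : O) : (pow A n).Hom X Y →ₗ[k] TT A X Y :=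
  DirectSum.lof k ℕ (fun n => (pow A n).Hom X Y) n

variable {A}

/-- The linear map out of `TT A X Y` given by a family of linear maps. -/
def tout {X Y : O} {M : Type*} [AddCommGroup M] [Module k M]
    (g : ∀ n, (pow A n).Hom X Y →ₗ[k] M) : TT A X Y →ₗ[k] M :=
  DirectSum.toModule k ℕ M g

@[simp] theorem tout_tin {X Y : O} {M : Type*} [AddCommGroup M] [Module k M]
    (g : ∀ n, (pow A n).Hom X Y →ₗ[k] M) (n : ℕ) (x) : tout g (tin A n X Y x) = g n x :=
  DirectSum.toModule_lof (R := k) (ι := ℕ) (M := fun n => (pow A n).Hom X Y) (φ := g) n x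

theorem tt_ext_tin {X Y : O} {M : Type*} [AddCommGroup M] [Module k M] {g h : TT A X Y →ₗ[k] M}
    (e : ∀ n x, g (tin A n X Y x) = h (tin A n X Y x)) : g = h :=
  DirectSum.linearMap_ext _ fun n => LinearMap.ext fun x => e n x

theorem tin_castPow {m n : ℕ} (h : m = n) (X Y : O) (x : (pow A m).Hom X Y) :
    tin A n X Y (castPow A h X Y x) = tin A m X Y x := by
  subst h; rfl

open Classical in
@[simp] theorem tlift_tmk {A B : GQuiv k O} {X Y Z : O} {M : Type u} [AddCommGroup M] [Module k M]
    (g : ∀ Z, A.Hom X Z →ₗ[k] B.Hom Z Y →ₗ[k] M) (a : A.Hom X Z) (b : B.Hom Z Y) :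
    tlift g (tmk A B X Z Y (a ⊗ₜ b)) = g Z a b := by
  exact (DirectSum.toModule_lof (R := k) (ι := O) (M := fun Z => A.Hom X Z ⊗[k] B.Hom Z Y)
    (φ := fun Z => TensorProduct.lift (g Z)) Z (a ⊗ₜ b)).trans (TensorProduct.lift.tmul a b)

@[simp] theorem tmap_tmk {φ : O → P} {A A' : GQuiv k O} {B B' : GQuiv k P} (f : QHom φ A B)
    (g : QHom φ A' B') {X Y Z : O} (a : A.Hom X Z) (b : A'.Hom Z Y) :
    tmap f g X Y (tmk A A' X Z Y (a ⊗ₜ b)) = tmk B B' _ _ _ (f X Z a ⊗ₜ g Z Y b) := by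
  simp [tmap]

@[simp] theorem tassoc_tmk {A B C : GQuiv k O} {X Y Z W : O} (a : A.Hom X Z) (b : B.Hom Z W)
    (c : C.Hom W Y) : tassoc A B C X Y (tmk _ _ X W Y (tmk _ _ X Z W (a ⊗ₜ b) ⊗ₜ c)) =
      tmk _ _ X Z Y (a ⊗ₜ tmk _ _ Z W Y (b ⊗ₜ c)) := by
  simp [tassoc]

@[simp] theorem tassocInv_tmk {A B C : GQuiv k O} {X Y Z W : O} (a : A.Hom X Z) (b : B.Hom Z W)
    (c : C.Hom W Y) : tassocInv A B C X Y (tmk _ _ X Z Y (a ⊗ₜ tmk _ _ Z W Y (b ⊗ₜ c))) =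
      tmk _ _ X W Y (tmk _ _ X Z W (a ⊗ₜ b) ⊗ₜ c) := by
  simp [tassocInv]

theorem unitElim_one {X : O} {M : Type u} [AddCommGroup M] [Module k M] (g : X = X → M) :
    unitElim g (unitOne (k := k) X) = g rfl := by
  rw [unitElim, dif_pos rfl]
  exact one_smul k _

@[simp] theorem runit_tmk {X Y : O} (a : A.Hom X Y) :
    runit A X Y (tmk A (unit k O) X Y Y (a ⊗ₜ unitOne Y)) = a := by
  rw [runit, tlift_tmk, LinearMap.flip_apply, unitElim_one]; rfl

/-- The unit element of `T⁰A`. -/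
def pone (A : GQuiv k O) (X : O) : (pow A 0).Hom X X := unitOne X

/-- The product `TⁿA(X, Z) ⊗ A(Z, Y) → Tⁿ⁺¹A(X, Y)`. -/
def psnoc {n : ℕ} {X Z Y : O} : (pow A n).Hom X Z →ₗ[k] A.Hom Z Y →ₗ[k] (pow A (n + 1)).Hom X Y :=
  TensorProduct.curry (tmk (pow A n) A X Z Y)

theorem ofPowOne_psnoc {X Y : O} (a : A.Hom X Y) : ofPowOne A X Y (psnoc (pone A X) a) = a := by
  refine (tlift_tmk (A := unit k O) (B := A) (M := A.Hom X Y) _ (unitOne X) a).trans ?_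
  rw [unitElim_one]; rfl

/-- T⁰(X, Y) vanishes unless X = Y. The predicate depends on the endpoint so that the diagonal case
can be stated at X without transport. -/
theorem pow_zero_cases {X Y : O} (z : (pow A 0).Hom X Y) {p : ∀ Y, (pow A 0).Hom X Y → Prop}
    (h0 : p Y 0) (h1 : ∀ c : k, p X (c • pone A X)) : p Y z := by
  by_cases h : X = Y
  · subst h
    have e : z = (show k from (show PLift (X = X) → k from z) ⟨rfl⟩) • pone A X := by
      refine @funext (PLift (X = X)) (fun _ => k) z _ fun ⟨_⟩ => ?_
      exact (mul_one _).symm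
    rw [e]; exact h1 _
  · have e : z = 0 := @funext (PLift (X = Y)) (fun _ => k) z _ fun ⟨h'⟩ => absurd h' h
    rw [e]; exact h0

@[simp] theorem unitMap_one (φ : O → P) (X : O) :
    unitMap φ X X (unitOne (k := k) X) = unitOne (φ X) := by
  rw [unitMap, unitElim_one]

/-- The element `1` of the tensor coalgebra. -/
def tone (A : GQuiv k O) (X : O) : TT A X X := tin A 0 X X (pone A X)

/-- Multiplication by a letter. -/
def tsnoc {X Z Y : O} : TT A X Z →ₗ[k] A.Hom Z Y →ₗ[k] TT A X Y :=
  tout fun n => psnoc.compr₂ (tin A (n + 1) X Y)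

theorem tsnoc_tin {X Z Y : O} (n : ℕ) (a : (pow A n).Hom X Z) (x : A.Hom Z Y) :
    tsnoc (tin A n X Z a) x = tin A (n + 1) X Y (psnoc a x) := by
  rw [tsnoc, tout_tin, LinearMap.compr₂_apply]

/-- The product of a word. -/
def ev {X : O} : {Y : O} → (w : Word A.Hom X Y) → (pow A w.length).Hom X Y
  | _, .nil => pone A X
  | _, .snoc w x => psnoc (ev w) x

/-- The product of a word in the tensor coalgebra. -/
def Ev {X : O} : {Y : O} → (w : Word A.Hom X Y) → TT A X Y
  | _, .nil => tone A X
  | _, .snoc w x => tsnoc (Ev w) x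

@[simp] theorem Ev_nil {X : O} : Ev (Word.nil : Word A.Hom X X) = tone A X := rfl
@[simp] theorem Ev_snoc {X Y Z : O} (w : Word A.Hom X Z) (x : A.Hom Z Y) :
    Ev (w.snoc x) = tsnoc (Ev w) x := rfl

theorem Ev_eq_tin {X Y : O} (w : Word A.Hom X Y) : Ev w = tin A w.length X Y (ev w) := by
  induction w with
  | nil => rfl
  | snoc w x ih => rw [Ev_snoc, ih, tsnoc_tin]; rfl

/-- A family of homogeneous letters generating the homogeneous components of a quiver. -/
structure Letters (A : GQuiv k O) where
  H : O → O → Type u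
  el : (X Y : O) → H X Y → A.Hom X Y
  dg : (X Y : O) → H X Y → ℤ
  mem : ∀ (X Y : O) x, el X Y x ∈ A.gr X Y (dg X Y x)
  span : ∀ (X Y : O) d, A.gr X Y d ≤ Submodule.span k {y | ∃ x, dg X Y x = d ∧ el X Y x = y}

/-- All homogeneous elements. -/
def homLetters (A : GQuiv k O) : Letters A where
  H X Y := Σ d, A.gr X Y d
  el X Y x := x.2
  dg X Y x := x.1
  mem X Y x := x.2.2
  span X Y d x hx := Submodule.subset_span ⟨⟨d, x, hx⟩, rfl, rfl⟩

theorem psnoc_mem {n : ℕ} {X Z Y : O} {i j : ℤ} {a : (pow A n).Hom X Z} {b : A.Hom Z Y}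
    (ha : a ∈ (pow A n).gr X Z i) (hb : b ∈ A.gr Z Y j) :
    psnoc a b ∈ (pow A (n + 1)).gr X Y (i + j) := by
  change tmk (pow A n) A X Z Y (a ⊗ₜ b) ∈ tensGr (pow A n) A X Y (i + j)
  exact Submodule.subset_span ⟨Z, i, j, a, b, ha, hb, rfl, rfl⟩

theorem ev_mem (L : Letters A) {X Y : O} (w : Word L.H X Y) :
    ev (w.map L.el) ∈ (pow A (w.map L.el).length).gr X Y (w.deg L.dg) := by
  induction w with
  | nil =>
    change unitOne X ∈ (if (0 : ℤ) = 0 then ⊤ else ⊥ : Submodule k ((unit k O).Hom X X))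
    rw [if_pos rfl]; exact Submodule.mem_top
  | snoc w x ih => exact psnoc_mem ih (L.mem _ _ x)

/-- Products of homogeneous letters span each homogeneous component. This reduces all later
statements about degrees to words. -/
theorem tin_mem_span (L : Letters A) (n : ℕ) (X Y : O) (d : ℤ) (z : (pow A n).Hom X Y)
    (hz : z ∈ (pow A n).gr X Y d) : tin A n X Y z ∈
      Submodule.span k {y | ∃ w : Word L.H X Y, w.length = n ∧ w.deg L.dg = d ∧
        Ev (w.map L.el) = y} := by
  induction n generalizing Y d with
  | zero =>
    by_cases hd : d = 0
    · subst hd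
      refine pow_zero_cases z (p := fun Y z => tin A 0 X Y z ∈ Submodule.span k {y |
        ∃ w : Word L.H X Y, w.length = 0 ∧ w.deg L.dg = 0 ∧ Ev (w.map L.el) = y}) ?_ fun c => ?_
      · rw [map_zero]; exact Submodule.zero_mem _
      · rw [map_smul]
        exact Submodule.smul_mem _ _ (Submodule.subset_span ⟨.nil, rfl, rfl, rfl⟩)
    · have hz0 : z = 0 := by
        change z ∈ (if d = 0 then ⊤ else ⊥ : Submodule k ((unit k O).Hom X Y)) at hz
        rw [if_neg hd] at hz
        exact hz
      rw [hz0, map_zero]; exact Submodule.zero_mem _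
  | succ n ih =>
    induction hz using Submodule.span_induction with
    | zero => rw [map_zero]; exact Submodule.zero_mem _
    | add x y _ _ hx hy => rw [map_add]; exact Submodule.add_mem _ hx hy
    | smul c x _ hx => rw [map_smul]; exact Submodule.smul_mem _ _ hx
    | mem x hx =>
      obtain ⟨Z, i, j, a, b, ha, hb, rfl, rfl⟩ := hx
      change tin A (n + 1) X Y (psnoc a b) ∈ _
      rw [← tsnoc_tin]
      refine LinearMap.BilinMap.apply_apply_mem_of_mem_span _ _ _ _ ?_ _ _ (ih Z i a ha)
        (L.span _ _ _ hb)
      rintro _ ⟨w, rfl, rfl, rfl⟩ _ ⟨y, rfl, rfl⟩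
      exact Submodule.subset_span ⟨w.snoc y, rfl, rfl, rfl⟩

/-- The homogeneous components of the tensor coalgebra. -/
def tgr (A : GQuiv k O) (X Y : O) (d : ℤ) : Submodule k (TT A X Y) :=
  ⨆ n, ((pow A n).gr X Y d).map (tin A n X Y)

theorem tin_mem_tgr {n : ℕ} {X Y : O} {d : ℤ} {z : (pow A n).Hom X Y}
    (hz : z ∈ (pow A n).gr X Y d) : tin A n X Y z ∈ tgr A X Y d :=
  Submodule.mem_iSup_of_mem n (Submodule.mem_map_of_mem hz)

theorem Ev_mem_tgr (L : Letters A) {X Y : O} (w : Word L.H X Y) :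
    Ev (w.map L.el) ∈ tgr A X Y (w.deg L.dg) := by
  rw [Ev_eq_tin]; exact tin_mem_tgr (ev_mem L w)

theorem tin_mem_span_length (L : Letters A) (n : ℕ) (X Y : O) (z : (pow A n).Hom X Y) :
    tin A n X Y z ∈
      Submodule.span k {y | ∃ w : Word L.H X Y, w.length = n ∧ Ev (w.map L.el) = y} := by
  induction z using hom_induction with
  | h0 => rw [map_zero]; exact Submodule.zero_mem _
  | ha x y hx hy => rw [map_add]; exact Submodule.add_mem _ hx hy
  | hh d x hx =>
    refine Submodule.span_mono ?_ (tin_mem_span L n X Y d x hx)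
    rintro _ ⟨w, h1, -, h2⟩
    exact ⟨w, h1, h2⟩

/-- The main tool for proving identities: linear maps out of the tensor coalgebra are compared on
words of letters chosen for the purpose. -/
theorem tt_ext_letters (L : Letters A) {X Y : O} {M : Type*} [AddCommGroup M] [Module k M]
    {g h : TT A X Y →ₗ[k] M}
    (e : ∀ w : Word L.H X Y, g (Ev (w.map L.el)) = h (Ev (w.map L.el))) : g = h := by
  refine tt_ext_tin fun n x => ?_
  refine LinearMap.eqOn_span' (f := g) (g := h) ?_ (tin_mem_span_length L n X Y x)
  rintro _ ⟨w, -, rfl⟩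
  exact e w

theorem tt_ext {X Y : O} {M : Type*} [AddCommGroup M] [Module k M]
    {g h : TT A X Y →ₗ[k] M} (e : ∀ w : Word A.Hom X Y, g (Ev w) = h (Ev w)) : g = h :=
  tt_ext_letters (homLetters A) fun w => e _

/-! ### Multiplication -/

/-- Concatenation as a bilinear map. -/
def pcat {r s : ℕ} {X Z Y : O} :
    (pow A r).Hom X Z →ₗ[k] (pow A s).Hom Z Y →ₗ[k] (pow A (r + s)).Hom X Y :=
  TensorProduct.curry (cat A r s X Y ∘ₗ tmk (pow A r) (pow A s) X Z Y)

theorem cat_tmk {r s : ℕ} {X Z Y : O} (a : (pow A r).Hom X Z) (b : (pow A s).Hom Z Y) :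
    cat A r s X Y (tmk (pow A r) (pow A s) X Z Y (a ⊗ₜ b)) = pcat a b := rfl

theorem pcat_pone {r : ℕ} {X Y : O} (a : (pow A r).Hom X Y) : pcat a (pone A Y) = a :=
  runit_tmk a

theorem pcat_psnoc {r s : ℕ} {X Z W Y : O} (a : (pow A r).Hom X Z) (b : (pow A s).Hom Z W)
    (x : A.Hom W Y) : pcat a (psnoc b x) = psnoc (pcat a b) x := by
  change tmap (cat A r s) (idMap A) X Y (tassocInv (pow A r) (pow A s) A X Y
    (tmk _ _ X Z Y (a ⊗ₜ tmk _ _ Z W Y (b ⊗ₜ x)))) = _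
  rw [tassocInv_tmk, tmap_tmk]; rfl

/-- The multiplication of the tensor algebra. -/
def tmul {X Z Y : O} : TT A X Z →ₗ[k] TT A Z Y →ₗ[k] TT A X Y :=
  tout fun r => (tout fun s => (pcat.compr₂ (tin A (r + s) X Y)).flip).flip

theorem tmul_tin {X Z Y : O} (r s : ℕ) (a : (pow A r).Hom X Z) (b : (pow A s).Hom Z Y) :
    tmul (tin A r X Z a) (tin A s Z Y b) =
      tin A (r + s) X Y (pcat a b) := by
  rw [tmul, tout_tin, LinearMap.flip_apply, tout_tin, LinearMap.flip_apply,
    LinearMap.compr₂_apply]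

@[simp] theorem tmul_tone {X Y : O} (a : TT A X Y) : tmul a (tone A Y) = a := by
  have : tmul.flip (tone A Y) = (LinearMap.id : TT A X Y →ₗ[k] TT A X Y) := by
    refine tt_ext_tin fun n x => ?_
    rw [LinearMap.flip_apply, tone, tmul_tin]
    exact congrArg _ (pcat_pone x)
  exact LinearMap.congr_fun this a

@[simp] theorem tmul_tsnoc {X Y Z W : O} (a : TT A X Y) (b : TT A Y Z) (x : A.Hom Z W) :
    tmul a (tsnoc b x) = tsnoc (tmul a b) x := by
  have : tmul.compl₂ (tsnoc.flip x) =
      (tmul (A := A) (X := X) (Z := Y) (Y := Z)).compr₂ (tsnoc.flip x) := by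
    refine tt_ext_tin fun r a => tt_ext_tin fun s b => ?_
    simp only [LinearMap.compl₂_apply, LinearMap.compr₂_apply, LinearMap.flip_apply, tsnoc_tin,
      tmul_tin]
    exact congrArg (tin A (r + s + 1) X W) (pcat_psnoc a b x)
  exact LinearMap.congr_fun₂ this a b

theorem Ev_append {X Y Z : O} (u : Word A.Hom X Y) (v : Word A.Hom Y Z) :
    Ev (u.append v) = tmul (Ev u) (Ev v) := by
  induction v with
  | nil => simp
  | snoc v x ih => simp [ih]

theorem tmul_assoc {X Y Z W : O} (a : TT A X Y) (b : TT A Y Z) (c : TT A Z W) :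
    tmul (tmul a b) c = tmul a (tmul b c) := by
  have : tmul (tmul a b) = (tmul a ∘ₗ tmul b : TT A Z W →ₗ[k] TT A X W) := by
    refine tt_ext fun w => ?_
    induction w with
    | nil => simp
    | snoc w x ih =>
      have ih' := ih (Ev w)
      rw [LinearMap.comp_apply] at ih'
      simp only [Ev_snoc, tmul_tsnoc, ih', LinearMap.comp_apply]
  exact LinearMap.congr_fun this c

/-- A letter as an element of the tensor algebra. -/
def tlet {X Y : O} : A.Hom X Y →ₗ[k] TT A X Y := tsnoc (tone A X)

theorem tmul_tlet {X Y Z : O} (a : TT A X Y) (x : A.Hom Y Z) : tmul a (tlet x) = tsnoc a x := by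
  simp [tlet]

theorem tlet_eq_tin {X Y : O} (x : A.Hom X Y) : tlet x = tin A 1 X Y (toPowOne A X Y x) := by
  rw [tlet, tone, tsnoc_tin]; rfl

end TT

end GQuiv

namespace GQuiv

section Coalgebra

variable {k : Type u} [CommRing k] {O P : Type u} {A : GQuiv k O} {B : GQuiv k P}

/-! ### Signs -/

/-- The sign `(-1) ^ d`. -/
def sg (k : Type u) [CommRing k] (d : ℤ) : k := ((d.negOnePow : ℤ) : k)

theorem sg_add (a b : ℤ) : sg k (a + b) = sg k a * sg k b := by
  simp [sg, Int.negOnePow_add]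

@[simp] theorem sg_zero : sg k 0 = 1 := by simp [sg]

@[simp] theorem sg_one : sg k 1 = -1 := by simp [sg]

theorem sg_natCast (n : ℕ) : sg k n = (-1) ^ n := by
  induction n with
  | zero => simp
  | succ n ih => rw [Nat.cast_succ, sg_add, ih, sg_one, pow_succ]

theorem sg_eq_of_even {a b : ℤ} (h : Even (a - b)) : sg k a = sg k b := by
  rw [← sub_add_cancel a b, sg_add, sg, Int.negOnePow_even _ h]; simp

theorem sg_eq_neg_of_odd {a b : ℤ} (h : Odd (a - b)) : sg k a = -sg k b := by
  rw [← sub_add_cancel a b, sg_add, sg, Int.negOnePow_odd _ h]; simp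

theorem sg_mul_self (a : ℤ) : sg k a * sg k a = 1 := by
  rw [← sg_add, ← sg_zero (k := k)]; exact sg_eq_of_even ⟨a, by ring⟩

theorem eps_eq (A : GQuiv k O) {X Y : O} {d : ℤ} {x : A.Hom X Y} (hx : x ∈ A.gr X Y d) :
    A.eps X Y x = sg k d • x := by
  rw [eps_of_mem A X Y d x hx, sg, Int.cast_smul_eq_zsmul]

theorem eps_eps (A : GQuiv k O) {X Y : O} (x : A.Hom X Y) : A.eps X Y (A.eps X Y x) = x := by
  induction x using hom_induction with
  | h0 => simp
  | ha x y hx hy => rw [map_add, map_add, hx, hy]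
  | hh d x hx => rw [eps_eq A hx, map_smul, eps_eq A hx, smul_smul, sg_mul_self, one_smul]

theorem eps_mem (A : GQuiv k O) {X Y : O} {d : ℤ} {x : A.Hom X Y} (hx : x ∈ A.gr X Y d) :
    A.eps X Y x ∈ A.gr X Y d := by
  rw [eps_eq A hx]; exact Submodule.smul_mem _ _ hx

theorem eps_pone (X : O) : (pow A 0).eps X X (pone A X) = pone A X := by
  have : pone A X ∈ (pow A 0).gr X X 0 := ev_mem (homLetters A) (.nil : Word _ X X)
  rw [eps_eq _ this, sg_zero, one_smul]

theorem eps_psnoc {n : ℕ} {X Z Y : O} (a : (pow A n).Hom X Z) (x : A.Hom Z Y) :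
    (pow A (n + 1)).eps X Y (psnoc a x) = psnoc ((pow A n).eps X Z a) (A.eps Z Y x) := by
  induction a using hom_induction with
  | h0 => simp
  | ha a b ha hb => simp only [map_add, LinearMap.add_apply, ha, hb]
  | hh i a ha =>
    induction x using hom_induction with
    | h0 => simp
    | ha x y hx hy => simp only [map_add, hx, hy]
    | hh j x hx =>
      rw [eps_eq _ (psnoc_mem ha hx), eps_eq _ ha, eps_eq _ hx, map_smul,
        map_smul psnoc, LinearMap.smul_apply, smul_smul, sg_add, mul_comm]

/-- The parity operator of the tensor coalgebra. -/
def teps (X Y : O) : TT A X Y →ₗ[k] TT A X Y := tout fun n => tin A n X Y ∘ₗ (pow A n).eps X Y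

@[simp] theorem teps_tone (X : O) : teps X X (tone A X) = tone A X := by
  rw [tone, teps, tout_tin, LinearMap.comp_apply, eps_pone]

@[simp] theorem teps_tsnoc {X Z Y : O} (z : TT A X Z) (x : A.Hom Z Y) :
    teps X Y (tsnoc z x) = tsnoc (teps X Z z) (A.eps Z Y x) := by
  have : teps X Y ∘ₗ tsnoc.flip x = tsnoc.flip (A.eps Z Y x) ∘ₗ teps X Z := by
    refine tt_ext_tin fun n a => ?_
    simp only [LinearMap.comp_apply, LinearMap.flip_apply, tsnoc_tin, teps, tout_tin, eps_psnoc]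
  exact LinearMap.congr_fun this z

theorem teps_Ev {X Y : O} (w : Word A.Hom X Y) : teps X Y (Ev w) = Ev (w.map fun _ _ x => A.eps _ _ x) := by
  induction w with
  | nil => simp
  | snoc w x ih => simp [ih]

theorem teps_tmul {X Z Y : O} (a : TT A X Z) (b : TT A Z Y) :
    teps X Y (tmul a b) = tmul (teps X Z a) (teps Z Y b) := by
  have : teps X Y ∘ₗ tmul a = tmul (teps X Z a) ∘ₗ teps Z Y := by
    refine tt_ext fun w => ?_
    simp only [LinearMap.comp_apply]
    induction w with
    | nil => simp
    | snoc w x ih => simp [ih (Ev w)]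
  exact LinearMap.congr_fun this b

theorem teps_teps {X Y : O} (z : TT A X Y) : teps X Y (teps X Y z) = z := by
  have : teps X Y ∘ₗ teps X Y = (LinearMap.id : TT A X Y →ₗ[k] TT A X Y) := by
    refine tt_ext_tin fun n a => ?_
    simp only [LinearMap.comp_apply, teps, tout_tin, eps_eps, LinearMap.id_apply]
  exact LinearMap.congr_fun this z

/-! ### The cut comultiplication -/

open Classical in
theorem tens_ext {A B : GQuiv k O} {X Y : O} {M : Type*} [AddCommGroup M] [Module k M]
    {g h : (tens A B).Hom X Y →ₗ[k] M}
    (e : ∀ Z (a : A.Hom X Z) (b : B.Hom Z Y), g (tmk A B X Z Y (a ⊗ₜ b)) =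
      h (tmk A B X Z Y (a ⊗ₜ b))) : g = h :=
  DirectSum.linearMap_ext k (M := fun Z => A.Hom X Z ⊗[k] B.Hom Z Y) fun Z =>
    TensorProduct.ext' fun a b => e Z a b

/-- The linear map `∑ β(z', z'')`, where `z ↦ ∑ z' ⊗ z''` is the cut comultiplication. -/
def Dl {X Y : O} {M : Type u} [AddCommGroup M] [Module k M]
    (β : ∀ Z, TT A X Z →ₗ[k] TT A Z Y →ₗ[k] M) : TT A X Y →ₗ[k] M :=
  tout fun n => ∑ p ∈ Finset.HasAntidiagonal.antidiagonal n,
    tlift (fun Z => (β Z).compl₁₂ (tin A p.1 X Z) (tin A p.2 Z Y)) ∘ₗ comul A n p.1 p.2 X Y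

variable {M : Type u} [AddCommGroup M] [Module k M]

theorem comul_self (r s : ℕ) {X Y : O} (z : (pow A (r + s)).Hom X Y) :
    comul A (r + s) r s X Y z = cut A r s X Y z := by
  rw [comul, dif_pos rfl]; rfl

theorem comul_of_ne {n r s : ℕ} (h : r + s ≠ n) {X Y : O} (z : (pow A n).Hom X Y) :
    comul A n r s X Y z = 0 := by
  rw [comul, dif_neg h]; rfl

theorem comul_zero (n : ℕ) {X Y : O} (z : (pow A n).Hom X Y) :
    comul A n n 0 X Y z = tmk (pow A n) (pow A 0) X Y Y (z ⊗ₜ pone A Y) :=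
  comul_self n 0 z

theorem comul_succ (n r s : ℕ) {X Z Y : O} (z : (pow A n).Hom X Z) (x : A.Hom Z Y) :
    comul A (n + 1) r (s + 1) X Y (psnoc z x) =
      tassoc (pow A r) (pow A s) A X Y
        (tmk (tens (pow A r) (pow A s)) A X Z Y (comul A n r s X Z z ⊗ₜ x)) := by
  by_cases h : r + s = n
  · subst h
    refine (comul_self r (s + 1) (psnoc z x)).trans ?_
    rw [comul_self]
    exact congrArg (tassoc (pow A r) (pow A s) A X Y) (tmap_tmk (cut A r s) (idMap A) z x)
  · rw [comul_of_ne h, TensorProduct.zero_tmul, map_zero, map_zero]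
    exact comul_of_ne (by omega) _

theorem Dl_tin {X Y : O} (β : ∀ Z, TT A X Z →ₗ[k] TT A Z Y →ₗ[k] M) (n : ℕ)
    (z : (pow A n).Hom X Y) : Dl β (tin A n X Y z) =
      ∑ p ∈ Finset.HasAntidiagonal.antidiagonal n,
        tlift (fun Z => (β Z).compl₁₂ (tin A p.1 X Z) (tin A p.2 Z Y)) (comul A n p.1 p.2 X Y z) := by
  rw [Dl, tout_tin, LinearMap.sum_apply]; rfl

theorem Dl_tone {X : O} (β : ∀ Z, TT A X Z →ₗ[k] TT A Z X →ₗ[k] M) :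
    Dl β (tone A X) = β X (tone A X) (tone A X) := by
  rw [tone, Dl_tin, Finset.Nat.antidiagonal_zero, Finset.sum_singleton, comul_zero, tlift_tmk]
  rfl

/-- The cut is either behind the last letter or further to the left. With `Dl_tone` this is the
recursion that defines `Word.ssum`, hence `Dl_Ev`. -/
theorem Dl_tsnoc {X Z Y : O} (β : ∀ Z, TT A X Z →ₗ[k] TT A Z Y →ₗ[k] M) (z : TT A X Z)
    (x : A.Hom Z Y) : Dl β (tsnoc z x) = β Y (tsnoc z x) (tone A Y) +
      Dl (fun W => (β W).compl₂ (tsnoc.flip x)) z := by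
  have : Dl β ∘ₗ tsnoc.flip x = (β Y).flip (tone A Y) ∘ₗ tsnoc.flip x +
      Dl (fun W => (β W).compl₂ (tsnoc.flip x)) := by
    refine tt_ext_tin fun n z => ?_
    simp only [LinearMap.comp_apply, LinearMap.add_apply, LinearMap.flip_apply, tsnoc_tin]
    rw [Dl_tin, Dl_tin, Finset.Nat.sum_antidiagonal_succ']
    congr 1
    · rw [comul_zero, tlift_tmk]; rfl
    · refine Finset.sum_congr rfl fun p _ => ?_
      rw [comul_succ]
      generalize comul A n p.1 p.2 X Z z = q
      refine LinearMap.congr_fun (f := tlift (A := pow A p.1) (B := pow A (p.2 + 1))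
          (fun Z => (β Z).compl₁₂ (tin A p.1 X Z) (tin A (p.2 + 1) Z Y)) ∘ₗ
          tassoc (pow A p.1) (pow A p.2) A X Y ∘ₗ tmk (tens (pow A p.1) (pow A p.2)) A X Z Y ∘ₗ
          (TensorProduct.mk k _ _).flip x) (g := tlift (fun W => ((β W).compl₂
            (tsnoc.flip x)).compl₁₂ (tin A p.1 X W) (tin A p.2 W Z))) (tens_ext fun W a b => ?_) q
      refine (congrArg (tlift (A := pow A p.1) (B := pow A (p.2 + 1))
          (fun Z => (β Z).compl₁₂ (tin A p.1 X Z) (tin A (p.2 + 1) Z Y)))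
          (tassoc_tmk a b x)).trans ?_
      refine (tlift_tmk (A := pow A p.1) (B := pow A (p.2 + 1)) (M := M)
        (fun Z => (β Z).compl₁₂ (tin A p.1 X Z) (tin A (p.2 + 1) Z Y)) a (psnoc b x)).trans ?_
      rw [tlift_tmk, LinearMap.compl₁₂_apply, LinearMap.compl₁₂_apply, LinearMap.compl₂_apply,
        LinearMap.flip_apply, tsnoc_tin]
  exact LinearMap.congr_fun this z

theorem Dl_Ev {X Y : O} (w : Word A.Hom X Y) (β : ∀ Z, TT A X Z →ₗ[k] TT A Z Y →ₗ[k] M) :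
    Dl β (Ev w) = w.ssum fun Z u v => β Z (Ev u) (Ev v) := by
  induction w with
  | nil => exact Dl_tone β
  | snoc w x ih =>
    rw [Ev_snoc, Dl_tsnoc, ih, Word.ssum_snoc]; rfl

/-! ### Convolution -/

/-- Families of linear maps between tensor coalgebras. -/
abbrev LM (φ : O → P) (A : GQuiv k O) (B : GQuiv k P) : Type u :=
  ∀ X Y, TT A X Y →ₗ[k] TT B (φ X) (φ Y)

variable {φ : O → P}

/-- The convolution product. -/
def conv (g h : LM φ A B) : LM φ A B := fun X Y =>
  Dl fun Z => tmul.compl₁₂ (g X Z) (h Z Y)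

theorem conv_Ev (g h : LM φ A B) {X Y : O} (w : Word A.Hom X Y) :
    conv g h X Y (Ev w) = w.ssum fun Z u v => tmul (g X Z (Ev u)) (h Z Y (Ev v)) := by
  rw [conv, Dl_Ev]; rfl

theorem lm_ext {g h : LM φ A B} (e : ∀ X Y (w : Word A.Hom X Y), g X Y (Ev w) = h X Y (Ev w)) :
    g = h := funext fun X => funext fun Y => tt_ext (e X Y)

theorem conv_assoc (f g h : LM φ A B) : conv (conv f g) h = conv f (conv g h) := by
  refine lm_ext fun X Y w => ?_
  rw [conv_Ev, conv_Ev]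
  have h1 : ∀ Z (u : Word A.Hom X Z) (v : Word A.Hom Z Y),
      tmul (conv f g X Z (Ev u)) (h Z Y (Ev v)) = u.ssum fun W p q =>
        tmul (tmul (f X W (Ev p)) (g W Z (Ev q))) (h Z Y (Ev v)) := fun Z u v => by
    rw [conv_Ev]; exact Word.map_ssum (tmul.flip (h Z Y (Ev v))) u _
  have h2 : ∀ Z (u : Word A.Hom X Z) (v : Word A.Hom Z Y),
      tmul (f X Z (Ev u)) (conv g h Z Y (Ev v)) = v.ssum fun W p q =>
        tmul (tmul (f X Z (Ev u)) (g Z W (Ev p))) (h W Y (Ev q)) := fun Z u v => by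
    rw [conv_Ev, Word.map_ssum]; simp only [tmul_assoc]
  simp only [h1, h2]
  exact Word.ssum_ssum w fun Z W p q v =>
    tmul (tmul (f X Z (Ev p)) (g Z W (Ev q))) (h W Y (Ev v))

theorem conv_add_left (f g h : LM φ A B) : conv (f + g) h = conv f h + conv g h := by
  refine lm_ext fun X Y w => ?_
  simp only [conv_Ev, Pi.add_apply, LinearMap.add_apply, map_add, Word.ssum_add]

theorem conv_add_right (f g h : LM φ A B) : conv f (g + h) = conv f g + conv f h := by
  refine lm_ext fun X Y w => ?_
  simp only [conv_Ev, Pi.add_apply, LinearMap.add_apply, map_add, Word.ssum_add]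

theorem conv_zero_left (h : LM φ A B) : conv 0 h = 0 :=
  add_eq_left.1 (by rw [← conv_add_left, add_zero] : conv 0 h + conv 0 h = conv 0 h)

theorem conv_zero_right (h : LM φ A B) : conv h 0 = 0 :=
  add_eq_left.1 (by rw [← conv_add_right, add_zero] : conv h 0 + conv h 0 = conv h 0)

theorem conv_neg_left (f h : LM φ A B) : conv (-f) h = -conv f h :=
  eq_neg_of_add_eq_zero_left (by rw [← conv_add_left, neg_add_cancel, conv_zero_left])

theorem conv_neg_right (f h : LM φ A B) : conv f (-h) = -conv f h :=
  eq_neg_of_add_eq_zero_left (by rw [← conv_add_right, neg_add_cancel, conv_zero_right])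

theorem conv_sub_left (f g h : LM φ A B) : conv (f - g) h = conv f h - conv g h := by
  rw [sub_eq_add_neg, conv_add_left, conv_neg_left, ← sub_eq_add_neg]

/-- The unit of convolution: the identity on `T⁰` and zero on `Tⁿ`, `n > 0`. -/
def eta (φ : O → P) (A : GQuiv k O) (B : GQuiv k P) : LM φ A B := fun X Y => tout fun n =>
  match n with
  | 0 => tin B 0 (φ X) (φ Y) ∘ₗ unitMap φ X Y
  | _ + 1 => 0

@[simp] theorem eta_tone (X : O) : eta φ A B X X (tone A X) = tone B (φ X) := by
  rw [eta, tone, tout_tin]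
  exact congrArg (tin B 0 (φ X) (φ X)) (unitMap_one φ X)

@[simp] theorem eta_tsnoc {X Z Y : O} (z : TT A X Z) (x : A.Hom Z Y) :
    eta φ A B X Y (tsnoc z x) = 0 := by
  have : eta φ A B X Y ∘ₗ tsnoc.flip x = 0 := by
    refine tt_ext_tin fun n z => ?_
    rw [LinearMap.comp_apply, LinearMap.flip_apply, tsnoc_tin, eta, tout_tin]; rfl
  exact LinearMap.congr_fun this z

theorem eta_Ev_of_length_ne_zero {X Y : O} {w : Word A.Hom X Y} (h : w.length ≠ 0) :
    eta φ A B X Y (Ev w) = 0 := by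
  cases w with
  | nil => exact absurd rfl h
  | snoc w x => simp

theorem conv_eta (g : LM φ A B) : conv g (eta φ A B) = g := by
  refine lm_ext fun X Y w => ?_
  rw [conv_Ev, Word.ssum_eq_right]
  · simp
  · intro Z u v hu
    rw [eta_Ev_of_length_ne_zero hu, map_zero]

/-- Composition with a family of maps which is the identity on objects. -/
def LM.pre (g : LM φ A B) (h : LM (fun X : O => X) A A) : LM φ A B := fun X Y => g X Y ∘ₗ h X Y

/-- Composition with a family of maps which is the identity on objects. -/
def LM.post (g : LM (fun X : P => X) B B) (h : LM φ A B) : LM φ A B := fun X Y =>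
  g (φ X) (φ Y) ∘ₗ h X Y

/-- The identity. -/
def lmId (A : GQuiv k O) : LM (fun X : O => X) A A := fun _ _ => LinearMap.id

/-- The parity operator. -/
def lmEps (A : GQuiv k O) : LM (fun X : O => X) A A := fun X Y => teps X Y

theorem conv_pre_eps (g h : LM φ A B) :
    (conv g h).pre (lmEps A) = conv (g.pre (lmEps A)) (h.pre (lmEps A)) := by
  refine lm_ext fun X Y w => ?_
  change conv g h X Y (teps X Y (Ev w)) = _
  rw [teps_Ev, conv_Ev, conv_Ev, Word.ssum_map]
  simp only [← teps_Ev]; rfl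

theorem conv_post_eps (g h : LM φ A B) :
    LM.post (lmEps B) (conv g h) = conv (LM.post (lmEps B) g) (LM.post (lmEps B) h) := by
  refine lm_ext fun X Y w => ?_
  change teps _ _ (conv g h X Y (Ev w)) = _
  rw [conv_Ev, conv_Ev, Word.map_ssum]
  simp only [teps_tmul]; rfl

/-! ### Coderivations -/

/-- The family of maps `T A → A` with components `b`, as a map with values in `T B`. -/
def letMap (b : ∀ X Y, TT A X Y →ₗ[k] B.Hom (φ X) (φ Y)) : LM φ A B := fun X Y => tlet ∘ₗ b X Y

/-- The map `T A → A` with components `b n`. -/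
def total (b : ∀ n, QHom φ (pow A n) B) (X Y : O) : TT A X Y →ₗ[k] B.Hom (φ X) (φ Y) :=
  tout fun n => b n X Y

theorem total_tin (b : ∀ n, QHom φ (pow A n) B) (X Y : O) (n : ℕ) (z) :
    total b X Y (tin A n X Y z) = b n X Y z := tout_tin _ _ _

/-- The coderivation `∑ 1^{⊗ r} ⊗ b ⊗ 1^{⊗ t}` of degree `1`. -/
def coder (b : ∀ X Y, TT A X Y →ₗ[k] A.Hom X Y) : LM (fun X : O => X) A A :=
  conv (conv (lmId A) (letMap b)) (lmEps A)

/-- The cuts hidden in `ins` are expressed by multiplication in the tensor algebra. The separate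
index `a` allows the use inside a sum over an antidiagonal, where `r + m` equals the outer index
only propositionally. -/
theorem tin_ins (b : ∀ n, QMap (pow A n) A) (n r m t a : ℕ) (h : r + m = a) {X Y : O}
    (z : (pow A n).Hom X Y) : tin A (r + 1 + t) X Y (ins b n r m t X Y z) =
      tlift (fun W => tmul.compl₁₂ (tlift (fun Z => tmul.compl₁₂ (tin A r X Z)
        (tlet ∘ₗ b m Z W)) ∘ₗ comul A a r m X W) (teps W Y ∘ₗ tin A t W Y))
        (comul A n a t X Y z) := by
  subst h
  change tin A (r + 1 + t) X Y (cat A (r + 1) t X Y (tmap (φ := fun X : O => X)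
    (B := pow A (r + 1)) (QMap.then (cut A r m) (tmap (φ := fun X : O => X) (idMap (pow A r))
      (b m))) (eps (pow A t)) X Y (comul A n (r + m) t X Y z))) = _
  generalize comul A n (r + m) t X Y z = y
  refine LinearMap.congr_fun (g := tlift _) (f := tin A (r + 1 + t) X Y ∘ₗ cat A (r + 1) t X Y ∘ₗ
    tmap (φ := fun X : O => X) (B := pow A (r + 1)) (QMap.then (cut A r m)
      (tmap (φ := fun X : O => X) (idMap (pow A r)) (b m))) (eps (pow A t)) X Y)
    (tens_ext fun W y x => ?_) y
  rw [tlift_tmk, LinearMap.comp_apply, LinearMap.comp_apply, tmap_tmk, cat_tmk, ← tmul_tin,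
    LinearMap.compl₁₂_apply]
  have h2 : ∀ x, (teps W Y ∘ₗ tin A t W Y) x = tin A t W Y ((pow A t).eps W Y x) := fun x => by
    rw [LinearMap.comp_apply, teps, tout_tin]; rfl
  rw [h2, LinearMap.comp_apply, comul_self]
  congr 2
  change tin A (r + 1) X W (tmap (φ := fun X : O => X) (idMap (pow A r)) (b m) X W
    (cut A r m X W y)) = _
  generalize cut A r m X W y = y
  refine LinearMap.congr_fun (g := tlift _) (f := tin A (r + 1) X W ∘ₗ
    tmap (φ := fun X : O => X) (idMap (pow A r)) (b m) X W) (tens_ext fun Z u v => ?_) y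
  refine (congrArg (tin A (r + 1) X W) (tmap_tmk (idMap (pow A r)) (b m) u v)).trans ?_
  rw [tlift_tmk, LinearMap.compl₁₂_apply, LinearMap.comp_apply, tmul_tlet, tsnoc_tin]
  rfl

/-- The outer convolution splits off the last t factors and the inner one separates the first r
factors from the arguments of b_m. This identifies `coder` with the sums in the A∞-relations. -/
theorem coder_tin (b : ∀ n, QMap (pow A n) A) (n : ℕ) {X Y : O} (z : (pow A n).Hom X Y) :
    coder (total b) X Y (tin A n X Y z) = ∑ p ∈ Finset.HasAntidiagonal.antidiagonal n,
      ∑ q ∈ Finset.HasAntidiagonal.antidiagonal p.1,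
        tin A (q.1 + 1 + p.2) X Y (ins b n q.1 q.2 p.2 X Y z) := by
  rw [coder, conv, Dl_tin]
  refine Finset.sum_congr rfl fun p _ => ?_
  rw [Finset.sum_congr rfl fun q hq => tin_ins b n q.1 q.2 p.2 p.1
    (Finset.HasAntidiagonal.mem_antidiagonal.1 hq) z]
  generalize comul A n p.1 p.2 X Y z = y
  rw [← LinearMap.sum_apply]
  refine LinearMap.congr_fun (tens_ext fun W u x => ?_) y
  rw [LinearMap.sum_apply]
  simp only [tlift_tmk, LinearMap.compl₁₂_apply]
  rw [← LinearMap.sum_apply, ← map_sum]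
  congr 2
  rw [conv, Dl_tin]
  refine Finset.sum_congr rfl fun q _ => ?_
  rw [LinearMap.comp_apply]
  generalize comul A p.1 q.1 q.2 X W u = y
  refine LinearMap.congr_fun (tens_ext fun Z v v' => ?_) y
  simp only [tlift_tmk, LinearMap.compl₁₂_apply]
  simp only [lmId, letMap, LinearMap.comp_apply, total_tin, LinearMap.id_apply]

/-! ### Cocategory homomorphisms -/

/-- The convolution powers of `f`. -/
def convPow (f : LM φ A B) : ℕ → LM φ A B
  | 0 => eta φ A B
  | l + 1 => conv (convPow f l) f

/-- The recursion of `coeff` in l splits off the last block, exactly as the convolution power does.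
-/
theorem tin_coeff (f : ∀ n, QHom φ (pow A n) B) (l n : ℕ) {X Y : O} (z : (pow A n).Hom X Y) :
    tin B l (φ X) (φ Y) (coeff f l n X Y z) =
      convPow (letMap (total f)) l X Y (tin A n X Y z) := by
  induction l generalizing n Y with
  | zero =>
    cases n with
    | zero => rw [convPow, eta, tout_tin]; rfl
    | succ n => rw [convPow, eta, tout_tin]; exact map_zero _
  | succ l ih =>
    rw [convPow, conv, Dl_tin, coeff]
    have h1 : (∑ p ∈ Finset.HasAntidiagonal.antidiagonal n,
        QMap.then (C := pow B (l + 1)) (comul A n p.1 p.2) (tmap (coeff f l p.1) (f p.2))) X Y z =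
        ∑ p ∈ Finset.HasAntidiagonal.antidiagonal n,
        (show (pow B (l + 1)).Hom (φ X) (φ Y) from
          tmap (coeff f l p.1) (f p.2) X Y (comul A n p.1 p.2 X Y z)) := by
      rw [Finset.sum_apply, Finset.sum_apply, LinearMap.sum_apply]; rfl
    refine (congrArg (tin B (l + 1) (φ X) (φ Y)) h1).trans ?_
    rw [map_sum]
    refine Finset.sum_congr rfl fun p _ => ?_
    generalize comul A n p.1 p.2 X Y z = y
    refine LinearMap.congr_fun (f := tin B (l + 1) (φ X) (φ Y) ∘ₗ
      tmap (coeff f l p.1) (f p.2) X Y) (tens_ext fun Z u v => ?_) y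
    refine (congrArg (tin B (l + 1) (φ X) (φ Y))
      (tmap_tmk (coeff f l p.1) (f p.2) u v)).trans ?_
    rw [tlift_tmk, LinearMap.compl₁₂_apply, LinearMap.compl₁₂_apply, ← ih, letMap,
      LinearMap.comp_apply, tmul_tlet, total_tin, tsnoc_tin]
    rfl

end Coalgebra

end GQuiv

/-! ### Coderivations and cocategory homomorphisms on words. -/

namespace GQuiv

theorem Word.ssum_comm {O : Type u} {H : O → O → Type u} {M : Type*} [AddCommMonoid M]
    {X Y X' Y' : O} (y : Word H X Y) (x : Word H X' Y')
    (F : ∀ Z W, Word H X Z → Word H Z Y → Word H X' W → Word H W Y' → M) :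
    (y.ssum fun Z u v => x.ssum fun W p q => F Z W u v p q) =
      x.ssum fun W p q => y.ssum fun Z u v => F Z W u v p q := by
  induction y with
  | nil => rfl
  | snoc w a ih =>
    rw [ssum_snoc, ih, ← ssum_add]; rfl

section Coalgebra

variable {k : Type u} [CommRing k] {O P : Type u} {A : GQuiv k O} {B : GQuiv k P} {φ : O → P}

theorem letMap_Ev (b : ∀ X Y, TT A X Y →ₗ[k] B.Hom (φ X) (φ Y)) {X Y : O} (w : Word A.Hom X Y) :
    letMap b X Y (Ev w) = tlet (b X Y (Ev w)) := rfl

/-- The word obtained by applying the parity operator to all letters. -/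
abbrev Word.par {X Y : O} (w : Word A.Hom X Y) : Word A.Hom X Y := w.map fun _ _ x => A.eps _ _ x

theorem coder_Ev (b : ∀ X Y, TT A X Y →ₗ[k] A.Hom X Y) {X Y : O} (w : Word A.Hom X Y) :
    coder b X Y (Ev w) = w.ssum fun W y x => y.ssum fun Z u v =>
      Ev ((u.snoc (b Z W (Ev v))).append x.par) := by
  rw [coder, conv_Ev]
  refine Word.ssum_congr w fun W y x _ => ?_
  rw [conv_Ev]
  refine (Word.map_ssum (tmul.flip (lmEps A W Y (Ev x))) y _).trans ?_
  refine Word.ssum_congr y fun Z u v _ => ?_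
  rw [LinearMap.flip_apply, letMap_Ev, tmul_tlet, Ev_append, ← teps_Ev]; rfl

/-- The inserted value of b lies in the left or in the right factor of each cut. In the left case b
has to pass the whole right factor, which produces the parity operator there. -/
theorem conv_pre_coder (b : ∀ X Y, TT A X Y →ₗ[k] A.Hom X Y) (g h : LM φ A B) :
    (conv g h).pre (coder b) = conv (g.pre (coder b)) (h.pre (lmEps A)) +
      conv g (h.pre (coder b)) := by
  refine lm_ext fun X Y w => ?_
  change conv g h X Y (coder b X Y (Ev w)) = conv _ _ X Y (Ev w) + conv _ _ X Y (Ev w)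
  rw [coder_Ev, Word.map_ssum, conv_Ev, conv_Ev]
  -- The cuts of the word u b(v) x are those inside u and those inside x (`Word.ssum_append`);
  -- coassociativity then rearranges the two resulting sums.
  have h1 : ∀ W (y : Word A.Hom X W) (x : Word A.Hom W Y),
      conv g h X Y (y.ssum fun Z u v => Ev ((u.snoc (b Z W (Ev v))).append x.par)) =
        (y.ssum fun Z r v => r.ssum fun V p q =>
          tmul (g X V (Ev p)) (h V Y (Ev ((q.snoc (b Z W (Ev v))).append x.par)))) +
        x.ssum fun V p q => y.ssum fun Z u v =>
          tmul (g X V (Ev ((u.snoc (b Z W (Ev v))).append p.par))) (h V Y (Ev q.par)) :=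
    fun W y x => by
      rw [Word.map_ssum, ← Word.ssum_comm, ← Word.ssum_add]
      refine Word.ssum_congr y fun Z u v _ => ?_
      rw [conv_Ev, Word.ssum_append, Word.ssum_map]
  simp only [h1]
  rw [Word.ssum_add, add_comm]
  congr 1
  · rw [← Word.ssum_ssum w fun W V y p q => y.ssum fun Z u v =>
      tmul (g X V (Ev ((u.snoc (b Z W (Ev v))).append p.par))) (h V Y (Ev q.par))]
    refine Word.ssum_congr w fun V z q _ => ?_
    change _ = tmul (g X V (coder b X V (Ev z))) (h V Y (teps V Y (Ev q)))
    rw [coder_Ev, teps_Ev, Word.map_ssum]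
    refine Eq.trans ?_ (Word.map_ssum (tmul.flip (h V Y (Ev q.par))) z _).symm
    refine Word.ssum_congr z fun W y p _ => ?_
    rw [LinearMap.flip_apply, Word.map_ssum]
    exact (Word.map_ssum (tmul.flip (h V Y (Ev q.par))) y _).symm
  · have h2 : ∀ W (y : Word A.Hom X W) (x : Word A.Hom W Y),
        (y.ssum fun Z r v => r.ssum fun V p q =>
          tmul (g X V (Ev p)) (h V Y (Ev ((q.snoc (b Z W (Ev v))).append x.par)))) =
        y.ssum fun V p r => r.ssum fun Z q v =>
          tmul (g X V (Ev p)) (h V Y (Ev ((q.snoc (b Z W (Ev v))).append x.par))) :=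
      fun W y x => Word.ssum_ssum y fun V Z p q v =>
          tmul (g X V (Ev p)) (h V Y (Ev ((q.snoc (b Z W (Ev v))).append x.par)))
    simp only [h2]
    rw [Word.ssum_ssum w fun V W p r x => r.ssum fun Z q v =>
      tmul (g X V (Ev p)) (h V Y (Ev ((q.snoc (b Z W (Ev v))).append x.par)))]
    refine Word.ssum_congr w fun V p z _ => ?_
    change _ = tmul (g X V (Ev p)) (h V Y (coder b V Y (Ev z)))
    rw [coder_Ev, Word.map_ssum, Word.map_ssum]
    refine Word.ssum_congr z fun W y x _ => ?_
    rw [Word.map_ssum, Word.map_ssum]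

/-- An insertion leaves at least the inserted letter, so `coder b` has no component in T⁰. -/
theorem eta_pre_coder (b : ∀ X Y, TT A X Y →ₗ[k] A.Hom X Y) :
    (eta φ A B).pre (coder b) = 0 := by
  refine lm_ext fun X Y w => ?_
  change eta φ A B X Y (coder b X Y (Ev w)) = 0
  rw [coder_Ev, Word.map_ssum, Word.ssum_congr w (γ := fun _ _ _ => 0), Word.ssum_zero]
  intro W y x _
  rw [Word.map_ssum, Word.ssum_congr y (γ := fun _ _ _ => 0), Word.ssum_zero]
  intro Z u v _
  exact eta_Ev_of_length_ne_zero (by simp)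

theorem lmEps_pre_lmEps : (lmEps A).pre (lmEps A) = lmId A :=
  funext fun _ => funext fun _ => LinearMap.ext fun z => teps_teps z

/-- The square of an odd coderivation is a coderivation. -/
theorem coder_pre_coder (b : ∀ X Y, TT A X Y →ₗ[k] A.Hom X Y)
    (hb : (letMap (φ := fun X : O => X) b).pre (lmEps A) = -LM.post (lmEps A) (letMap b)) :
    (coder b).pre (coder b) =
      conv (conv (lmId A) ((letMap (φ := fun X : O => X) b).pre (coder b))) (lmId A) := by
  have h1 : (conv (lmId A) (letMap b)).pre (coder b) =
      -conv (coder b) (LM.post (lmEps A) (letMap b)) +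
        conv (lmId A) ((letMap (φ := fun X : O => X) b).pre (coder b)) := by
    rw [conv_pre_coder, hb, conv_neg_right]; rfl
  have h2 : (lmEps A).pre (coder b) =
      conv (conv (lmEps A) (LM.post (lmEps A) (letMap b))) (lmId A) := by
    have : (lmEps A).pre (coder b) = LM.post (lmEps A) (coder b) := rfl
    rw [this, coder, conv_post_eps, conv_post_eps]
    congr 1
    exact lmEps_pre_lmEps
  have h3 : (coder b).pre (coder b) = (conv (conv (lmId A) (letMap b)) (lmEps A)).pre (coder b) :=
    rfl
  -- The terms with two disjoint insertions form (id ⋆ b ⋆ ε) ⋆ (ε b) ⋆ id, once with each sign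
  -- because b is odd. Only the nested insertions survive.
  rw [h3, conv_pre_coder, h1, h2, lmEps_pre_lmEps, conv_add_left, conv_neg_left, coder,
    conv_assoc (conv (lmId A) (letMap b)) (lmEps A), ← conv_assoc (conv (lmId A) (letMap b))
      (conv (lmEps A) _)]
  abel

/-! ### The cocategory homomorphism with given components -/

/-- The cocategory homomorphism with components `f`. -/
def cohom (f : ∀ X Y, TT A X Y →ₗ[k] B.Hom (φ X) (φ Y)) : LM φ A B := fun X Y =>
  tout fun n => ∑ l ∈ Finset.range (n + 1), convPow (letMap f) l X Y ∘ₗ tin A n X Y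

/-- Each factor has to absorb at least one letter, because g kills T⁰. Hence the truncated sum in
`cohom` is the whole geometric series. -/
theorem convPow_eq_zero {g : LM φ A B} (hg : ∀ X, g X X (tone A X) = 0) {l : ℕ} {X Y : O}
    (w : Word A.Hom X Y) (h : w.length < l) : convPow g l X Y (Ev w) = 0 := by
  induction l generalizing Y with
  | zero => omega
  | succ l ih =>
    rw [convPow, conv_Ev, Word.ssum_congr w (γ := fun _ _ _ => 0), Word.ssum_zero]
    rintro Z u v rfl
    cases v with
    | nil => rw [Ev_nil, hg, map_zero]
    | snoc v x =>
      rw [ih u (by simp at h; omega), map_zero, LinearMap.zero_apply]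

theorem cohom_Ev {f : ∀ X Y, TT A X Y →ₗ[k] B.Hom (φ X) (φ Y)} (hf : ∀ X, f X X (tone A X) = 0)
    {X Y : O} (w : Word A.Hom X Y) {N : ℕ} (h : w.length < N) :
    cohom f X Y (Ev w) = ∑ l ∈ Finset.range N, convPow (letMap f) l X Y (Ev w) := by
  have h1 : cohom f X Y (Ev w) =
      ∑ l ∈ Finset.range (w.length + 1), convPow (letMap f) l X Y (Ev w) := by
    rw [Ev_eq_tin, cohom, tout_tin, LinearMap.sum_apply]; rfl
  rw [h1]
  refine Finset.sum_subset (Finset.range_mono h) fun l _ hl => convPow_eq_zero ?_ w ?_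
  · intro X; rw [letMap, LinearMap.comp_apply, hf, map_zero]
  · simpa using hl

/-- The equation of a geometric series. It replaces computations with sums over compositions of n by
the uniqueness principle `eq_of_eq_add_conv`. -/
theorem cohom_eq {f : ∀ X Y, TT A X Y →ₗ[k] B.Hom (φ X) (φ Y)} (hf : ∀ X, f X X (tone A X) = 0) :
    cohom f = eta φ A B + conv (cohom f) (letMap f) := by
  refine lm_ext fun X Y w => ?_
  rw [cohom_Ev hf w (N := w.length + 2) (by omega), Finset.sum_range_succ', add_comm,
    Pi.add_apply, Pi.add_apply, LinearMap.add_apply]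
  congr 1
  simp only [convPow]
  have h1 : ∑ l ∈ Finset.range (w.length + 1), conv (convPow (letMap f) l) (letMap f) =
      conv (∑ l ∈ Finset.range (w.length + 1), convPow (letMap f) l) (letMap f) :=
    (map_sum (AddMonoidHom.mk' (fun g => conv g (letMap f))
      fun a b => conv_add_left a b (letMap f)) _ _).symm
  have h2 := congrArg (fun g : LM φ A B => g X Y (Ev w)) h1
  simp only [Finset.sum_apply, LinearMap.sum_apply] at h2
  rw [h2, conv_Ev, conv_Ev]
  refine Word.ssum_congr w fun Z u v e => ?_
  rw [cohom_Ev hf u (N := w.length + 1) (by rw [← e, Word.length_append]; omega)]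
  simp only [Finset.sum_apply, LinearMap.sum_apply]

theorem cohom_Ev_eq {f : ∀ X Y, TT A X Y →ₗ[k] B.Hom (φ X) (φ Y)}
    (hf : ∀ X, f X X (tone A X) = 0) {X Y : O} (w : Word A.Hom X Y) :
    cohom f X Y (Ev w) = eta φ A B X Y (Ev w) +
      w.ssum fun Z u v => tsnoc (cohom f X Z (Ev u)) (f Z Y (Ev v)) := by
  conv_lhs => rw [cohom_eq hf]
  rw [Pi.add_apply, Pi.add_apply, LinearMap.add_apply, conv_Ev]
  simp only [letMap_Ev, tmul_tlet]

theorem cohom_tone {f : ∀ X Y, TT A X Y →ₗ[k] B.Hom (φ X) (φ Y)}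
    (hf : ∀ X, f X X (tone A X) = 0) (X : O) : cohom f X X (tone A X) = tone B (φ X) := by
  rw [← Ev_nil, cohom_Ev_eq hf, Word.ssum_nil, Ev_nil, hf, map_zero, add_zero, eta_tone]

/-- A map satisfying `u = u ⋆ g` is zero if `g` vanishes on `T⁰`. -/
theorem eq_zero_of_eq_conv {u g : LM φ A B} (hg : ∀ X, g X X (tone A X) = 0)
    (h : u = conv u g) : u = 0 := by
  have : ∀ (n : ℕ) X Y (w : Word A.Hom X Y), w.length = n → u X Y (Ev w) = 0 := by
    intro n
    induction n using Nat.strong_induction_on with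
    | _ n ih =>
      rintro X Y w rfl
      rw [h, conv_Ev, Word.ssum_congr w (γ := fun _ _ _ => 0), Word.ssum_zero]
      rintro Z p v rfl
      cases v with
      | nil => rw [Ev_nil, hg, map_zero]
      | snoc v x => rw [ih p.length (by simp) _ _ p rfl, map_zero, LinearMap.zero_apply]
  exact lm_ext fun X Y w => this _ X Y w rfl

/-- The difference satisfies d = d ⋆ g and vanishes by induction on the length, since g absorbs at
least one letter. -/
theorem eq_of_eq_add_conv {u v c g : LM φ A B} (hg : ∀ X, g X X (tone A X) = 0)
    (hu : u = c + conv u g) (hv : v = c + conv v g) : u = v := by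
  refine sub_eq_zero.1 (eq_zero_of_eq_conv hg ?_)
  rw [conv_sub_left]
  conv_lhs => rw [hu, hv]
  abel

theorem LM.pre_add (g g' : LM φ A B) (h : LM (fun X : O => X) A A) :
    (g + g').pre h = g.pre h + g'.pre h := rfl

theorem LM.post_add (g : LM (fun X : P => X) B B) (h h' : LM φ A B) :
    LM.post g (h + h') = LM.post g h + LM.post g h' :=
  funext fun X => funext fun Y => LinearMap.comp_add (h X Y) (h' X Y) (g (φ X) (φ Y))

theorem eta_pre_eps : (eta φ A B).pre (lmEps A) = eta φ A B := by
  refine lm_ext fun X Y w => ?_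
  change eta φ A B X Y (teps X Y (Ev w)) = _
  cases w with
  | nil => simp
  | snoc w x => simp

theorem eps_post_eta : LM.post (lmEps B) (eta φ A B) = eta φ A B := by
  refine lm_ext fun X Y w => ?_
  change teps _ _ (eta φ A B X Y (Ev w)) = _
  cases w with
  | nil => simp
  | snoc w x => simp

section cohom

variable {f : ∀ X Y, TT A X Y →ₗ[k] B.Hom (φ X) (φ Y)} (hf : ∀ X, f X X (tone A X) = 0)
include hf

theorem letMap_tone (X : O) : letMap f X X (tone A X) = 0 := by
  rw [letMap, LinearMap.comp_apply, hf, map_zero]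

theorem letMap_pre_eps_tone (X : O) : (letMap f).pre (lmEps A) X X (tone A X) = 0 := by
  change letMap f X X (teps X X (tone A X)) = 0
  rw [teps_tone, letMap_tone hf]

theorem cohom_pre_eps_eq : (cohom f).pre (lmEps A) =
    eta φ A B + conv ((cohom f).pre (lmEps A)) ((letMap f).pre (lmEps A)) := by
  conv_lhs => rw [cohom_eq hf]
  rw [LM.pre_add, eta_pre_eps, conv_pre_eps]

theorem eps_post_cohom (hfe : (letMap f).pre (lmEps A) = LM.post (lmEps B) (letMap f)) :
    LM.post (lmEps B) (cohom f) = (cohom f).pre (lmEps A) := by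
  refine eq_of_eq_add_conv (letMap_pre_eps_tone hf) ?_ (cohom_pre_eps_eq hf)
  conv_lhs => rw [cohom_eq hf]
  rw [LM.post_add, eps_post_eta, conv_post_eps, hfe]

/-- Both sides solve u = c + u ⋆ (f ε), where c is the convolution of `cohom f` with f ∘ `coder b`.
-/
theorem cohom_pre_coder (b : ∀ X Y, TT A X Y →ₗ[k] A.Hom X Y) :
    (cohom f).pre (coder b) =
      conv (conv (cohom f) ((letMap f).pre (coder b))) ((cohom f).pre (lmEps A)) := by
  refine eq_of_eq_add_conv (c := conv (cohom f) ((letMap f).pre (coder b)))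
    (letMap_pre_eps_tone hf) ?_ ?_
  · conv_lhs => rw [cohom_eq hf]
    rw [LM.pre_add, eta_pre_coder, conv_pre_coder, zero_add, add_comm]
  · conv_lhs => rw [cohom_pre_eps_eq hf]
    rw [conv_add_right, conv_eta, conv_assoc _ _ ((letMap f).pre (lmEps A))]

/-- Compatibility of `cohom f` with the comultiplication, by induction on the length: a cut of the
image is either behind the last block f(v) or is a cut of the image of a shorter word. -/
theorem Dl_cohom {X Y : O} (w : Word A.Hom X Y) {M : Type u} [AddCommGroup M] [Module k M]
    (β : ∀ Z, TT B (φ X) Z →ₗ[k] TT B Z (φ Y) →ₗ[k] M) :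
    Dl β (cohom f X Y (Ev w)) =
      w.ssum fun Z u v => β (φ Z) (cohom f X Z (Ev u)) (cohom f Z Y (Ev v)) := by
  induction hn : w.length using Nat.strong_induction_on generalizing Y with
  | _ n ih =>
    subst hn
    -- The right factor is expanded by its own series: its unit part gives the cut at the end, and
    -- the rest separates the last block after reordering by coassociativity.
    have hr : (w.ssum fun Z u v => β (φ Z) (cohom f X Z (Ev u)) (cohom f Z Y (Ev v))) =
        β (φ Y) (cohom f X Y (Ev w)) (tone B (φ Y)) +
          w.ssum fun W r v => r.ssum fun Z p q => β (φ Z) (cohom f X Z (Ev p))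
            (tsnoc (cohom f Z W (Ev q)) (f W Y (Ev v))) := by
      rw [Word.ssum_ssum w fun Z W p q v => β (φ Z) (cohom f X Z (Ev p))
            (tsnoc (cohom f Z W (Ev q)) (f W Y (Ev v)))]
      have h1 : (w.ssum fun Z u v => β (φ Z) (cohom f X Z (Ev u)) (eta φ A B Z Y (Ev v))) =
          β (φ Y) (cohom f X Y (Ev w)) (tone B (φ Y)) := by
        rw [Word.ssum_eq_right]
        · rw [Ev_nil, eta_tone]
        · intro Z u v hv
          rw [eta_Ev_of_length_ne_zero hv, map_zero]
      rw [← h1, ← Word.ssum_add]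
      refine Word.ssum_congr w fun Z p v _ => ?_
      rw [cohom_Ev_eq hf v, map_add, Word.map_ssum]
    rw [hr]
    cases w with
    | nil =>
      rw [Ev_nil, cohom_tone hf, Dl_tone, Word.ssum_nil, Word.ssum_nil, Ev_nil, hf, map_zero,
        map_zero, add_zero]
    | snoc w x =>
      have h2 : cohom f X Y (Ev (w.snoc x)) =
          (w.snoc x).ssum fun Z u v => tsnoc (cohom f X Z (Ev u)) (f Z Y (Ev v)) := by
        rw [cohom_Ev_eq hf, eta_Ev_of_length_ne_zero (by simp), zero_add]
      rw [h2, Word.map_ssum]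
      have h3 := (Word.map_ssum ((β (φ Y)).flip (tone B (φ Y))) (w.snoc x) fun Z u v =>
        tsnoc (cohom f X Z (Ev u)) (f Z Y (Ev v)))
      rw [LinearMap.flip_apply] at h3
      rw [h3, ← Word.ssum_add]
      refine Word.ssum_congr _ fun W u v e => ?_
      cases v with
      | nil =>
        rw [Ev_nil, hf, map_zero, map_zero, map_zero, zero_add]
        simp only [map_zero, Word.ssum_zero]
      | snoc v y =>
        rw [Dl_tsnoc, ih u.length (by rw [← e, Word.length_append]; simp) u _ rfl]
        rfl

theorem conv_post_cohom (g h : LM (fun X : P => X) B B) :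
    LM.post (conv g h) (cohom f) = conv (LM.post g (cohom f)) (LM.post h (cohom f)) := by
  refine lm_ext fun X Y w => ?_
  rw [conv_Ev]
  exact Dl_cohom hf w fun Z => tmul.compl₁₂ (g (φ X) Z) (h Z (φ Y))

theorem coder_post_cohom (hfe : (letMap f).pre (lmEps A) = LM.post (lmEps B) (letMap f))
    (b : ∀ X Y, TT B X Y →ₗ[k] B.Hom X Y) :
    LM.post (coder b) (cohom f) =
      conv (conv (cohom f) (LM.post (letMap b) (cohom f))) ((cohom f).pre (lmEps A)) := by
  rw [coder, conv_post_cohom hf, conv_post_cohom hf, eps_post_cohom hf hfe]; rfl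

/-- The failure of `cohom f` to commute with the coderivations is determined by its components. -/
theorem cohom_pre_coder_sub (hfe : (letMap f).pre (lmEps A) = LM.post (lmEps B) (letMap f))
    (b : ∀ X Y, TT A X Y →ₗ[k] A.Hom X Y) (b' : ∀ X Y, TT B X Y →ₗ[k] B.Hom X Y) :
    (cohom f).pre (coder b) - LM.post (coder b') (cohom f) =
      conv (conv (cohom f) (letMap fun X Y => f X Y ∘ₗ coder b X Y -
        b' (φ X) (φ Y) ∘ₗ cohom f X Y)) ((cohom f).pre (lmEps A)) := by
  have h1 : (letMap fun X Y => f X Y ∘ₗ coder b X Y - b' (φ X) (φ Y) ∘ₗ cohom f X Y) =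
      (letMap f).pre (coder b) + -LM.post (letMap b') (cohom f) :=
    funext fun X => funext fun Y => LinearMap.ext fun z => by
      change tlet (f X Y (coder b X Y z) - b' (φ X) (φ Y) (cohom f X Y z)) =
        tlet (f X Y (coder b X Y z)) + -tlet (b' (φ X) (φ Y) (cohom f X Y z))
      rw [map_sub, sub_eq_add_neg]
  rw [h1, conv_add_right, conv_add_left, conv_neg_right, conv_neg_left,
    ← coder_post_cohom hf hfe, ← cohom_pre_coder hf, sub_eq_add_neg]

end cohom

/-! ### The component of degree one -/

/-- The projection to `T¹A = A`. -/
def pr1 (X Y : O) : TT A X Y →ₗ[k] A.Hom X Y := tout fun n =>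
  match n with
  | 1 => ofPowOne A X Y
  | _ => 0

theorem pr1_tlet {X Y : O} (x : A.Hom X Y) : pr1 X Y (tlet x) = x := by
  rw [tlet_eq_tin, pr1, tout_tin]; exact ofPowOne_psnoc x

theorem pr1_Ev {X Y : O} (w : Word A.Hom X Y) (h : w.length ≠ 1) : pr1 X Y (Ev w) = 0 := by
  rw [Ev_eq_tin, pr1, tout_tin]
  generalize ev w = z
  revert z h
  rcases w.length with _ | _ | n
  · exact fun _ _ => rfl
  · exact fun h => absurd rfl h
  · exact fun _ _ => rfl

/-- An insertion produces a word with one letter only if b takes all letters as arguments. Hence a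
coderivation determines its components. -/
theorem pr1_coder (b : ∀ X Y, TT A X Y →ₗ[k] A.Hom X Y) {X Y : O} (z : TT A X Y) :
    pr1 X Y (coder b X Y z) = b X Y z := by
  refine LinearMap.congr_fun (f := pr1 X Y ∘ₗ coder b X Y) (tt_ext fun w => ?_) z
  rw [LinearMap.comp_apply, coder_Ev, Word.map_ssum, Word.ssum_eq_right]
  · rw [Word.map_ssum, Word.ssum_eq_left]
    · exact pr1_tlet _
    · intro Z u v hu
      exact pr1_Ev _ (by simpa using hu)
  · intro Z u v hv
    rw [Word.map_ssum, Word.ssum_congr u (γ := fun _ _ _ => 0), Word.ssum_zero]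
    intro W p q _
    exact pr1_Ev _ (by simp; omega)

end Coalgebra

end GQuiv

/-! ### Degrees of tensors and the derivation of the tensor algebra given by a differential. -/

namespace GQuiv

section Grading

variable {k : Type u} [CommRing k] {O : Type u} {A : GQuiv k O}

/-- Induction on homogeneous elements of tensor powers. -/
theorem pow_succ_induction {n : ℕ} {X Y : O} {d : ℤ} {p : (pow A (n + 1)).Hom X Y → Prop}
    {z : (pow A (n + 1)).Hom X Y} (hz : z ∈ (pow A (n + 1)).gr X Y d) (h0 : p 0)
    (ha : ∀ x y, p x → p y → p (x + y)) (hs : ∀ (c : k) x, p x → p (c • x))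
    (hp : ∀ (Z : O) (i j : ℤ) (a : (pow A n).Hom X Z) (b : A.Hom Z Y), a ∈ (pow A n).gr X Z i →
      b ∈ A.gr Z Y j → i + j = d → p (psnoc a b)) : p z := by
  induction hz using Submodule.span_induction with
  | zero => exact h0
  | add x y _ _ hx hy => exact ha x y hx hy
  | smul c x _ hx => exact hs c x hx
  | mem x hx =>
    obtain ⟨Z, i, j, a, b, ha, hb, hd, rfl⟩ := hx
    exact hp Z i j a b ha hb hd

theorem pow_zero_gr {X Y : O} {d : ℤ} {p : ∀ Y, (pow A 0).Hom X Y → Prop}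
    {z : (pow A 0).Hom X Y} (hz : z ∈ (pow A 0).gr X Y d) (h0 : p Y 0)
    (h1 : d = 0 → ∀ c : k, p X (c • pone A X)) : p Y z := by
  by_cases hd : d = 0
  · exact pow_zero_cases z h0 (h1 hd)
  · have hz0 : z = 0 := by
      change z ∈ (if d = 0 then ⊤ else ⊥ : Submodule k ((unit k O).Hom X Y)) at hz
      rw [if_neg hd] at hz
      exact hz
    rw [hz0]; exact h0

theorem pcat_mem {r s : ℕ} {X Z Y : O} {i j : ℤ} {a : (pow A r).Hom X Z} {b : (pow A s).Hom Z Y}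
    (ha : a ∈ (pow A r).gr X Z i) (hb : b ∈ (pow A s).gr Z Y j) :
    pcat a b ∈ (pow A (r + s)).gr X Y (i + j) := by
  induction s generalizing Y j with
  | zero =>
    refine pow_zero_gr (p := fun Y b => pcat a b ∈ (pow A (r + 0)).gr X Y (i + j)) hb ?_ ?_
    · rw [map_zero]; exact Submodule.zero_mem _
    · rintro rfl c
      rw [map_smul, pcat_pone, add_zero i]
      exact Submodule.smul_mem _ _ ha
  | succ s ih =>
    refine pow_succ_induction (p := fun b => pcat a b ∈ (pow A (r + (s + 1))).gr X Y (i + j)) hb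
      ?_ ?_ ?_ ?_
    · rw [map_zero]; exact Submodule.zero_mem _
    · intro x y hx hy; rw [map_add]; exact Submodule.add_mem _ hx hy
    · intro c x hx; rw [map_smul]; exact Submodule.smul_mem _ _ hx
    · rintro W i' j' b x hb' hx rfl
      rw [pcat_psnoc, ← add_assoc i]
      exact psnoc_mem (ih hb') hx

theorem castPow_mem {m n : ℕ} (h : m = n) {X Y : O} {d : ℤ} {z : (pow A m).Hom X Y}
    (hz : z ∈ (pow A m).gr X Y d) : castPow A h X Y z ∈ (pow A n).gr X Y d := by
  subst h; exact hz

theorem der_psnoc (d : QMap A A) {n : ℕ} {X Z Y : O} (a : (pow A n).Hom X Z) (x : A.Hom Z Y) :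
    der d (n + 1) X Y (psnoc a x) =
      psnoc (der d n X Z a) (A.eps Z Y x) + psnoc a (d Z Y x) := by
  change tmap (der d n) (eps A) X Y (tmk (pow A n) A X Z Y (a ⊗ₜ x)) +
    tmap (idMap (pow A n)) d X Y (tmk (pow A n) A X Z Y (a ⊗ₜ x)) = _
  rw [tmap_tmk, tmap_tmk]; rfl

theorem der_mem {d : QMap A A} (hd : HasDegree d 1) (n : ℕ) : HasDegree (der d n) 1 := by
  intro X Y i z hz
  induction n generalizing Y i with
  | zero => exact Submodule.zero_mem _
  | succ n ih =>
    refine pow_succ_induction (p := fun z => der d (n + 1) X Y z ∈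
      (pow A (n + 1)).gr X Y (i + 1)) hz ?_ ?_ ?_ ?_
    · rw [map_zero]; exact Submodule.zero_mem _
    · intro x y hx hy; rw [map_add]; exact Submodule.add_mem _ hx hy
    · intro c x hx; rw [map_smul]; exact Submodule.smul_mem _ _ hx
    · rintro Z p q a x ha hx rfl
      rw [der_psnoc]
      refine Submodule.add_mem _ ?_ ?_
      · have h := psnoc_mem (ih Z p a ha) (eps_mem A hx)
        rwa [show p + 1 + q = p + q + 1 by ring] at h
      · have h := psnoc_mem ha (hd Z Y q x hx)
        rwa [← add_assoc] at h

/-- The derivation of the tensor algebra given by a map `d` of degree `1`. -/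
def tder (d : QMap A A) (X Y : O) : TT A X Y →ₗ[k] TT A X Y :=
  tout fun n => tin A n X Y ∘ₗ der d n X Y

theorem tder_tin (d : QMap A A) (X Y : O) (n : ℕ) (z : (pow A n).Hom X Y) :
    tder d X Y (tin A n X Y z) = tin A n X Y (der d n X Y z) := by
  rw [tder, tout_tin]; rfl

theorem tder_tone (d : QMap A A) (X : O) : tder d X X (tone A X) = 0 := by
  rw [tone, tder_tin]; exact map_zero _

theorem tder_tsnoc (d : QMap A A) {X Z Y : O} (a : TT A X Z) (x : A.Hom Z Y) :
    tder d X Y (tsnoc a x) = tsnoc (tder d X Z a) (A.eps Z Y x) + tsnoc a (d Z Y x) := by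
  have : tder d X Y ∘ₗ tsnoc.flip x =
      tsnoc.flip (A.eps Z Y x) ∘ₗ tder d X Z + tsnoc.flip (d Z Y x) := by
    refine tt_ext_tin fun n a => ?_
    simp only [LinearMap.comp_apply, LinearMap.add_apply, LinearMap.flip_apply, tsnoc_tin,
      tder_tin, der_psnoc, map_add]
  exact LinearMap.congr_fun this a

theorem tder_tmul (d : QMap A A) {X Z Y : O} (a : TT A X Z) (b : TT A Z Y) :
    tder d X Y (tmul a b) = tmul (tder d X Z a) (teps Z Y b) + tmul a (tder d Z Y b) := by
  have : tder d X Y ∘ₗ tmul a = tmul (tder d X Z a) ∘ₗ teps Z Y + tmul a ∘ₗ tder d Z Y := by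
    refine tt_ext fun w => ?_
    simp only [LinearMap.comp_apply, LinearMap.add_apply]
    induction w with
    | nil => simp [tder_tone]
    | snoc w x ih =>
      simp only [Ev_snoc, tmul_tsnoc, tder_tsnoc, ih (Ev w), teps_tsnoc, map_add,
        LinearMap.add_apply, add_assoc]
  exact LinearMap.congr_fun this b

theorem teps_tin {X Y : O} {n : ℕ} {d : ℤ} {z : (pow A n).Hom X Y}
    (hz : z ∈ (pow A n).gr X Y d) : teps X Y (tin A n X Y z) = sg k d • tin A n X Y z := by
  rw [teps, tout_tin, LinearMap.comp_apply, eps_eq _ hz, map_smul]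

theorem teps_Ev_letters (L : Letters A) {X Y : O} (w : Word L.H X Y) :
    teps X Y (Ev (w.map L.el)) = sg k (w.deg L.dg) • Ev (w.map L.el) := by
  rw [Ev_eq_tin, teps_tin (ev_mem L w)]

open Classical in
theorem dlift_dinc {ι : Type} {A : ι → GQuiv k O} {X Y : O} {M : Type u} [AddCommGroup M]
    [Module k M] (g : ∀ i, (A i).Hom X Y →ₗ[k] M) (i : ι) (x : (A i).Hom X Y) :
    dlift g (dinc A i X Y x) = g i x :=
  DirectSum.toModule_lof (R := k) (ι := ι) (M := fun i => (A i).Hom X Y) (φ := g) i x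

open Classical in
theorem dsum_ext {ι : Type} {A : ι → GQuiv k O} {X Y : O} {M : Type*} [AddCommGroup M]
    [Module k M] {g h : (dsum A).Hom X Y →ₗ[k] M}
    (e : ∀ i x, g (dinc A i X Y x) = h (dinc A i X Y x)) : g = h :=
  DirectSum.linearMap_ext k (M := fun i => (A i).Hom X Y) fun i => LinearMap.ext fun x => e i x

end Grading

end GQuiv

/-! ### Trees described by the list of their subtrees. -/

namespace PTree

/-- The tree obtained by joining the trees of a list to a new lowest vertex. -/
def nodeL (l : List PTree) : PTree := if h : 2 ≤ l.length then node l.length h l.get else leaf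

theorem nodeL_eq {l : List PTree} (h : 2 ≤ l.length) : nodeL l = node l.length h l.get :=
  dif_pos h

/-- Concatenation and splitting are easier for lists than for families indexed by `Fin n`. Comparing
entries by natural number indices avoids transport between index types. -/
theorem node_eq_nodeL {n : ℕ} (h : 2 ≤ n) (c : Fin n → PTree) (l : List PTree)
    (hl : l.length = n) (hc : ∀ (i : ℕ) (hi : i < n) (hi' : i < l.length), l[i] = c ⟨i, hi⟩) :
    node n h c = nodeL l := by
  subst hl
  rw [nodeL_eq h]
  congr 1
  funext i
  exact (hc i i.2 i.2).symm

theorem node_eq_nodeL_ofFn {n : ℕ} (h : 2 ≤ n) (c : Fin n → PTree) :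
    node n h c = nodeL (List.ofFn c) :=
  node_eq_nodeL h c _ (by simp) fun i hi _ => by simp

/-- The total number of internal vertices of the trees in a list. -/
def vertsL (l : List PTree) : ℕ := (l.map verts).sum

/-- The total number of input vertices of the trees in a list. -/
def leavesL (l : List PTree) : ℕ := (l.map leaves).sum

theorem vertsL_ofFn {n : ℕ} (c : Fin n → PTree) : vertsL (List.ofFn c) = ∑ i, (c i).verts := by
  rw [vertsL, List.map_ofFn, List.sum_ofFn]; rfl

theorem leavesL_ofFn {n : ℕ} (c : Fin n → PTree) : leavesL (List.ofFn c) = ∑ i, (c i).leaves := by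
  rw [leavesL, List.map_ofFn, List.sum_ofFn]; rfl

theorem leaves_nodeL {l : List PTree} (h : 2 ≤ l.length) : (nodeL l).leaves = leavesL l := by
  rw [nodeL_eq h, leaves, ← leavesL_ofFn, List.ofFn_get]

theorem verts_nodeL {l : List PTree} (h : 2 ≤ l.length) : (nodeL l).verts = 1 + vertsL l := by
  rw [nodeL_eq h, verts, ← vertsL_ofFn, List.ofFn_get]

@[simp] theorem vertsL_append (l l' : List PTree) : vertsL (l ++ l') = vertsL l + vertsL l' := by
  simp [vertsL]

@[simp] theorem leavesL_append (l l' : List PTree) :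
    leavesL (l ++ l') = leavesL l + leavesL l' := by
  simp [leavesL]

@[simp] theorem vertsL_singleton (t : PTree) : vertsL [t] = t.verts := by simp [vertsL]

@[simp] theorem leavesL_singleton (t : PTree) : leavesL [t] = t.leaves := by simp [leavesL]

end PTree

/-! ### The operations of the free category on words of homogeneous tensors. -/

namespace FreeAInf

open PTree

variable {k : Type u} [CommRing k] {O : Type u} (Q : DGQuiv k O)

/-- The suspension `sFQ`. -/
abbrev sF : GQuiv k O := (quiv Q).shift 1

theorem sd_deg : HasDegree Q.sd 1 := by
  intro X Y d x hx
  have h := Q.d_deg X Y (d + 1) x hx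
  rw [add_right_comm] at h
  exact Submodule.neg_mem _ h

theorem lift_inc {X Y : O} {M : Type u} [AddCommGroup M] [Module k M]
    (g : ∀ t : PTree, (pow Q.s t.leaves).Hom X Y →ₗ[k] M) (t : PTree)
    (z : (pow Q.s t.leaves).Hom X Y) : lift Q g (inc Q t X Y z) = g t z :=
  dlift_dinc (A := fun t : PTree => (pow Q.s t.leaves).shift (-(t.verts : ℤ) - 1)) g t z

theorem sF_ext {X Y : O} {M : Type*} [AddCommGroup M] [Module k M]
    {g h : (sF Q).Hom X Y →ₗ[k] M}
    (e : ∀ t z, g (inc Q t X Y z) = h (inc Q t X Y z)) : g = h :=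
  dsum_ext (A := fun t : PTree => (pow Q.s t.leaves).shift (-(t.verts : ℤ) - 1)) e

open Classical in
theorem inc_mem (t : PTree) {X Y : O} {d : ℤ} {z : (pow Q.s t.leaves).Hom X Y}
    (hz : z ∈ (pow Q.s t.leaves).gr X Y d) : inc Q t X Y z ∈ (sF Q).gr X Y (d + t.verts) := by
  intro t'
  change (DirectSum.lof k PTree (fun t => (pow Q.s t.leaves).Hom X Y) t z) t' ∈
    (pow Q.s t'.leaves).gr X Y (d + t.verts + 1 + (-(t'.verts : ℤ) - 1))
  by_cases h : t = t'
  · subst h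
    rw [DirectSum.lof_apply, show d + t.verts + 1 + (-(t.verts : ℤ) - 1) = d by ring]
    exact hz
  · rw [DirectSum.lof_eq_of, DirectSum.of_eq_of_ne _ _ _ (Ne.symm h)]
    exact Submodule.zero_mem _

open Classical in
theorem sF_gr_le (X Y : O) (d : ℤ) : (sF Q).gr X Y d ≤ Submodule.span k {y | ∃ (t : PTree)
    (z : (pow Q.s t.leaves).Hom X Y), z ∈ (pow Q.s t.leaves).gr X Y (d - t.verts) ∧
      inc Q t X Y z = y} := by
  intro x hx
  have hs : x = ∑ t ∈ DFinsupp.support (β := fun t : PTree => (pow Q.s t.leaves).Hom X Y) x,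
      inc Q t X Y ((show ⨁ t : PTree, (pow Q.s t.leaves).Hom X Y from x) t) :=
    (DirectSum.sum_support_of (β := fun t : PTree => (pow Q.s t.leaves).Hom X Y) x).symm
  rw [hs]
  refine Submodule.sum_mem _ fun t _ => Submodule.subset_span ⟨t, _, ?_, rfl⟩
  have h : (show ⨁ t : PTree, (pow Q.s t.leaves).Hom X Y from x) t ∈
    (pow Q.s t.leaves).gr X Y (d + 1 + (-(t.verts : ℤ) - 1)) := hx t
  rwa [show d + 1 + (-(t.verts : ℤ) - 1) = d - t.verts by ring] at h

/-- The map `TsQ → sFQ` which is the inclusion of `sF_t Q` on `Tⁿ sQ` if `t` has `n` input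
vertices and zero otherwise. -/
def IT (t : PTree) (X Y : O) : TT Q.s X Y →ₗ[k] (sF Q).Hom X Y := tout fun n =>
  if h : n = t.leaves then inc Q t X Y ∘ₗ castPow Q.s h X Y else 0

theorem IT_tin (t : PTree) {n : ℕ} (h : n = t.leaves) {X Y : O} (z : (pow Q.s n).Hom X Y) :
    IT Q t X Y (tin Q.s n X Y z) = inc Q t X Y (castPow Q.s h X Y z) := by
  rw [IT, tout_tin, dif_pos h]; rfl

theorem IT_tin_self (t : PTree) {X Y : O} (z : (pow Q.s t.leaves).Hom X Y) :
    IT Q t X Y (tin Q.s t.leaves X Y z) = inc Q t X Y z := IT_tin Q t rfl z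

theorem IT_tin_of_ne (t : PTree) {n : ℕ} (h : n ≠ t.leaves) {X Y : O} (z : (pow Q.s n).Hom X Y) :
    IT Q t X Y (tin Q.s n X Y z) = 0 := by
  rw [IT, tout_tin, dif_neg h]; rfl

theorem b1_inc (t : PTree) {X Y : O} (z : (pow Q.s t.leaves).Hom X Y) :
    b1 Q X Y (inc Q t X Y z) = sg k t.verts • inc Q t X Y (der Q.sd t.leaves X Y z) +
      ∑ e : t.Insertion, sg k (1 + t.height e) •
        inc Q (t.insert e) X Y (castPow Q.s (t.leaves_insert e) X Y z) := by
  have h : ∀ n : ℕ, sg k (1 + n) = (-1) ^ (1 + n) := fun n => by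
    rw [← sg_natCast]; push_cast; rfl
  rw [b1, lift_inc, LinearMap.add_apply, LinearMap.smul_apply, LinearMap.sum_apply, sg_natCast]
  simp only [h]
  rfl

/-- Since `IT` is defined on all tensor powers at once, no casts between the tensor powers belonging
to t and to t + edge remain. -/
theorem b1_IT (t : PTree) {X Y : O} (z : TT Q.s X Y) :
    b1 Q X Y (IT Q t X Y z) = sg k t.verts • IT Q t X Y (tder Q.sd X Y z) +
      ∑ e : t.Insertion, sg k (1 + t.height e) • IT Q (t.insert e) X Y z := by
  have : b1 Q X Y ∘ₗ IT Q t X Y = sg k t.verts • (IT Q t X Y ∘ₗ tder Q.sd X Y) +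
      ∑ e : t.Insertion, sg k (1 + t.height e) • IT Q (t.insert e) X Y := by
    refine tt_ext_tin fun n z => ?_
    simp only [LinearMap.comp_apply, LinearMap.add_apply, LinearMap.smul_apply,
      LinearMap.sum_apply, tder_tin]
    by_cases h : n = t.leaves
    · subst h
      rw [IT_tin_self, IT_tin_self, b1_inc]
      congr 1
      exact Finset.sum_congr rfl fun e _ => by rw [IT_tin Q _ (t.leaves_insert e)]
    · rw [IT_tin_of_ne Q t h, IT_tin_of_ne Q t h, map_zero, smul_zero, zero_add, eq_comm]
      refine Finset.sum_eq_zero fun e _ => ?_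
      rw [IT_tin_of_ne Q _ (by rwa [← t.leaves_insert e]), smul_zero]
  have h := LinearMap.congr_fun this z
  simpa only [LinearMap.comp_apply, LinearMap.add_apply, LinearMap.smul_apply,
      LinearMap.sum_apply] using h

/-- Homogeneous elements of the summands `sF_t Q`. -/
structure Simp (X Y : O) where
  t : PTree
  δ : ℤ
  z : (pow Q.s t.leaves).Hom X Y
  hz : z ∈ (pow Q.s t.leaves).gr X Y δ

/-- Homogeneous elements of the summands `sF_t Q` as letters. -/
def simpLetters : Letters (sF Q) where
  H X Y := Simp Q X Y
  el X Y a := inc Q a.t X Y a.z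
  dg X Y a := a.δ + a.t.verts
  mem X Y a := inc_mem Q a.t a.hz
  span X Y d := by
    refine (sF_gr_le Q X Y d).trans (Submodule.span_mono ?_)
    rintro _ ⟨t, z, hz, rfl⟩
    exact ⟨⟨t, _, z, hz⟩, by simp, rfl⟩

/-- Words of homogeneous elements of the summands `sF_t Q`. -/
abbrev SWord (X Y : O) : Type u := Word (Simp Q) X Y

variable {Q}

/-- The word in `sFQ`. -/
def val {X Y : O} (P : SWord Q X Y) : Word (sF Q).Hom X Y := P.map (simpLetters Q).el

/-- The trees of the letters. -/
def trees {X : O} : {Y : O} → SWord Q X Y → List PTree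
  | _, .nil => []
  | _, .snoc P a => trees P ++ [a.t]

/-- The product of the letters in the tensor algebra of `sQ`. -/
def flat {X : O} : {Y : O} → SWord Q X Y → TT Q.s X Y
  | _, .nil => tone Q.s X
  | _, .snoc P a => tmul (flat P) (tin Q.s a.t.leaves _ _ a.z)

/-- The total degree in `TsFQ`. -/
def sdeg {X Y : O} (P : SWord Q X Y) : ℤ := P.deg (simpLetters Q).dg

/-- The total degree in `TsQ`. -/
def qdeg {X Y : O} (P : SWord Q X Y) : ℤ := P.deg fun _ _ a => a.δ

/-- The exponent of the sign of `s^{|t₁|} ⊗ ⋯ ⊗ s^{|tₙ|}`. -/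
def sgn {X : O} : {Y : O} → SWord Q X Y → ℤ
  | _, .nil => 0
  | _, .snoc P a => sgn P + vertsL (trees P) * (a.δ + a.t.verts)

@[simp] theorem val_nil {X : O} : val (.nil : SWord Q X X) = .nil := rfl
@[simp] theorem val_snoc {X Y Z : O} (P : SWord Q X Y) (a : Simp Q Y Z) :
    val (P.snoc a) = (val P).snoc (inc Q a.t Y Z a.z) := rfl
@[simp] theorem trees_nil {X : O} : trees (.nil : SWord Q X X) = [] := rfl
@[simp] theorem trees_snoc {X Y Z : O} (P : SWord Q X Y) (a : Simp Q Y Z) :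
    trees (P.snoc a) = trees P ++ [a.t] := rfl
@[simp] theorem flat_nil {X : O} : flat (.nil : SWord Q X X) = tone Q.s X := rfl
@[simp] theorem flat_snoc {X Y Z : O} (P : SWord Q X Y) (a : Simp Q Y Z) :
    flat (P.snoc a) = tmul (flat P) (tin Q.s a.t.leaves Y Z a.z) := rfl
@[simp] theorem sgn_nil {X : O} : sgn (.nil : SWord Q X X) = 0 := rfl
@[simp] theorem sgn_snoc {X Y Z : O} (P : SWord Q X Y) (a : Simp Q Y Z) :
    sgn (P.snoc a) = sgn P + vertsL (trees P) * (a.δ + a.t.verts) := rfl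
@[simp] theorem sdeg_nil {X : O} : sdeg (.nil : SWord Q X X) = 0 := rfl
@[simp] theorem sdeg_snoc {X Y Z : O} (P : SWord Q X Y) (a : Simp Q Y Z) :
    sdeg (P.snoc a) = sdeg P + (a.δ + a.t.verts) := rfl
@[simp] theorem qdeg_nil {X : O} : qdeg (.nil : SWord Q X X) = 0 := rfl
@[simp] theorem qdeg_snoc {X Y Z : O} (P : SWord Q X Y) (a : Simp Q Y Z) :
    qdeg (P.snoc a) = qdeg P + a.δ := rfl

@[simp] theorem val_append {X Y Z : O} (P : SWord Q X Y) (R : SWord Q Y Z) :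
    val (P.append R) = (val P).append (val R) := Word.map_append _ _ _

@[simp] theorem length_val {X Y : O} (P : SWord Q X Y) : (val P).length = P.length :=
  Word.length_map _ _

@[simp] theorem length_trees {X Y : O} (P : SWord Q X Y) : (trees P).length = P.length := by
  induction P with
  | nil => rfl
  | snoc P a ih => simp [ih]

@[simp] theorem trees_append {X Y Z : O} (P : SWord Q X Y) (R : SWord Q Y Z) :
    trees (P.append R) = trees P ++ trees R := by
  induction R with
  | nil => simp
  | snoc R a ih => simp [ih]

@[simp] theorem flat_append {X Y Z : O} (P : SWord Q X Y) (R : SWord Q Y Z) :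
    flat (P.append R) = tmul (flat P) (flat R) := by
  induction R with
  | nil => simp
  | snoc R a ih => simp [ih, tmul_assoc]

theorem sgn_append {X Y Z : O} (P : SWord Q X Y) (R : SWord Q Y Z) :
    sgn (P.append R) = sgn P + sgn R + vertsL (trees P) * sdeg R := by
  induction R with
  | nil => simp
  | snoc R a ih => simp [ih]; ring

theorem sdeg_eq {X Y : O} (P : SWord Q X Y) : sdeg P = qdeg P + vertsL (trees P) := by
  induction P with
  | nil => rfl
  | snoc P a ih => simp [ih]; ring

theorem flat_eq_tin {X Y : O} (P : SWord Q X Y) : ∃ z : (pow Q.s (leavesL (trees P))).Hom X Y,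
    z ∈ (pow Q.s (leavesL (trees P))).gr X Y (qdeg P) ∧ flat P = tin Q.s _ X Y z := by
  induction P with
  | nil => exact ⟨pone Q.s X, ev_mem (homLetters Q.s) (.nil : Word _ X X), rfl⟩
  | snoc P a ih =>
    obtain ⟨z, hz, h⟩ := ih
    refine ⟨castPow Q.s (by simp) _ _ (pcat z a.z), castPow_mem _ (pcat_mem hz a.hz), ?_⟩
    rw [tin_castPow, ← tmul_tin, ← h, flat_snoc]

/-! ### The operations on words -/

theorem eps_pow_inc {X Y : O} (a : Simp Q X Y) (n : ℕ) :
    ((sF Q).eps X Y ^ n) (inc Q a.t X Y a.z) =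
      sg k (n * (a.δ + a.t.verts)) • inc Q a.t X Y a.z := by
  induction n with
  | zero => simp
  | succ n ih =>
    rw [pow_succ', Module.End.mul_apply, ih, map_smul, eps_eq _ (inc_mem Q a.t a.hz), smul_smul,
      ← sg_add]
    congr 2
    push_cast; ring

/-- The inclusion of a summand in a sum over forests. -/
def finc {n : ℕ} (c : Fin n → PTree) (X Y : O) :
    (pow Q.s (∑ i, (c i).leaves)).Hom X Y →ₗ[k] (forest Q n).Hom X Y :=
  dinc (fun c : Fin n → PTree => pow Q.s (∑ i, (c i).leaves)) c X Y

theorem forest_ext {n : ℕ} {X Y : O} {M : Type*} [AddCommGroup M] [Module k M]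
    {g h : (forest Q n).Hom X Y →ₗ[k] M}
    (e : ∀ c y, g (finc c X Y y) = h (finc c X Y y)) : g = h :=
  dsum_ext (A := fun c : Fin n → PTree => pow Q.s (∑ i, (c i).leaves)) e

/-- The linear map out of a sum over forests given by a family of linear maps. -/
def flift {n : ℕ} {X Y : O} {M : Type u} [AddCommGroup M] [Module k M]
    (g : ∀ c : Fin n → PTree, (pow Q.s (∑ i, (c i).leaves)).Hom X Y →ₗ[k] M) :
    (forest Q n).Hom X Y →ₗ[k] M :=
  dlift (A := fun c : Fin n → PTree => pow Q.s (∑ i, (c i).leaves)) g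

theorem flift_finc {n : ℕ} {X Y : O} {M : Type u} [AddCommGroup M] [Module k M]
    (g : ∀ c : Fin n → PTree, (pow Q.s (∑ i, (c i).leaves)).Hom X Y →ₗ[k] M)
    (c : Fin n → PTree) (y : (pow Q.s (∑ i, (c i).leaves)).Hom X Y) :
    flift g (finc c X Y y) = g c y :=
  dlift_dinc (A := fun c : Fin n → PTree => pow Q.s (∑ i, (c i).leaves)) g c y

/-- The linear map out of a sum over forests given by a family of maps indexed by lists of
trees. -/
def forestLift (n : ℕ) {X Y : O} {M : Type u} [AddCommGroup M] [Module k M]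
    (m : List PTree → TT Q.s X Y →ₗ[k] M) : (forest Q n).Hom X Y →ₗ[k] M :=
  flift fun c : Fin n → PTree => m (List.ofFn c) ∘ₗ tin Q.s (∑ i, (c i).leaves) X Y

theorem forestLift_finc (n : ℕ) {X Y : O} {M : Type u} [AddCommGroup M] [Module k M]
    (m : List PTree → TT Q.s X Y →ₗ[k] M) (c : Fin n → PTree)
    (y : (pow Q.s (∑ i, (c i).leaves)).Hom X Y) :
    forestLift n m (finc c X Y y) = m (List.ofFn c) (tin Q.s (∑ i, (c i).leaves) X Y y) := by
  rw [forestLift, flift_finc]; rfl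

/-- The concatenation of a forest with a tree. -/
def fcat {n : ℕ} (c : Fin n → PTree) (t : PTree) (X Z Y : O) :
    (pow Q.s (∑ i, (c i).leaves)).Hom X Z →ₗ[k] (pow Q.s t.leaves).Hom Z Y →ₗ[k]
      (forest Q (n + 1)).Hom X Y :=
  TensorProduct.curry
    (finc (Fin.snoc (α := fun _ => PTree) c t) X Y ∘ₗ
      castPow Q.s (by simp [Fin.sum_univ_castSucc]) X Y ∘ₗ
      cat Q.s (∑ i, (c i).leaves) t.leaves X Y ∘ₗ
      tmk (pow Q.s (∑ i, (c i).leaves)) (pow Q.s t.leaves) X Z Y)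

/-- Appending a letter to a forest. -/
def forestSnoc (n : ℕ) (X Z Y : O) :
    (forest Q n).Hom X Z →ₗ[k] (sF Q).Hom Z Y →ₗ[k] (forest Q (n + 1)).Hom X Y :=
  flift fun c => ((lift Q fun t => (fcat c t X Z Y).flip) ∘ₗ
    (eps (sF Q) Z Y) ^ (∑ i, (c i).verts)).flip

theorem join_psnoc (n : ℕ) {X Z Y : O} (p : (pow (sF Q) n).Hom X Z) (x : (sF Q).Hom Z Y) :
    join Q (n + 1) X Y (psnoc p x) = forestSnoc n X Z Y (join Q n X Z p) x :=
  tlift_tmk (A := pow (sF Q) n) (B := sF Q) (M := (forest Q (n + 1)).Hom X Y) _ p x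

theorem ofFn_snoc {α : Type} {n : ℕ} (c : Fin n → α) (t : α) :
    List.ofFn (Fin.snoc (α := fun _ => α) c t : Fin (n + 1) → α) = List.ofFn c ++ [t] := by
  rw [List.ofFn_succ']; simp

theorem forestSnoc_finc (n : ℕ) {X Z Y : O} (c : Fin n → PTree)
    (y : (pow Q.s (∑ i, (c i).leaves)).Hom X Z) (a : Simp Q Z Y) {M : Type u} [AddCommGroup M]
    [Module k M] (m : List PTree → TT Q.s X Y →ₗ[k] M) :
    forestLift (n + 1) m (forestSnoc n X Z Y (finc c X Z y) (inc Q a.t Z Y a.z)) =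
    sg k (vertsL (List.ofFn c) * (a.δ + a.t.verts)) • m (List.ofFn c ++ [a.t])
      (tmul (tin Q.s _ X Z y) (tin Q.s a.t.leaves Z Y a.z)) := by
  rw [forestSnoc, flift_finc, LinearMap.flip_apply, LinearMap.comp_apply, eps_pow_inc, map_smul,
    LinearMap.smul_apply, map_smul, vertsL_ofFn]
  congr 1
  rw [lift_inc, LinearMap.flip_apply]
  refine (forestLift_finc (n + 1) m (Fin.snoc (α := fun _ => PTree) c a.t) _).trans ?_
  rw [ofFn_snoc]
  congr 1
  refine (tin_castPow _ X Y _).trans ?_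
  rw [tmul_tin]; rfl

/-- Testing `join` against maps indexed by lists of trees removes the casts along equalities of
numbers of input vertices. What remains is concatenation with the sign `sgn`, accumulated letter by
letter. -/
theorem forestLift_join {X Y : O} (P : SWord Q X Y) {M : Type u} [AddCommGroup M] [Module k M]
    (m : List PTree → TT Q.s X Y →ₗ[k] M) :
    forestLift (val P).length m (join Q (val P).length X Y (ev (val P))) =
      sg k (sgn P) • m (trees P) (flat P) := by
  induction P generalizing M with
  | nil =>
    refine (forestLift_finc 0 m Fin.elim0 _).trans ?_
    rw [sgn_nil, sg_zero, one_smul, List.ofFn_zero]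
    exact congrArg (m []) (tin_castPow (by simp) X X (pone Q.s X))
  | @snoc Z Y P a ih =>
    refine (congrArg (forestLift ((val P).length + 1) m)
      (join_psnoc _ (ev (val P)) (inc Q a.t Z Y a.z))).trans ?_
    have h : forestLift ((val P).length + 1) m ∘ₗ
        (forestSnoc (val P).length X Z Y).flip (inc Q a.t Z Y a.z) =
        forestLift (val P).length fun l => sg k (vertsL l * (a.δ + a.t.verts)) •
          (m (l ++ [a.t]) ∘ₗ tmul.flip (tin Q.s a.t.leaves Z Y a.z)) := by
      refine forest_ext fun c y => ?_
      rw [forestLift_finc, LinearMap.comp_apply, LinearMap.flip_apply, forestSnoc_finc]; rfl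
    refine (LinearMap.congr_fun h (join Q (val P).length X Z (ev (val P)))).trans ?_
    rw [ih, sgn_snoc, sg_add, LinearMap.smul_apply, smul_smul]; rfl

variable (Q)

/-- The map `TsFQ → sFQ` with components `b n`. -/
abbrev bT (X Y : O) : TT (sF Q) X Y →ₗ[k] (sF Q).Hom X Y := total (φ := fun X : O => X) (b Q) X Y

variable {Q}

theorem bT_tone (X : O) : bT Q X X (tone (sF Q) X) = 0 := by
  rw [tone, bT, total_tin]; rfl

theorem bT_tlet {X Y : O} (x : (sF Q).Hom X Y) : bT Q X Y (tlet x) = b1 Q X Y x := by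
  rw [tlet_eq_tin, bT, total_tin]
  exact congrArg (b1 Q X Y) (ofPowOne_psnoc x)

/-- The working description of b_n for n ≥ 2: the tensors are concatenated and the trees grafted,
with a sign. All later arguments use this instead of `join`. -/
theorem bT_val {X Y : O} (P : SWord Q X Y) (h : 2 ≤ P.length) :
    bT Q X Y (Ev (val P)) = sg k (sgn P) • IT Q (nodeL (trees P)) X Y (flat P) := by
  rw [Ev_eq_tin, bT, total_tin]
  have h1 : ∀ n (z : (pow (sF Q) n).Hom X Y), 2 ≤ n →
      b Q n X Y z = forestLift n (fun l => IT Q (nodeL l) X Y) (join Q n X Y z) := by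
    intro n z hn
    obtain ⟨n, rfl⟩ : ∃ m, n = m + 2 := ⟨n - 2, by omega⟩
    refine LinearMap.congr_fun (f := flift fun c =>
      inc Q (PTree.node (n + 2) (Nat.le_add_left 2 n) c) X Y) (forest_ext fun c y => ?_)
      (join Q (n + 2) X Y z)
    refine (flift_finc _ c y).trans ?_
    rw [forestLift_finc]
    rw [← node_eq_nodeL_ofFn (Nat.le_add_left 2 n) c]
    exact (IT_tin_self Q (.node (n + 2) (Nat.le_add_left 2 n) c) y).symm
  rw [h1 _ _ (by simpa using h), forestLift_join]

end FreeAInf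

/-! ### Insertions of edges and factorizations into three factors. -/

/-- An interval [a, b) in an n-element set is everything, a proper block with at least two elements,
a single element, or empty. Proper blocks are the insertions at the lowest vertex, and single
elements are the subtrees. -/
theorem sum_block_pairs {M : Type*} [AddCommMonoid M] {n : ℕ} (hn : 2 ≤ n) (g : ℕ → ℕ → M)
    (hg : ∀ a, g a a = 0) :
    ∑ b ∈ Finset.range (n + 1), ∑ a ∈ Finset.range (b + 1), g a b =
      g 0 n + ((∑ p : PTree.Block n, g p.1.1 (p.1.1 + p.1.2)) + ∑ i : Fin n, g i (i + 1)) := by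
  have h1 : ∑ s : Unit ⊕ PTree.Block n ⊕ Fin n, Sum.elim (γ := M) (fun _ => g 0 n)
      (Sum.elim (fun p : PTree.Block n => g p.1.1 (p.1.1 + p.1.2)) fun i : Fin n => g i (i + 1)) s =
      g 0 n + ((∑ p : PTree.Block n, g p.1.1 (p.1.1 + p.1.2)) + ∑ i : Fin n, g i (i + 1)) := by
    simp
  rw [← h1, Finset.sum_sigma']
  symm
  refine Finset.sum_of_injOn (Sum.elim (fun _ => ⟨n, 0⟩)
      (Sum.elim (fun p : PTree.Block n => ⟨p.1.1 + p.1.2, p.1.1⟩) fun i : Fin n => ⟨i + 1, i⟩)) ?_ ?_ ?_ ?_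
  · rintro (_ | ⟨⟨⟨a, ha⟩, ⟨m, hm⟩⟩, h2, h3⟩ | ⟨i, hi⟩) - (_ | ⟨⟨⟨a', ha'⟩, ⟨m', hm'⟩⟩, h2', h3'⟩ |
      ⟨i', hi'⟩) - h <;> (try dsimp only at h2 h3) <;> (try dsimp only at h2' h3') <;> simp_all <;> omega
  · rintro (_ | ⟨⟨⟨a, ha⟩, ⟨m, hm⟩⟩, h2, h3⟩ | ⟨i, hi⟩) - <;> simp_all
  · rintro ⟨b, a⟩ hba h
    simp only [Finset.mem_sigma, Finset.mem_range] at hba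
    by_cases hab : a = b
    · subst hab; exact hg a
    · refine absurd ?_ h
      by_cases h1 : b = a + 1
      · exact ⟨.inr (.inr ⟨a, by omega⟩), by simp, by simp [h1]⟩
      · by_cases h2 : b - a = n
        · refine ⟨.inl (), by simp, ?_⟩
          obtain ⟨rfl, rfl⟩ : a = 0 ∧ b = n := by omega
          rfl
        · refine ⟨.inr (.inl ⟨⟨⟨a, by omega⟩, ⟨b - a, by omega⟩⟩, by dsimp only; omega,
            by dsimp only; omega⟩), by simp, ?_⟩
          simp only [Sum.elim_inr, Sum.elim_inl, Sigma.mk.injEq, heq_eq_eq, and_true]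
          omega
  · rintro (_ | p | i) - <;> rfl

namespace PTree

/-- The index type depends on the tree, so a tree cannot simply be rewritten under the sum. It can
once the summand depends only on the height and on the resulting tree. -/
theorem sum_insertion_cast {M : Type*} [AddCommMonoid M] {t t' : PTree} (h : t = t')
    (F : ℕ → PTree → M) :
    ∑ e : t.Insertion, F (t.height e) (t.insert e) =
      ∑ e : t'.Insertion, F (t'.height e) (t'.insert e) := by
  subst h; rfl

theorem sum_insertion_node {M : Type*} [AddCommMonoid M] {n : ℕ} (hn : 2 ≤ n) (c : Fin n → PTree)
    (F : ℕ → PTree → M) :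
    ∑ e : (node n hn c).Insertion, F ((node n hn c).height e) ((node n hn c).insert e) =
      (∑ p : Block n, F ((node n hn c).height (.inl p)) ((node n hn c).insert (.inl p))) +
      ∑ i : Fin n, ∑ e : (c i).Insertion,
        F (1 + (∑ j with j < i, (c j).verts) + (c i).height e)
          (node n hn (Function.update c i ((c i).insert e))) := by
  refine (Fintype.sum_sum_type (α₁ := Block n) (α₂ := Σ i : Fin n, (c i).Insertion)
    fun e => F ((node n hn c).height e) ((node n hn c).insert e)).trans ?_
  congr 1
  exact Fintype.sum_sigma (ι := Fin n) (α := fun i => (c i).Insertion) _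

theorem sum_filter_verts {l₀ l l' : List PTree} (hl : l₀ = l ++ l') (i : Fin l₀.length)
    (hi : i.val = l.length) : ∑ j with j < i, (l₀.get j).verts = vertsL l := by
  subst hl
  have h : ∀ l : List PTree, vertsL l = ∑ j : Fin l.length, (l.get j).verts := fun l => by
    rw [← vertsL_ofFn, List.ofFn_get]
  rw [h, eq_comm]
  refine Finset.sum_nbij (fun j => ⟨j.val, by simp; omega⟩) ?_ ?_ ?_ ?_
  · intro j _
    simp only [Finset.mem_filter, Finset.mem_univ, true_and, Fin.lt_def]
    omega
  · intro a _ b _ hab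
    simpa [Fin.ext_iff] using hab
  · intro j hj
    simp only [Finset.coe_filter, Finset.mem_univ, true_and, Set.mem_ofPred_eq, Fin.lt_def] at hj
    exact ⟨⟨j.val, by omega⟩, by simp, rfl⟩
  · intro j _
    simp

theorem update_eq_nodeL {l₀ l l' : List PTree} {t : PTree} (hl : l₀ = l ++ t :: l') (t' : PTree)
    (h : 2 ≤ l₀.length) (i : Fin l₀.length) (hi : i.val = l.length) :
    node _ h (Function.update l₀.get i t') = nodeL (l ++ t' :: l') := by
  subst hl
  refine node_eq_nodeL h _ _ (by simp) fun j hj hj' => ?_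
  by_cases hji : j = l.length
  · subst hji
    have : (⟨l.length, hj⟩ : Fin (l ++ t :: l').length) = i := Fin.ext hi.symm
    rw [this, Function.update_self]
    simp
  · have : (⟨j, hj⟩ : Fin (l ++ t :: l').length) ≠ i := fun h => hji (by rw [← hi, ← h])
    rw [Function.update_of_ne this]
    simp only [List.get_eq_getElem]
    rcases lt_or_gt_of_ne hji with h1 | h1
    · rw [List.getElem_append_left h1, List.getElem_append_left h1]
    · rw [List.getElem_append_right h1.le, List.getElem_append_right h1.le]
      obtain ⟨m, hm⟩ : ∃ m, j - l.length = m + 1 := ⟨j - l.length - 1, by omega⟩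
      simp only [hm, List.getElem_cons_succ]

/-- Collecting a block under a new vertex means replacing the middle part of the list of subtrees by
one tree. -/
theorem insert_inl_eq_nodeL {l l₁ l₂ l₃ : List PTree} (hl : l = l₁ ++ l₂ ++ l₃)
    (h : 2 ≤ l.length) (p : Block l.length) (ha : p.1.1.val = l₁.length)
    (hm : p.1.2.val = l₂.length) :
    insert (node _ h l.get) (.inl p) = nodeL (l₁ ++ nodeL l₂ :: l₃) := by
  subst hl
  obtain ⟨⟨⟨a, ha'⟩, ⟨m, hm'⟩⟩, h2, h3⟩ := p
  dsimp only at ha hm h2 h3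
  subst ha hm
  refine node_eq_nodeL _ _ _ (by simp; omega) fun j hj hj' => ?_
  simp only [group]
  split_ifs with h4 h5
  · simp only [List.get_eq_getElem]
    rw [List.getElem_append_left h4, List.getElem_append_left (by simp; omega),
      List.getElem_append_left h4]
  · subst h5
    simp only [List.getElem_append_right le_rfl, Nat.sub_self, List.getElem_cons_zero]
    symm
    refine node_eq_nodeL _ _ _ rfl fun i hi hi' => ?_
    simp only [List.get_eq_getElem, List.append_assoc]
    rw [List.getElem_append_right (by omega), List.getElem_append_left (by omega)]
    congr 1; omega
  · have h6 : l₁.length < j := by omega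
    simp only [List.get_eq_getElem]
    rw [List.getElem_append_right h6.le, List.getElem_append_right (by simp; omega)]
    obtain ⟨m, hm⟩ : ∃ m, j - l₁.length = m + 1 := ⟨j - l₁.length - 1, by omega⟩
    simp only [hm, List.getElem_cons_succ]
    congr 1
    simp; omega

theorem height_inl {l l₁ l₂ : List PTree} (hl : l = l₁ ++ l₂) (h : 2 ≤ l.length)
    (p : Block l.length) (ha : p.1.1.val = l₁.length) :
    height (node _ h l.get) (.inl p) = 2 + vertsL l₁ :=
  congrArg (2 + ·) (sum_filter_verts hl p.1.1 ha)

end PTree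

namespace PTree

@[simp] theorem vertsL_nil : vertsL [] = 0 := rfl

@[simp] theorem vertsL_cons (t : PTree) (l : List PTree) : vertsL (t :: l) = t.verts + vertsL l := by
  simp [vertsL]

theorem exists_list {n : ℕ} (c : Fin n → PTree) :
    ∃ (l : List PTree) (h : l.length = n), c = fun i => l.get (i.cast h.symm) :=
  ⟨List.ofFn c, by simp, by funext i; simp⟩

theorem verts_insert : (t : PTree) → (e : t.Insertion) → (t.insert e).verts = t.verts + 1
  | leaf, e => e.elim
  | node n hn c, .inl p => by
    obtain ⟨l, rfl, rfl⟩ := exists_list c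
    obtain ⟨l₁, l₂, l₃, rfl, h1, h2⟩ : ∃ l₁ l₂ l₃ : List PTree, l = l₁ ++ l₂ ++ l₃ ∧
        p.1.1.val = l₁.length ∧ p.1.2.val = l₂.length := by
      have := p.2.2
      refine ⟨l.take p.1.1, (l.drop p.1.1).take p.1.2, (l.drop p.1.1).drop p.1.2, ?_, ?_, ?_⟩
      · simp
      · simp
      · simp; omega
    have h3 := insert_inl_eq_nodeL (l₁ := l₁) (l₂ := l₂) (l₃ := l₃) rfl hn p h1 h2
    have h4 := p.2.1
    have h5 := p.2.2
    have h6 := p.1.2.2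
    have h7 := hn
    simp only [List.length_append] at h5 h6 h7
    refine (congrArg verts h3).trans ?_
    have h8 : (node (l₁ ++ l₂ ++ l₃).length hn (l₁ ++ l₂ ++ l₃).get).verts = _ :=
      (congrArg verts (nodeL_eq hn).symm).trans (verts_nodeL hn)
    refine Eq.trans ?_ (congrArg (· + 1) h8.symm)
    rw [verts_nodeL (by simp; omega), ← List.singleton_append, vertsL_append, vertsL_append,
      vertsL_singleton, verts_nodeL (by omega), vertsL_append, vertsL_append]
    omega
  | node n hn c, .inr ⟨i, e⟩ => by
    have h := verts_insert (c i) e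
    simp only [insert, verts]
    rw [add_assoc]
    congr 1
    rw [← Finset.add_sum_erase _ _ (Finset.mem_univ i),
      ← Finset.add_sum_erase _ (fun j => (c j).verts) (Finset.mem_univ i), Function.update_self, h]
    rw [Finset.sum_congr rfl fun j hj => by
      rw [Function.update_of_ne (Finset.ne_of_mem_erase hj)]]
    omega

end PTree

namespace GQuiv.Word

variable {O : Type u} {H : O → O → Type u} {M : Type*} [AddCommMonoid M]

theorem cutAt_of_le {X Y : O} (w : Word H X Y) {a : ℕ} (h : w.length ≤ a) :
    w.cutAt a = ⟨Y, w, nil⟩ := by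
  cases w with
  | nil => rfl
  | snoc w x => rw [cutAt, if_pos (by simpa using h)]

theorem length_cutAt {X Y : O} (w : Word H X Y) {a : ℕ} (h : a ≤ w.length) :
    (w.cutAt a).2.1.length = a := by
  obtain ⟨Z, u, v, rfl, rfl, -⟩ := w.exists_append (a := a) (b := w.length - a) (by omega)
  rw [cutAt_append]

/-- The value at the word without its last letter and the last letter. -/
def onLast {X Y : O} (F : ∀ Z, Word H X Z → H Z Y → M) : Word H X Y → M
  | nil => 0
  | snoc u a => F _ u a

/-- The value at a letter of a word and the parts of the word before and after this letter. -/
def atLetter {X Y : O} (w : Word H X Y) (F : ∀ Z W, Word H X Z → H Z W → Word H W Y → M)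
    (i : ℕ) : M :=
  onLast (fun Z u a => F Z _ u a (w.cutAt (i + 1)).2.2) (w.cutAt (i + 1)).2.1

theorem atLetter_append {X Z W Y : O} (F : ∀ Z W, Word H X Z → H Z W → Word H W Y → M)
    (u : Word H X Z) (a : H Z W) (x : Word H W Y) :
    ((u.snoc a).append x).atLetter F u.length = F Z W u a x := by
  rw [atLetter, ← length_snoc u a, cutAt_append]; rfl

theorem ssum_onLast {X Y : O} (w : Word H X Y) {n : ℕ} (hn : w.length = n)
    (F : ∀ Z W, Word H X Z → H Z W → Word H W Y → M) :
    (w.ssum fun W y x => onLast (fun Z u a => F Z W u a x) y) =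
      ∑ i : Fin n, w.atLetter F i := by
  subst hn
  -- The cut at position 0 has an empty left factor without a last letter and contributes 0, so n +
  -- 1 cuts give n letters.
  rw [ssum_eq_sum_range, Finset.sum_range_succ']
  have h0 : w.cutAt 0 = ⟨X, nil, w⟩ := by
    simpa using cutAt_append (nil : Word H X X) w
  rw [Finset.sum_range, h0, onLast, add_zero]
  rfl

/-- A sum over factorizations into three factors, in terms of the lengths. -/
theorem ssum_ssum_eq {X Y : O} (w : Word H X Y) {n : ℕ} (hn : w.length = n) (hw : 2 ≤ n)
    (G : ∀ Z W, Word H X Z → Word H Z W → Word H W Y → M)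
    (h0 : ∀ Z u x, G Z Z u nil x = 0) (gb : PTree.Block n → M) (gl : Fin n → M)
    (hb : ∀ p Z W (u : Word H X Z) (v : Word H Z W) (x : Word H W Y), (u.append v).append x = w →
      p.1.1.val = u.length → p.1.2.val = v.length → G Z W u v x = gb p)
    (hl : ∀ i Z W (u : Word H X Z) (a : H Z W) (x : Word H W Y), (u.snoc a).append x = w →
      i.val = u.length → G Z W u (single a) x = gl i) :
    (w.ssum fun W y x => y.ssum fun Z u v => G Z W u v x) =
      G X Y nil w nil + (∑ p, gb p + ∑ i, gl i) := by
  subst hn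
  set g : ℕ → ℕ → M := fun a b => G ((w.cutAt b).2.1.cutAt a).1 (w.cutAt b).1
    ((w.cutAt b).2.1.cutAt a).2.1 ((w.cutAt b).2.1.cutAt a).2.2 (w.cutAt b).2.2 with hgdef
  have hg : ∀ Z W (u : Word H X Z) (v : Word H Z W) (x : Word H W Y),
      (u.append v).append x = w → g u.length (u.length + v.length) = G Z W u v x := by
    rintro Z W u v x rfl
    simp only [hgdef]
    rw [← length_append, cutAt_append, cutAt_append]
  have h1 : (w.ssum fun W y x => y.ssum fun Z u v => G Z W u v x) =
      ∑ b ∈ Finset.range (w.length + 1), ∑ a ∈ Finset.range (b + 1), g a b := by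
    rw [ssum_eq_sum_range]
    refine Finset.sum_congr rfl fun b hb => ?_
    rw [ssum_eq_sum_range, length_cutAt w (by simp at hb; omega)]
  rw [h1, sum_block_pairs hw]
  · congr 1
    · have := hg _ _ nil w nil (by simp)
      rwa [length_nil, zero_add] at this
    · congr 1
      · refine Finset.sum_congr rfl fun p _ => ?_
        have := p.2.2
        obtain ⟨W, y, x, hw1, h2, -⟩ := w.exists_append (a := p.1.1 + p.1.2)
          (b := w.length - (p.1.1 + p.1.2)) (by omega)
        obtain ⟨Z, u, v, rfl, h3, h4⟩ := y.exists_append h2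
        rw [← h3, ← h4, hg _ _ u v x hw1, hb p _ _ u v x hw1 h3.symm h4.symm]
      · refine Finset.sum_congr rfl fun i _ => ?_
        obtain ⟨W, y, x, hw1, h2, -⟩ := w.exists_append (a := i + 1)
          (b := w.length - (i + 1)) (by omega)
        cases y with
        | nil => simp at h2
        | snoc u a =>
          have h3 : u.length = i := by simpa using h2
          rw [← h3]
          exact (hg _ _ u (single a) x hw1).trans (hl i _ _ u a x hw1 h3.symm)
  -- This is required for every natural number a. Beyond the length of the word `cutAt` returns the
  -- whole word, so the middle factor is empty in this case too.
  · intro a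
    have : (w.cutAt a).2.1.length ≤ a := by
      by_cases h : a ≤ w.length
      · exact (length_cutAt w h).le
      · rw [cutAt_of_le w (by omega)]
        exact (not_le.1 h).le
    simp only [hgdef]
    rw [cutAt_of_le (w.cutAt a).2.1 this]
    exact h0 _ _ _

end GQuiv.Word

/-! ### The relations of the free category with at least two arguments. -/

namespace FreeAInf

open PTree

variable {k : Type u} [CommRing k] {O : Type u} {Q : DGQuiv k O}

theorem tder_flat {X Y : O} (P : SWord Q X Y) : tder Q.sd X Y (flat P) =
    P.ssum fun W y x => Word.onLast (fun Z u a => sg k (qdeg x) •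
      tmul (tmul (flat u) (tin Q.s a.t.leaves Z W (der Q.sd _ Z W a.z))) (flat x)) y := by
  induction P with
  | nil => exact tder_tone _ _
  | @snoc Z Y P a ih =>
    rw [flat_snoc, tder_tmul, ih, tder_tin, teps_tin a.hz, Word.ssum_snoc, add_comm, Word.onLast,
      qdeg_nil, sg_zero, one_smul, flat_nil, tmul_tone]
    congr 1
    refine (Word.map_ssum (tmul.flip (sg k a.δ • tin Q.s _ Z Y a.z)) P _).trans ?_
    refine Word.ssum_congr P fun W y x _ => ?_
    cases y with
    | nil => exact map_zero _
    | snoc u c =>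
      simp only [Word.onLast, LinearMap.flip_apply, map_smul, LinearMap.smul_apply, flat_snoc,
        tmul_assoc, qdeg_snoc, sg_add, smul_smul]

/-- The value of the operations on words with one variable letter. -/
def bMid {X Z W Y : O} (u : SWord Q X Z) (x : SWord Q W Y) :
    (sF Q).Hom Z W →ₗ[k] (sF Q).Hom X Y :=
  bT Q X Y ∘ₗ tmul.flip (Ev (val x)) ∘ₗ tsnoc (Ev (val u))

theorem bMid_inc {X Z W Y : O} (u : SWord Q X Z) (x : SWord Q W Y) (a : Simp Q Z W)
    (h : 1 ≤ u.length + x.length) : bMid u x (inc Q a.t Z W a.z) =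
      sg k (sgn u + vertsL (trees u) * (a.δ + a.t.verts) + sgn x +
        (vertsL (trees u) + a.t.verts) * sdeg x) •
      IT Q (nodeL (trees u ++ a.t :: trees x)) X Y
        (tmul (tmul (flat u) (tin Q.s a.t.leaves Z W a.z)) (flat x)) := by
  have h1 : bMid u x (inc Q a.t Z W a.z) = bT Q X Y (Ev (val ((u.snoc a).append x))) := by
    rw [val_append, Ev_append]; rfl
  rw [h1, bT_val _ (by simp; omega), sgn_append, trees_append, flat_append]
  simp

/-- The parity operators on the letters of x combine to the Koszul sign of the inner operation,
which has degree 1 and passes x. -/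
theorem Ev_par {X Z W Y : O} (u : SWord Q X Z) (β : (sF Q).Hom Z W) (x : SWord Q W Y) :
    bT Q X Y (Ev (((val u).snoc β).append (val x).par)) = sg k (sdeg x) • bMid u x β := by
  rw [Ev_append, ← teps_Ev]
  have : teps W Y (Ev (val x)) = sg k (sdeg x) • Ev (val x) := teps_Ev_letters (simpLetters Q) x
  rw [this, map_smul, map_smul]; rfl

/-- The inner operation is b₁ on one letter. The right side is minus the part of b₁(b_n) in which
the differential hits this letter or an edge is inserted in its tree. -/
theorem bMid_letter {X Z W Y : O} (u : SWord Q X Z) (x : SWord Q W Y) (a : Simp Q Z W)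
    (h : 1 ≤ u.length + x.length) :
    sg k (sdeg x) • bMid u x (bT Q Z W (Ev (val (.single a)))) =
      -(sg k (sgn ((u.snoc a).append x)) •
        (sg k (1 + vertsL (trees ((u.snoc a).append x))) •
          IT Q (nodeL (trees ((u.snoc a).append x))) X Y (sg k (qdeg x) •
            tmul (tmul (flat u) (tin Q.s a.t.leaves Z W (der Q.sd _ Z W a.z))) (flat x)) +
        ∑ e : a.t.Insertion, sg k (1 + (1 + vertsL (trees u) + a.t.height e : ℕ)) •
          IT Q (nodeL (trees u ++ a.t.insert e :: trees x)) X Y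
            (flat ((u.snoc a).append x)))) := by
  have h1 : bT Q Z W (Ev (val (.single a))) = b1 Q Z W (inc Q a.t Z W a.z) := bT_tlet _
  rw [h1, b1_inc, map_add, map_smul, map_sum, smul_add, smul_add, neg_add]
  congr 1
  · rw [bMid_inc u x ⟨a.t, a.δ + 1, der Q.sd _ Z W a.z, der_mem (sd_deg Q) _ _ _ _ _ a.hz⟩ h,
      map_smul, smul_smul, smul_smul, smul_smul, smul_smul, ← neg_smul]
    simp only [trees_append, trees_snoc, List.append_assoc, List.singleton_append]
    congr 1
    rw [← sg_add, ← sg_add, ← sg_add, ← sg_add]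
    -- Raising the degree of the letter by 1 adds `vertsL (trees u)`, and `sdeg x = qdeg x + vertsL
    -- (trees x)`. The exponents then differ by −1.
    refine sg_eq_neg_of_odd ⟨-1, ?_⟩
    rw [sgn_append, sgn_snoc, sdeg_eq x, trees_snoc]
    simp only [vertsL_append, vertsL_cons, vertsL_nil]
    push_cast; ring
  · rw [Finset.smul_sum, Finset.smul_sum, ← Finset.sum_neg_distrib]
    refine Finset.sum_congr rfl fun e _ => ?_
    rw [map_smul, bMid_inc u x ⟨a.t.insert e, a.δ, castPow Q.s (a.t.leaves_insert e) Z W a.z,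
      castPow_mem _ a.hz⟩ h, smul_smul, smul_smul, smul_smul, ← neg_smul, flat_append, flat_snoc,
      tin_castPow]
    congr 1
    rw [← sg_add, ← sg_add, ← sg_add]
    -- The additional vertex adds `vertsL (trees u)`, compensated by the height, and a second copy
    -- of `sdeg x`. The difference of the exponents is 2 `sdeg x` − 1.
    refine sg_eq_neg_of_odd ⟨sdeg x - 1, ?_⟩
    rw [sgn_append, sgn_snoc, verts_insert, trees_snoc]
    simp only [vertsL_append, vertsL_singleton]
    push_cast; ring

/-- Grafting v first and everything else afterwards gives the tree with one more edge above the
lowest vertex, whose upper end carries the trees of v. The minus sign cancels the corresponding term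
of b₁(b_n). -/
theorem bMid_block {X Z W Y : O} (u : SWord Q X Z) (v : SWord Q Z W) (x : SWord Q W Y)
    (hv : 2 ≤ v.length) (h : 1 ≤ u.length + x.length) :
    sg k (sdeg x) • bMid u x (bT Q Z W (Ev (val v))) =
      -(sg k (sgn ((u.append v).append x)) • sg k (1 + (2 + vertsL (trees u) : ℕ)) •
          IT Q (nodeL (trees u ++ nodeL (trees v) :: trees x)) X Y
            (flat ((u.append v).append x))) := by
  obtain ⟨z, hz, hzf⟩ := flat_eq_tin v
  have hl : leavesL (trees v) = (nodeL (trees v)).leaves := (leaves_nodeL (by simpa using hv)).symm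
  rw [bT_val v hv, hzf, IT_tin Q _ hl, map_smul,
    bMid_inc u x ⟨nodeL (trees v), qdeg v, castPow Q.s hl Z W z, castPow_mem _ hz⟩ h, tin_castPow,
    ← hzf, flat_append, flat_append, smul_smul, smul_smul, smul_smul, ← neg_smul]
  congr 1
  rw [← sg_add, ← sg_add, ← sg_add]
  -- The new vertex again doubles `sdeg x` and adds `vertsL (trees u)`. The height is 2 + `vertsL
  -- (trees u)`, so the exponents differ by 2 `sdeg x` − 3.
  refine sg_eq_neg_of_odd ⟨sdeg x - 2, ?_⟩
  rw [sgn_append, sgn_append, verts_nodeL (by simpa using hv), trees_append, sdeg_eq v]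
  simp only [vertsL_append]
  push_cast; ring

theorem ssum_val {X Y : O} {M : Type*} [AddCommMonoid M] (P : SWord Q X Y)
    (β : ∀ Z, Word (sF Q).Hom X Z → Word (sF Q).Hom Z Y → M) :
    (val P).ssum β = P.ssum fun Z u v => β Z (val u) (val v) := Word.ssum_map _ P β

/-- The `A∞`-relations of the free `A∞`-category with at least two arguments, on words. -/
theorem bT_coder_val {X Y : O} (P : SWord Q X Y) (hP : 2 ≤ P.length) :
    bT Q X Y (coder (bT Q) X Y (Ev (val P))) = 0 := by
  have hl : 2 ≤ (trees P).length := by simpa using hP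
  have hlen : P.length = (trees P).length := by simp
  rw [coder_Ev, Word.map_ssum, ssum_val]
  have h1 : ∀ W (y : SWord Q X W) (x : SWord Q W Y),
      bT Q X Y ((val y).ssum fun Z u v => Ev ((u.snoc (bT Q Z W (Ev v))).append (val x).par)) =
      y.ssum fun Z u v => sg k (sdeg x) • bMid u x (bT Q Z W (Ev (val v))) := by
    intro W y x
    rw [Word.map_ssum, ssum_val]
    exact Word.ssum_congr _ fun Z u v _ => Ev_par u _ x
  simp only [h1]
  have hN : nodeL (trees P) = node _ hl (trees P).get := nodeL_eq hl
  set F : ∀ Z W, SWord Q X Z → Simp Q Z W → SWord Q W Y → TT Q.s X Y := fun Z W u a x =>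
    sg k (qdeg x) • tmul (tmul (flat u) (tin Q.s a.t.leaves Z W (der Q.sd _ Z W a.z))) (flat x)
  -- The inner operation takes all of P, a proper block, or one letter. The last two contributions
  -- are specified as the negatives of terms in the expansion of the first one.
  rw [Word.ssum_ssum_eq P hlen hl
    (fun Z W u v x => sg k (sdeg x) • bMid u x (bT Q Z W (Ev (val v)))) ?_
    (fun p => -(sg k (sgn P) •
      sg k (1 + ((node _ hl (trees P).get).height (.inl p) : ℕ)) •
        IT Q ((node _ hl (trees P).get).insert (.inl p)) X Y (flat P)))
    (fun i => -(sg k (sgn P) • (sg k (1 + vertsL (trees P)) •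
          IT Q (node _ hl (trees P).get) X Y (P.atLetter F i) +
        ∑ e : ((trees P).get i).Insertion,
          sg k (1 + (1 + (∑ j with j < i, ((trees P).get j).verts) +
            ((trees P).get i).height e : ℕ)) •
          IT Q (node _ hl (Function.update (trees P).get i (((trees P).get i).insert e))) X Y
            (flat P)))) ?_ ?_]
  -- The term with all of P inside is b₁(b_n P). The differential of the tensor is split by letters
  -- and the insertions by position, and these terms cancel the other two groups.
  · have h2 : bMid (.nil : SWord Q X X) (.nil : SWord Q Y Y) (bT Q X Y (Ev (val P))) =
        b1 Q X Y (bT Q X Y (Ev (val P))) := by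
      refine Eq.trans ?_ (bT_tlet _)
      exact congrArg (bT Q X Y) (tmul_tone (tlet (bT Q X Y (Ev (val P)))))
    have hv : (node _ hl (trees P).get).verts = 1 + vertsL (trees P) := by
      rw [← hN, verts_nodeL hl]
    rw [sdeg_nil, sg_zero, one_smul, h2, bT_val P hP, map_smul, b1_IT, tder_flat,
      Word.ssum_onLast P hlen F, hN,
      sum_insertion_node hl _ fun h t => sg k (1 + h) • IT Q t X Y (flat P), hv]
    simp only [map_sum, Finset.sum_neg_distrib, ← Finset.smul_sum, Finset.sum_add_distrib,
      smul_add]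
    push_cast
    abel
  · intro Z u x
    rw [val_nil, Ev_nil, bT_tone, map_zero, smul_zero]
  · rintro p Z W u v x hP' hu hv
    have hT : trees P = trees u ++ trees v ++ trees x := by
      rw [← hP', trees_append, trees_append]
    have h5 : (trees P).length = u.length + v.length + x.length := by simp [hT, add_assoc]
    rw [bMid_block u v x (hv ▸ p.2.1) (by have h3 := p.1.2.2; omega), hP',
      insert_inl_eq_nodeL hT hl p (by simpa using hu) (by simpa using hv),
      height_inl (hT.trans (List.append_assoc _ _ _)) hl p (by simpa using hu)]
  · rintro i Z W u a x hP' hu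
    have hT : trees P = trees u ++ a.t :: trees x := by
      rw [← hP', trees_append, trees_snoc, List.append_assoc, List.singleton_append]
    have h5 : (trees P).length = u.length + x.length + 1 := by simp [hT, add_assoc]
    have hu' : i.val = (trees u).length := by simpa using hu
    have hget : (trees P).get i = a.t := by simp [hT, hu]
    rw [bMid_letter u x a (by omega), hP', sum_filter_verts hT i hu']
    have h6 : P.atLetter F i = F Z W u a x := by
      rw [hu, ← hP']; exact Word.atLetter_append F u a x
    have h7 := sum_insertion_cast hget fun h t =>
      sg k (1 + (1 + vertsL (trees u) + h : ℕ)) •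
        IT Q (nodeL (trees u ++ t :: trees x)) X Y (flat P)
    simp only [update_eq_nodeL hT _ hl i hu']
    rw [h6, h7, ← hN]

end FreeAInf

/-! ### Parity of homogeneous components and the relations in coalgebra form. -/

namespace GQuiv

section

variable {k : Type u} [CommRing k] {O P : Type u} {A : GQuiv k O} {B : GQuiv k P} {φ : O → P}

theorem teps_tlet {X Y : O} (x : A.Hom X Y) : teps X Y (tlet x) = tlet (A.eps X Y x) := by
  rw [tlet, teps_tsnoc, teps_tone]

theorem eps_total {f : ∀ n, QHom φ (pow A n) B} {e : ℤ} (hf : ∀ n, HasDegree (f n) e) {X Y : O}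
    (z : TT A X Y) : B.eps _ _ (total f X Y z) = sg k e • total f X Y (teps X Y z) := by
  refine LinearMap.congr_fun (f := B.eps _ _ ∘ₗ total f X Y)
    (g := sg k e • (total f X Y ∘ₗ teps X Y)) (tt_ext_tin fun n z => ?_) z
  rw [LinearMap.comp_apply, LinearMap.smul_apply, LinearMap.comp_apply]
  induction z using hom_induction with
  | h0 => simp
  | ha x y hx hy => simp only [map_add, smul_add, hx, hy]
  | hh d x hx =>
    rw [teps_tin hx, map_smul, total_tin, eps_eq _ (hf n X Y d x hx), sg_add, smul_smul, mul_comm]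

theorem letMap_total_pre_eps {f : ∀ n, QHom φ (pow A n) B} {e : ℤ}
    (hf : ∀ n, HasDegree (f n) e) {X Y : O} (z : TT A X Y) :
    teps _ _ (letMap (total f) X Y z) = sg k e • letMap (total f) X Y (teps X Y z) := by
  rw [letMap, LinearMap.comp_apply, LinearMap.comp_apply, teps_tlet, eps_total hf, map_smul]

theorem letMap_pre_eps_of_odd {b : ∀ n, QMap (pow A n) A} (hb : ∀ n, HasDegree (b n) 1) :
    (letMap (φ := fun X : O => X) (total b)).pre (lmEps A) =
      -LM.post (lmEps A) (letMap (total b)) := by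
  refine funext fun X => funext fun Y => LinearMap.ext fun z => ?_
  change letMap (total b) X Y (teps X Y z) = -teps X Y (letMap (total b) X Y z)
  rw [letMap_total_pre_eps (φ := fun X : O => X) hb, sg_one, neg_one_smul, neg_neg]

theorem letMap_pre_eps_of_even {f : ∀ n, QHom φ (pow A n) B} (hf : ∀ n, HasDegree (f n) 0) :
    (letMap (total f)).pre (lmEps A) = LM.post (lmEps B) (letMap (total f)) := by
  refine funext fun X => funext fun Y => LinearMap.ext fun z => ?_
  change letMap (total f) X Y (teps X Y z) = teps _ _ (letMap (total f) X Y z)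
  rw [letMap_total_pre_eps hf, sg_zero, one_smul]

theorem coder_tone {b : ∀ X Y, TT A X Y →ₗ[k] A.Hom X Y} (hb : ∀ X, b X X (tone A X) = 0)
    (X : O) : coder b X X (tone A X) = 0 := by
  rw [← Ev_nil, coder_Ev, Word.ssum_nil, Word.ssum_nil, Ev_nil, hb]
  exact map_zero _

theorem coder_tlet {b : ∀ X Y, TT A X Y →ₗ[k] A.Hom X Y} (hb : ∀ X, b X X (tone A X) = 0)
    {X Y : O} (x : A.Hom X Y) : coder b X Y (tlet x) = tlet (b X Y (tlet x)) := by
  have h : tlet x = Ev (Word.single x) := rfl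
  rw [h, coder_Ev, Word.ssum_snoc, Word.ssum_snoc, Word.ssum_nil, Word.ssum_nil, Word.ssum_nil,
    Ev_nil, hb, Ev_nil, hb]
  simp [Ev_snoc]; rfl

/-- Such a map factors through T¹. Applied at z = `coder b` w it turns g(b w) into g(`coder b` w),
the device behind both inductions over trees. -/
theorem apply_eq_apply_pr1 {X Y : O} {M : Type*} [AddCommGroup M] [Module k M]
    {g : TT A X Y →ₗ[k] M} (hg : ∀ w : Word A.Hom X Y, w.length ≠ 1 → g (Ev w) = 0)
    (z : TT A X Y) : g z = g (tlet (pr1 X Y z)) := by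
  refine LinearMap.congr_fun (f := g) (g := g ∘ₗ tlet ∘ₗ pr1 X Y) (tt_ext fun w => ?_) z
  rw [LinearMap.comp_apply, LinearMap.comp_apply]
  by_cases h : w.length = 1
  · match w, h with
    | .snoc .nil x, _ =>
      have h : tlet x = Ev (Word.single x) := rfl
      rw [← h, pr1_tlet]
  · rw [pr1_Ev w h, hg w h, map_zero, map_zero]

theorem total_coder_tin (b : ∀ n, QMap (pow A n) A) (f : ∀ n, QHom φ (pow A n) B) (n : ℕ)
    {X Y : O} (z : (pow A n).Hom X Y) : total f X Y (coder (total b) X Y (tin A n X Y z)) =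
      (∑ p ∈ Finset.HasAntidiagonal.antidiagonal n,
        ∑ q ∈ Finset.HasAntidiagonal.antidiagonal p.1,
          f (q.1 + 1 + p.2) X Y ∘ₗ ins b n q.1 q.2 p.2 X Y) z := by
  rw [coder_tin]
  simp only [map_sum, total_tin, LinearMap.sum_apply, LinearMap.comp_apply]

theorem total_tone {f : ∀ n, QHom φ (pow A n) B} (h : f 0 = 0) (X : O) :
    total f X X (tone A X) = 0 := by
  rw [tone, total_tin, h]; rfl

end

end GQuiv

section

variable {k : Type u} [CommRing k] {O : Type u} {A : AInfData k O}

theorem AInfData.IsAInfCat.total_coder (hA : A.IsAInfCat) {X Y : O} (z : TT A.s X Y) :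
    total (φ := fun X : O => X) A.b X Y (coder (total A.b) X Y z) = 0 := by
  refine LinearMap.congr_fun (f := total (φ := fun X : O => X) A.b X Y ∘ₗ coder (total A.b) X Y)
    (g := 0) (tt_ext_tin fun n z => ?_) z
  rw [LinearMap.comp_apply, total_coder_tin]
  rcases n with _ | n
  -- Length 0 is not covered by the relations; here the coderivation vanishes because `b 0 = 0`.
  · have h : tin A.s 0 X Y z ∈ Submodule.span k {y | ∃ w : Word A.s.Hom X Y, w.length = 0 ∧
        Ev w = y} := by
      refine Submodule.span_mono ?_ (tin_mem_span_length (homLetters A.s) 0 X Y z)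
      rintro _ ⟨w, h1, rfl⟩
      exact ⟨_, by simpa using h1, rfl⟩
    rw [← total_coder_tin A.b (φ := fun X : O => X) A.b]
    refine LinearMap.eqOn_span' (f := total (φ := fun X : O => X) A.b X Y ∘ₗ
      coder (total A.b) X Y) (g := 0) ?_ h
    rintro _ ⟨w, hw, rfl⟩
    match w, hw with
    | .nil, _ =>
      rw [LinearMap.comp_apply, Ev_nil, coder_tone fun X => total_tone (φ := fun X : O => X) hA.b_zero X]
      exact map_zero _
  · have h := hA.rel (n + 1) (by omega)
    have h1 := LinearMap.congr_fun (congrFun (congrFun h X) Y) z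
    simp only [Finset.sum_apply] at h1
    exact h1

end

/-! ### Degrees, surjectivity of grafting and the square of b₁. -/

namespace FreeAInf

open PTree

variable {k : Type u} [CommRing k] {O : Type u} {Q : DGQuiv k O}

theorem bT_val_mem {X Y : O} (P : SWord Q X Y) :
    bT Q X Y (Ev (val P)) ∈ (sF Q).gr X Y (sdeg P + 1) := by
  match P with
  | .nil => rw [val_nil, Ev_nil, bT_tone]; exact Submodule.zero_mem _
  | .snoc .nil a =>
    have h : bT Q X Y (Ev (val (Word.single a))) = b1 Q X Y (inc Q a.t X Y a.z) := bT_tlet _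
    rw [h, b1_inc]
    refine Submodule.add_mem _ (Submodule.smul_mem _ _ ?_)
      (Submodule.sum_mem _ fun e _ => Submodule.smul_mem _ _ ?_)
    · have := inc_mem Q a.t (der_mem (sd_deg Q) _ _ _ _ _ a.hz)
      rwa [show a.δ + 1 + (a.t.verts : ℤ) = sdeg (Word.single a) + 1 by simp; ring] at this
    · have := inc_mem Q (a.t.insert e) (castPow_mem (a.t.leaves_insert e) a.hz)
      rwa [verts_insert, show a.δ + ((a.t.verts + 1 : ℕ) : ℤ) = sdeg (Word.single a) + 1 by
        simp; ring] at this
  | .snoc (.snoc P a) c =>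
    obtain ⟨z, hz, h⟩ := flat_eq_tin ((P.snoc a).snoc c)
    have hl : 2 ≤ (trees ((P.snoc a).snoc c)).length := by simp
    rw [bT_val _ (by simp), h, IT_tin Q _ (leaves_nodeL hl).symm]
    have := inc_mem Q _ (castPow_mem (leaves_nodeL hl).symm hz)
    rw [verts_nodeL hl] at this
    refine Submodule.smul_mem _ _ ?_
    rwa [sdeg_eq, add_assoc, add_comm (_ : ℤ) 1, ← Nat.cast_one (R := ℤ), ← Nat.cast_add]

theorem b_deg (n : ℕ) : HasDegree (b Q n) 1 := by
  intro X Y d z hz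
  have h : b Q n X Y z = bT Q X Y (tin (sF Q) n X Y z) := (total_tin _ _ _ _ _).symm
  rw [h]
  have h1 := tin_mem_span (simpLetters Q) n X Y d z hz
  have h2 : Submodule.span k {y | ∃ w : Word (simpLetters Q).H X Y, w.length = n ∧
      w.deg (simpLetters Q).dg = d ∧ Ev (w.map (simpLetters Q).el) = y} ≤
      ((sF Q).gr X Y (d + 1)).comap (bT Q X Y) := by
    refine Submodule.span_le.2 ?_
    rintro _ ⟨w, -, rfl, rfl⟩
    exact bT_val_mem w
  exact h2 h1

theorem bT_coder_Ev {X Y : O} (w : Word (sF Q).Hom X Y) (h : w.length ≠ 1) :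
    bT Q X Y (coder (bT Q) X Y (Ev w)) = 0 := by
  rw [Ev_eq_tin]
  refine LinearMap.eqOn_span' (f := bT Q X Y ∘ₗ coder (bT Q) X Y) (g := 0) ?_
    (tin_mem_span_length (simpLetters Q) w.length X Y (ev w))
  rintro _ ⟨P, hP, rfl⟩
  by_cases h2 : 2 ≤ P.length
  · exact bT_coder_val P h2
  · match P with
    | .nil =>
      rw [LinearMap.comp_apply, Word.map_nil, Ev_nil, coder_tone bT_tone]
      exact map_zero _
    | .snoc .nil a => exact absurd hP.symm h
    | .snoc (.snoc P a) c => simp at h2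

theorem bT_coder_tlet {X Y : O} (x : (sF Q).Hom X Y) :
    bT Q X Y (coder (bT Q) X Y (tlet x)) = b1 Q X Y (b1 Q X Y x) := by
  rw [coder_tlet bT_tone, bT_tlet, bT_tlet]

/-- A word with the right number of letters can be cut according to the numbers of input vertices of
the trees in l. Every tensor on a grafted tree is thus a combination of grafted words. -/
theorem exists_flat_eq (l : List PTree) {X Y : O} (w : Word (homLetters Q.s).H X Y)
    (hw : w.length = leavesL l) : ∃ P : SWord Q X Y, trees P = l ∧
      qdeg P = w.deg (homLetters Q.s).dg ∧ flat P = Ev (w.map (homLetters Q.s).el) := by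
  induction l using List.reverseRecOn generalizing Y with
  | nil =>
    match w, hw with
    | .nil, _ => exact ⟨.nil, rfl, rfl, rfl⟩
  | append_singleton l t ih =>
    rw [leavesL_append, leavesL_singleton] at hw
    obtain ⟨Z, u, v, rfl, hu, hv⟩ := w.exists_append hw
    obtain ⟨P, h1, h2, h3⟩ := ih u hu
    refine ⟨P.snoc ⟨t, v.deg (homLetters Q.s).dg, castPow Q.s (by simpa using hv) _ _
      (ev (v.map (homLetters Q.s).el)), castPow_mem _ (ev_mem _ v)⟩, by rw [trees_snoc, h1],
      by rw [qdeg_snoc, h2, Word.deg_append], ?_⟩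
    rw [flat_snoc, h3, tin_castPow, ← Ev_eq_tin, ← Ev_append, Word.map_append]

theorem tin_mem_span_flat_deg (l : List PTree) {n : ℕ} (hn : n = leavesL l) {X Y : O} {d : ℤ}
    {z : (pow Q.s n).Hom X Y} (hz : z ∈ (pow Q.s n).gr X Y d) : tin Q.s n X Y z ∈
      Submodule.span k {y | ∃ P : SWord Q X Y, trees P = l ∧ qdeg P = d ∧ flat P = y} := by
  refine Submodule.span_mono ?_ (tin_mem_span (homLetters Q.s) n X Y d z hz)
  rintro _ ⟨w, h1, rfl, rfl⟩
  exact exists_flat_eq l w (h1.trans hn)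

theorem tin_mem_span_flat (l : List PTree) {n : ℕ} (hn : n = leavesL l) {X Y : O}
    (z : (pow Q.s n).Hom X Y) : tin Q.s n X Y z ∈
      Submodule.span k {y | ∃ P : SWord Q X Y, trees P = l ∧ flat P = y} := by
  refine Submodule.span_mono ?_ (tin_mem_span_length (homLetters Q.s) n X Y z)
  rintro _ ⟨w, h1, rfl⟩
  obtain ⟨P, h2, -, h3⟩ := exists_flat_eq l w (h1.trans hn)
  exact ⟨P, h2, h3⟩

/-- A linear map vanishes on `sF_t Q`, where `t` is not the tree without internal vertices, if it
vanishes on the values of the operation `b n` which has `sF_t Q` as its target. -/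
theorem apply_inc_node_eq {M : Type*} [AddCommGroup M] [Module k M] {X Y : O}
    {g h : (sF Q).Hom X Y →ₗ[k] M} {n : ℕ} (hn : 2 ≤ n) (c : Fin n → PTree)
    (e : ∀ P : SWord Q X Y, trees P = List.ofFn c →
      g (bT Q X Y (Ev (val P))) = h (bT Q X Y (Ev (val P))))
    (z : (pow Q.s (node n hn c).leaves).Hom X Y) :
    g (inc Q (node n hn c) X Y z) = h (inc Q (node n hn c) X Y z) := by
  rw [← IT_tin_self]
  refine LinearMap.eqOn_span' (f := g ∘ₗ IT Q (node n hn c) X Y)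
    (g := h ∘ₗ IT Q (node n hn c) X Y) ?_
    (tin_mem_span_flat (List.ofFn c) (leavesL_ofFn c).symm z)
  rintro _ ⟨P, hP, rfl⟩
  have h1 := e P hP
  have h2 : P.length = n := by rw [← length_trees, hP, List.length_ofFn]
  rw [bT_val P (h2 ▸ hn), hP, ← node_eq_nodeL_ofFn hn, map_smul, map_smul] at h1
  have h3 := congrArg (sg k (sgn P) • ·) h1
  simpa only [smul_smul, sg_mul_self, one_smul, LinearMap.comp_apply] using h3

/-- Structural induction on the tree. On the tree | it is d² = 0. On other trees the argument is a
value of b_n, and b₁² there is expressed by b₁² on the letters, which carry the subtrees. -/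
theorem b1_b1_inc : ∀ (t : PTree) (X Y : O) (z : (pow Q.s t.leaves).Hom X Y),
    b1 Q X Y (b1 Q X Y (inc Q t X Y z)) = 0
  | leaf, X, Y, z => by
    rw [← IT_tin_self]
    have h : ∀ z, b1 Q X Y (IT Q leaf X Y z) = IT Q leaf X Y (tder Q.sd X Y z) := fun z => by
      rw [b1_IT]
      refine (congrArg₂ (· + ·) ?_ (Finset.sum_eq_zero fun e _ => e.elim)).trans (add_zero _)
      rw [verts, Nat.cast_zero, sg_zero, one_smul]
    refine LinearMap.eqOn_span' (f := b1 Q X Y ∘ₗ b1 Q X Y ∘ₗ IT Q leaf X Y) (g := 0) ?_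
      (tin_mem_span_length (homLetters Q.s) 1 X Y z)
    rintro _ ⟨w, hw, rfl⟩
    match w, hw with
    | .snoc .nil x, _ =>
      have h1 : ∀ x, tder Q.sd X Y (tsnoc (tone Q.s X) x) = tsnoc (tone Q.s X) (Q.sd X Y x) :=
        fun x => by rw [tder_tsnoc, tder_tone, map_zero, LinearMap.zero_apply, zero_add]
      rw [LinearMap.comp_apply, LinearMap.comp_apply, h, h, Word.map_snoc, Word.map_nil, Ev_snoc,
        Ev_nil, h1, h1]
      have h2 : ∀ x, Q.sd X Y (Q.sd X Y x) = 0 := fun x => by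
        change -Q.d X Y (-Q.d X Y x) = 0
        rw [map_neg, neg_neg, Q.d_sq]
      rw [h2, map_zero, map_zero]; rfl
  | node n hn c, X, Y, z => by
    refine apply_inc_node_eq (g := b1 Q X Y ∘ₗ b1 Q X Y) (h := 0) hn c (fun P hP => ?_) z
    rw [LinearMap.comp_apply, LinearMap.zero_apply, ← bT_coder_tlet]
    -- As b ∘ B vanishes outside T¹, b₁²(b P) equals (b ∘ B)(B P) = b(B² P), and B² is the
    -- coderivation with components b ∘ B.
    have h1 := apply_eq_apply_pr1 (g := bT Q X Y ∘ₗ coder (bT Q) X Y) bT_coder_Ev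
      (coder (bT Q) X Y (Ev (val P)))
    rw [pr1_coder, LinearMap.comp_apply, LinearMap.comp_apply] at h1
    rw [← h1]
    have h2 := coder_pre_coder (bT Q) (letMap_pre_eps_of_odd b_deg)
    have h3 : coder (bT Q) X Y (coder (bT Q) X Y (Ev (val P))) = _ :=
      LinearMap.congr_fun (congrFun (congrFun h2 X) Y) (Ev (val P))
    rw [h3]
    refine (congrArg (bT Q X Y) ?_).trans (map_zero _)
    refine (conv_Ev _ _ _).trans ?_
    rw [ssum_val, Word.ssum_congr P (γ := fun _ _ _ => 0), Word.ssum_zero]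
    intro W y x hw
    refine (congrArg (tmul.flip (lmId (sF Q) W Y (Ev (val x)))) ?_).trans (map_zero _)
    rw [conv_Ev, ssum_val, Word.ssum_congr y (γ := fun _ _ _ => 0), Word.ssum_zero]
    intro Z u v hy
    refine (congrArg (tmul (lmId (sF Q) X Z (Ev (val u)))) ?_).trans (map_zero _)
    refine (congrArg tlet ?_).trans (map_zero tlet)
    -- Only a single letter v can contribute. Its tree is one of the children of the lowest vertex,
    -- so the induction hypothesis applies.
    by_cases hv : v.length = 1
    · match v, hv with
      | .snoc .nil a, _ =>
        refine (bT_coder_tlet _).trans ?_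
        have h4 : a.t ∈ List.ofFn c := by
          rw [← hP, ← hw, ← hy]; simp
        obtain ⟨i, hi⟩ := (List.mem_ofFn' _ _).1 h4
        have h5 := b1_b1_inc (c i) Z W
        rw [hi] at h5
        exact h5 a.z
    · exact bT_coder_Ev _ (by simpa using hv)

theorem bT_coder {X Y : O} (z : TT (sF Q) X Y) : bT Q X Y (coder (bT Q) X Y z) = 0 := by
  refine LinearMap.congr_fun (f := bT Q X Y ∘ₗ coder (bT Q) X Y) (g := 0) (tt_ext fun w => ?_) z
  by_cases h : w.length = 1
  · match w, h with
    | .snoc .nil x, _ =>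
      refine (bT_coder_tlet x).trans ?_
      exact LinearMap.congr_fun (f := b1 Q X Y ∘ₗ b1 Q X Y) (g := 0)
        (sF_ext Q fun t z => b1_b1_inc t X Y z) x
  · exact bT_coder_Ev w h

end FreeAInf

/-- The free `A∞`-category is an `A∞`-category. -/
theorem isAInfCat_freeAInf {k : Type u} [CommRing k] {O : Type u} (Q : DGQuiv k O) :
    (freeAInf Q).IsAInfCat where
  b_zero := rfl
  b_deg := FreeAInf.b_deg
  rel n _ := by
    refine funext fun X => funext fun Y => LinearMap.ext fun z => ?_
    have h := (total_coder_tin (φ := fun X : O => X) (FreeAInf.b Q) (FreeAInf.b Q) n z).symm.trans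
      (FreeAInf.bT_coder _)
    simp only [Finset.sum_apply]
    exact h

/-! ### The inverse of grafting. -/

namespace GQuiv

theorem Word.ssum_append_eq {O : Type u} {H : O → O → Type u} {M : Type*} [AddCommMonoid M]
    {X Z Y : O} (u : Word H X Z) (v : Word H Z Y) (β : ∀ W, Word H X W → Word H W Y → M)
    (h : ∀ W p q, q.length ≠ v.length → β W p q = 0) : (u.append v).ssum β = β Z u v := by
  induction v with
  | nil => exact ssum_eq_right u β h
  | snoc v x ih =>
    rw [append_snoc, ssum_snoc, h _ _ nil (by simp), zero_add]
    exact ih _ fun W p q hq => h W p _ (by simpa using hq)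

section

variable {k : Type u} [CommRing k] {O P : Type u} {A : GQuiv k O} {B : GQuiv k P} {φ : O → P}

/-- Since h sees only words of length s, the single cut that leaves s letters on the right
contributes to the convolution. -/
theorem conv_tmul_of_length {g h : LM φ A B} {s : ℕ}
    (hh : ∀ X Y (w : Word A.Hom X Y), w.length ≠ s → h X Y (Ev w) = 0) {X Z Y : O}
    (y : TT A X Z) (b : (pow A s).Hom Z Y) :
    conv g h X Y (tmul y (tin A s Z Y b)) = tmul (g X Z y) (h Z Y (tin A s Z Y b)) := by
  refine LinearMap.eqOn_span' (f := conv g h X Y ∘ₗ tmul y) (g := tmul (g X Z y) ∘ₗ h Z Y) ?_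
    (tin_mem_span_length (homLetters A) s Z Y b)
  rintro _ ⟨v, hv, rfl⟩
  refine LinearMap.congr_fun (f := conv g h X Y ∘ₗ tmul.flip (Ev (v.map (homLetters A).el)))
    (g := tmul.flip (h Z Y (Ev (v.map (homLetters A).el))) ∘ₗ g X Z) (tt_ext fun w => ?_) y
  simp only [LinearMap.comp_apply, LinearMap.flip_apply]
  rw [← Ev_append, conv_Ev]
  refine Word.ssum_append_eq _ _ _ fun W p q hq => ?_
  rw [hh _ _ _ (by simpa [hv] using hq), map_zero]

end

end GQuiv

namespace FreeAInf

open PTree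

variable {k : Type u} [CommRing k] {O : Type u} (Q : DGQuiv k O)

theorem IT_Ev_of_ne (t : PTree) {X Y : O} (w : Word Q.s.Hom X Y) (h : w.length ≠ t.leaves) :
    IT Q t X Y (Ev w) = 0 := by
  rw [Ev_eq_tin, IT_tin_of_ne Q t h]

/-- The map `TsQ → TsFQ` which cuts a tensor according to the numbers of input vertices of the
trees from the reversed list. -/
def unj : List PTree → LM (fun X : O => X) Q.s (sF Q)
  | [] => eta _ _ _
  | t :: r => conv (unj r) (letMap fun X Y => (eps (sF Q) X Y ^ vertsL r) ∘ₗ IT Q t X Y)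

variable {Q}

/-- The lengths determine where to cut, one tree at a time from the right. The powers of the parity
operator reproduce `sgn`. -/
theorem unj_flat {X Y : O} (P : SWord Q X Y) :
    unj Q (trees P).reverse X Y (flat P) = sg k (sgn P) • Ev (val P) := by
  induction P with
  | nil =>
    rw [sgn_nil, sg_zero, one_smul]
    exact eta_tone X
  | @snoc Z Y P a ih =>
    rw [trees_snoc, List.reverse_append, List.reverse_singleton, List.singleton_append, unj,
      flat_snoc, conv_tmul_of_length (s := a.t.leaves), ih]
    · have hv : vertsL (trees P).reverse = vertsL (trees P) := by
        rw [vertsL, List.map_reverse, List.sum_reverse]; rfl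
      have h1 : letMap (φ := fun X : O => X) (fun X Y => (eps (sF Q) X Y ^
          vertsL (trees P).reverse) ∘ₗ IT Q a.t X Y) Z Y (tin Q.s a.t.leaves Z Y a.z) =
          sg k (vertsL (trees P) * (a.δ + a.t.verts)) • tlet (inc Q a.t Z Y a.z) := by
        rw [letMap, LinearMap.comp_apply, LinearMap.comp_apply, IT_tin_self, eps_pow_inc, hv,
          map_smul]
      rw [h1, map_smul, map_smul, LinearMap.smul_apply, sgn_snoc, sg_add, smul_smul, mul_comm,
        val_snoc, Ev_snoc, ← tmul_tlet]
    · intro X Y w hw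
      rw [letMap, LinearMap.comp_apply, LinearMap.comp_apply, IT_Ev_of_ne Q a.t w hw, map_zero,
        map_zero]

/-- The restriction of the inverse of the operations `b n`, `n ≥ 2`, to a summand. -/
def unjoinTree (X Y : O) : (t : PTree) → (pow Q.s t.leaves).Hom X Y →ₗ[k] TT (sF Q) X Y
  | leaf => 0
  | node _ _ c => unj Q (List.ofFn c).reverse X Y ∘ₗ tin Q.s (∑ i, (c i).leaves) X Y

/-- The inverse of the operations `b n`, `n ≥ 2`, extended by zero to the generators. -/
def unjoin (X Y : O) : (sF Q).Hom X Y →ₗ[k] TT (sF Q) X Y := lift Q (unjoinTree X Y)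

theorem unjoin_leaf {X Y : O} (z : (pow Q.s leaf.leaves).Hom X Y) :
    unjoin X Y (inc Q leaf X Y z) = 0 := by
  rw [unjoin, lift_inc]; rfl

/-- Grafting and cutting produce the same sign, whose square is 1. Hence a word with at least two
letters can be recovered from the value of the operation on it. -/
theorem unjoin_bT {X Y : O} (P : SWord Q X Y) (hP : 2 ≤ P.length) :
    unjoin X Y (bT Q X Y (Ev (val P))) = Ev (val P) := by
  have hl : 2 ≤ (trees P).length := by simpa using hP
  obtain ⟨z, -, hz⟩ := flat_eq_tin P
  have h : ∀ (t : PTree) (n : ℕ) (z : (pow Q.s n).Hom X Y) (e : n = t.leaves), unjoin X Y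
      (IT Q t X Y (tin Q.s n X Y z)) = unjoinTree X Y t (castPow Q.s e X Y z) := fun t n z e => by
    rw [IT_tin Q t e, unjoin, lift_inc]
  rw [bT_val P hP, map_smul, hz, nodeL_eq hl, h _ _ z (by rw [← nodeL_eq hl, leaves_nodeL hl])]
  have h2 := tin_castPow (A := Q.s) (show leavesL (trees P) =
    ∑ i, ((trees P).get i).leaves by rw [← leavesL_ofFn, List.ofFn_get]) X Y z
  refine (congrArg (fun y => sg k (sgn P) • unj Q (List.ofFn (trees P).get).reverse X Y y)
    h2).trans ?_
  rw [← hz, List.ofFn_get]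
  dsimp only
  rw [unj_flat, smul_smul, sg_mul_self, one_smul]

end FreeAInf

/-! ### Degrees and locality of cocategory homomorphisms. -/

namespace GQuiv

section

variable {k : Type u} [CommRing k] {O P : Type u} {A : GQuiv k O} {B : GQuiv k P} {φ : O → P}

theorem Word.ssum_mem {H : O → O → Type u} {M : Type*} [AddCommGroup M] [Module k M]
    (N : Submodule k M) {X Y : O} (w : Word H X Y) {β : ∀ Z, Word H X Z → Word H Z Y → M}
    (h : ∀ Z u v, u.append v = w → β Z u v ∈ N) : w.ssum β ∈ N := by
  induction w with
  | nil => exact h X nil nil rfl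
  | @snoc V Y w x ih =>
    rw [ssum_snoc]
    exact Submodule.add_mem _ (h _ _ _ rfl) (ih (β := fun Z u v => β Z u (v.snoc x))
      fun Z u v e => h Z u (v.snoc x) (congrArg (fun y => snoc y x) e))

theorem tone_mem_tgr (X : O) : tone A X ∈ tgr A X X 0 :=
  Ev_mem_tgr (homLetters A) (.nil : Word _ X X)

theorem tsnoc_mem_tgr {X Z Y : O} {i j : ℤ} {z : TT A X Z} {x : A.Hom Z Y}
    (hz : z ∈ tgr A X Z i) (hx : x ∈ A.gr Z Y j) : tsnoc z x ∈ tgr A X Y (i + j) := by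
  have : tgr A X Z i ≤ (tgr A X Y (i + j)).comap (tsnoc.flip x) := by
    refine iSup_le fun n => ?_
    rintro _ ⟨z, hz, rfl⟩
    rw [Submodule.mem_comap, LinearMap.flip_apply, tsnoc_tin]
    exact tin_mem_tgr (psnoc_mem hz hx)
  exact this hz

theorem tmul_mem_tgr {X Z Y : O} {i j : ℤ} {z : TT A X Z} {y : TT A Z Y}
    (hz : z ∈ tgr A X Z i) (hy : y ∈ tgr A Z Y j) : tmul z y ∈ tgr A X Y (i + j) := by
  have h : ∀ n (y : (pow A n).Hom Z Y), y ∈ (pow A n).gr Z Y j →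
      tgr A X Z i ≤ (tgr A X Y (i + j)).comap (tmul.flip (tin A n Z Y y)) := fun n y hy => by
    refine iSup_le fun m => ?_
    rintro _ ⟨z, hz, rfl⟩
    rw [Submodule.mem_comap, LinearMap.flip_apply, tmul_tin]
    exact tin_mem_tgr (pcat_mem hz hy)
  have : tgr A Z Y j ≤ (tgr A X Y (i + j)).comap (tmul z) := by
    refine iSup_le fun n => ?_
    rintro _ ⟨y, hy, rfl⟩
    exact h n y hy hz
  exact this hy

theorem total_mem {f : ∀ n, QHom φ (pow A n) B} {e : ℤ} (hf : ∀ n, HasDegree (f n) e) {X Y : O}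
    {d : ℤ} {z : TT A X Y} (hz : z ∈ tgr A X Y d) :
    total f X Y z ∈ B.gr (φ X) (φ Y) (d + e) := by
  have : tgr A X Y d ≤ (B.gr (φ X) (φ Y) (d + e)).comap (total f X Y) := by
    refine iSup_le fun n => ?_
    rintro _ ⟨z, hz, rfl⟩
    rw [Submodule.mem_comap, total_tin]
    exact hf n X Y d z hz
  exact this hz

theorem cohom_mem_tgr {f : ∀ n, QHom φ (pow A n) B} (hf : ∀ n, HasDegree (f n) 0)
    (h0 : f 0 = 0) (L : Letters A) {X Y : O} (w : Word L.H X Y) :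
    cohom (total f) X Y (Ev (w.map L.el)) ∈ tgr B (φ X) (φ Y) (w.deg L.dg) := by
  induction hn : w.length using Nat.strong_induction_on generalizing Y with
  | _ n ih =>
    subst hn
    rw [cohom_Ev_eq (total_tone h0), Word.ssum_map]
    refine Submodule.add_mem _ ?_ (Word.ssum_mem _ w fun Z u v e => ?_)
    · cases w with
      | nil => rw [Word.map_nil, Ev_nil, eta_tone]; exact tone_mem_tgr _
      | snoc w x => rw [eta_Ev_of_length_ne_zero (by simp)]; exact Submodule.zero_mem _
    · subst e
      cases v with
      | nil => rw [Word.map_nil, Ev_nil, total_tone h0, map_zero]; exact Submodule.zero_mem _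
      | snoc v x =>
        have h := tsnoc_mem_tgr (ih u.length (by simp) u rfl)
          (total_mem hf (Ev_mem_tgr L (v.snoc x)))
        rwa [add_zero, ← Word.deg_append] at h

theorem coder_mem_tgr {b : ∀ n, QMap (pow A n) A} (hb : ∀ n, HasDegree (b n) 1)
    (L : Letters A) {X Y : O} (w : Word L.H X Y) :
    coder (total b) X Y (Ev (w.map L.el)) ∈ tgr A X Y (w.deg L.dg + 1) := by
  rw [coder_Ev, Word.ssum_map]
  refine Word.ssum_mem _ w fun W y x e => ?_
  rw [Word.ssum_map]
  refine Word.ssum_mem _ y fun Z u v e' => ?_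
  subst e e'
  rw [Ev_append, ← teps_Ev, teps_Ev_letters, map_smul]
  refine Submodule.smul_mem _ _ ?_
  have h := tmul_mem_tgr (tsnoc_mem_tgr (Ev_mem_tgr L u)
    (total_mem (φ := fun X : O => X) hb (Ev_mem_tgr L v))) (Ev_mem_tgr L x)
  rwa [show u.deg L.dg + (v.deg L.dg + 1) + x.deg L.dg =
    ((u.append v).append x).deg L.dg + 1 by simp; ring] at h

/-- The homomorphism applies its components only to consecutive subwords, so agreement on these
suffices. This locality makes the functor equation a recursion. -/
theorem cohom_Ev_congr {f g : ∀ X Y, TT A X Y →ₗ[k] B.Hom (φ X) (φ Y)}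
    (hf : ∀ X, f X X (tone A X) = 0) (hg : ∀ X, g X X (tone A X) = 0)
    {H : O → O → Type u} (el : ∀ X Y, H X Y → A.Hom X Y) {X Y : O} (w : Word H X Y)
    (h : ∀ Z W (u : Word H X Z) (v : Word H Z W) (x : Word H W Y),
      (u.append v).append x = w → f Z W (Ev (v.map el)) = g Z W (Ev (v.map el))) :
    cohom f X Y (Ev (w.map el)) = cohom g X Y (Ev (w.map el)) := by
  induction hn : w.length using Nat.strong_induction_on generalizing Y with
  | _ n ih =>
    subst hn
    rw [cohom_Ev_eq hf, cohom_Ev_eq hg, Word.ssum_map, Word.ssum_map]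
    congr 1
    refine Word.ssum_congr w fun Z u v e => ?_
    subst e
    cases v with
    | nil => rw [Word.map_nil, Ev_nil, hf, hg, map_zero, map_zero]
    | snoc v x =>
      rw [h _ _ u (v.snoc x) .nil rfl, ih u.length (by simp) u (fun Z' W' u' v' x' e =>
        h _ _ u' v' (x'.append (v.snoc x)) (by rw [← Word.append_assoc, e])) rfl]

theorem cohom_tlet {f : ∀ X Y, TT A X Y →ₗ[k] B.Hom (φ X) (φ Y)}
    (hf : ∀ X, f X X (tone A X) = 0) {X Y : O} (x : A.Hom X Y) :
    cohom f X Y (tlet x) = tlet (f X Y (tlet x)) := by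
  have h : tlet x = Ev (Word.single x) := rfl
  rw [h, cohom_Ev_eq hf, eta_Ev_of_length_ne_zero (by simp), Word.ssum_snoc, Word.ssum_nil,
    Ev_nil, hf, Ev_nil, cohom_tone hf, map_zero, zero_add, zero_add]
  rfl

theorem total_cohom_tin (f : ∀ n, QHom φ (pow A n) B) {b : ∀ n, QMap (pow B n) B}
    (hb : b 0 = 0) (n : ℕ) {X Y : O} (z : (pow A n).Hom X Y) :
    total (φ := fun X : P => X) b (φ X) (φ Y) (cohom (total f) X Y (tin A n X Y z)) =
      (∑ l ∈ Finset.Icc 1 n, b l (φ X) (φ Y) ∘ₗ coeff f l n X Y) z := by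
  have h : cohom (total f) X Y (tin A n X Y z) =
      ∑ l ∈ Finset.range (n + 1), tin B l (φ X) (φ Y) (coeff f l n X Y z) := by
    rw [cohom, tout_tin, LinearMap.sum_apply]
    exact Finset.sum_congr rfl fun l _ => (tin_coeff f l n z).symm
  rw [h, map_sum, LinearMap.sum_apply]
  simp only [total_tin, LinearMap.comp_apply]
  -- The series starts with l = 0 and the functor equation with l = 1; the additional term is zero
  -- because `b 0 = 0`.
  have h1 : Finset.Icc 1 n = (Finset.range (n + 1)).erase 0 := by
    ext l; simp; omega
  rw [h1, Finset.sum_erase]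
  rw [hb]; rfl

end

end GQuiv

/-! ### Tensors of length one and sequences of components. -/

namespace GQuiv

section

variable {k : Type u} [CommRing k] {O P : Type u} {A : GQuiv k O} {B : GQuiv k P} {φ : O → P}

theorem ofPowOne_deg : HasDegree (φ := fun X : O => X) (ofPowOne A) 0 := by
  intro X Y d z hz
  refine pow_succ_induction (n := 0) (p := fun z => ofPowOne A X Y z ∈ A.gr X Y (d + 0)) hz
    ?_ ?_ ?_ ?_
  · rw [map_zero]; exact Submodule.zero_mem _
  · intro x y hx hy; rw [map_add]; exact Submodule.add_mem _ hx hy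
  · intro c x hx; rw [map_smul]; exact Submodule.smul_mem _ _ hx
  · rintro Z i j a x ha hx rfl
    refine pow_zero_gr (p := fun Z a => ∀ x : A.Hom Z Y, x ∈ A.gr Z Y j →
      ofPowOne A X Y (psnoc a x) ∈ A.gr X Y (i + j + 0)) ha ?_ ?_ x hx
    · intro x _
      rw [map_zero, LinearMap.zero_apply, map_zero]; exact Submodule.zero_mem _
    · rintro rfl c x hx
      rw [map_smul, LinearMap.smul_apply, map_smul, ofPowOne_psnoc, zero_add, add_zero]
      exact Submodule.smul_mem _ _ hx

theorem toPowOne_ofPowOne {X Y : O} (z : (pow A 1).Hom X Y) :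
    toPowOne A X Y (ofPowOne A X Y z) = z := by
  have h : ∀ y : TT A X Y, y ∈ Submodule.span k {y | ∃ w : Word (homLetters A).H X Y,
      w.length = 1 ∧ Ev (w.map (homLetters A).el) = y} → tlet (pr1 X Y y) = y := by
    refine LinearMap.eqOn_span' (f := tlet ∘ₗ pr1 X Y) (g := LinearMap.id) ?_
    rintro _ ⟨w, hw, rfl⟩
    match w, hw with
    | .snoc .nil x, _ => exact congrArg tlet (pr1_tlet _)
  have h1 := h _ (tin_mem_span_length (homLetters A) 1 X Y z)
  rw [pr1, tout_tin, tlet_eq_tin] at h1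
  -- Projecting back to T¹ extracts the equality from the direct sum.
  have h2 := congrArg (tout fun n => if h : n = 1 then castPow A h X Y else 0) h1
  rw [tout_tin, tout_tin] at h2
  exact h2

theorem components_deg {F : QHom φ A B} {f : ∀ n, 1 < n → QHom φ (pow A n) B}
    (hF : HasDegree F 0) (hf : ∀ n hn, HasDegree (f n hn) 0) : ∀ n, HasDegree (components F f n) 0
  | 0 => fun _ _ _ _ _ => Submodule.zero_mem _
  | 1 => fun X Y d z hz => by
    have h := hF X Y _ _ (ofPowOne_deg X Y d z hz)
    rwa [add_zero] at h
  | n + 2 => hf (n + 2) _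

theorem zero_deg : HasDegree (0 : QHom φ A B) 0 := fun _ _ _ _ _ => Submodule.zero_mem _

theorem total_components (F : QHom φ A B) (f : ∀ n, 1 < n → QHom φ (pow A n) B) {X Y : O}
    (z : TT A X Y) : total (components F f) X Y z =
      F X Y (pr1 X Y z) + total (components 0 f) X Y z := by
  refine LinearMap.congr_fun (g := F X Y ∘ₗ pr1 X Y + total (components 0 f) X Y)
    (tt_ext_tin fun n z => ?_) z
  rw [LinearMap.add_apply, LinearMap.comp_apply, total_tin, total_tin, pr1, tout_tin]
  match n with
  | 0 => exact (zero_add _).symm.trans (congrArg (· + _) (map_zero (F X Y)).symm)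
  | 1 => exact (add_zero _).symm
  | n + 2 => exact (zero_add _).symm.trans (congrArg (· + _) (map_zero (F X Y)).symm)

end

end GQuiv

/-! ### The recursion for the first component and the vanishing of the defect. -/

namespace FreeAInf

open PTree

variable {k : Type u} [CommRing k] {O P : Type u} {Q : DGQuiv k O} (A : AInfData k P) {φ : O → P}
  (f₁ : QHom φ Q.s A.s) (f : ∀ n, 1 < n → QHom φ (pow (sF Q) n) A.s) (F G : QHom φ (sF Q) A.s)

/-- The value which the first component `F` of an `A∞`-functor with higher components `f` has to
take at `bT z`. -/
def target (X Y : O) : TT (sF Q) X Y →ₗ[k] A.s.Hom (φ X) (φ Y) :=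
  total (φ := fun X : P => X) A.b (φ X) (φ Y) ∘ₗ cohom (total (components F f)) X Y -
    total (components 0 f) X Y ∘ₗ coder (bT Q) X Y

/-- In f ∘ B the first component contributes exactly F ∘ b. Moving the remaining terms to the other
side isolates the unknown value F(b z). -/
theorem sub_target {X Y : O} (z : TT (sF Q) X Y) :
    F X Y (bT Q X Y z) - target A f F X Y z =
      total (components F f) X Y (coder (bT Q) X Y z) -
        total (φ := fun X : P => X) A.b (φ X) (φ Y) (cohom (total (components F f)) X Y z) := by
  rw [total_components F f, pr1_coder, target, LinearMap.sub_apply, LinearMap.comp_apply,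
    LinearMap.comp_apply]
  abel

/-- The map given by `f₁` on generators and by zero on the other summands. -/
def genMapTree (X Y : O) : (t : PTree) → (pow Q.s t.leaves).Hom X Y →ₗ[k] A.s.Hom (φ X) (φ Y)
  | leaf => f₁ X Y ∘ₗ ofPowOne Q.s X Y
  | node _ _ _ => 0

/-- The equation `step F = F` expresses that `F` extends `f₁` and is the first component of an
`A∞`-functor. -/
def step : QHom φ (sF Q) A.s := fun X Y =>
  lift Q (genMapTree A f₁ X Y) + target A f F X Y ∘ₗ unjoin X Y

theorem step_leaf {X Y : O} (z : (pow Q.s leaf.leaves).Hom X Y) :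
    step A f₁ f F X Y (inc Q leaf X Y z) = f₁ X Y (ofPowOne Q.s X Y z) := by
  rw [step, LinearMap.add_apply, LinearMap.comp_apply, unjoin_leaf, map_zero, add_zero, lift_inc]
  rfl

theorem step_bT {X Y : O} (w : SWord Q X Y) (hw : 2 ≤ w.length) :
    step A f₁ f F X Y (bT Q X Y (Ev (val w))) = target A f F X Y (Ev (val w)) := by
  rw [step, LinearMap.add_apply, LinearMap.comp_apply, unjoin_bT w hw]
  refine (congrArg (· + _) ?_).trans (zero_add _)
  have hl : 2 ≤ (trees w).length := by simpa using hw
  obtain ⟨z, -, hz⟩ := flat_eq_tin w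
  rw [bT_val w hw, map_smul, hz, IT_tin Q _ (leaves_nodeL hl).symm, lift_inc]
  have : ∀ t, t = node _ hl (trees w).get → genMapTree A f₁ X Y t = 0 := by
    rintro _ rfl; rfl
  rw [this _ (nodeL_eq hl), LinearMap.zero_apply, smul_zero]

variable {A f₁ f F G}

theorem mem_trees {X Z W Y : O} (u : SWord Q X Z) (a : Simp Q Z W) (x : SWord Q W Y) :
    a.t ∈ trees ((u.snoc a).append x) := by simp

/-- In the coderivation term F is replaced by 0, and in `cohom` the first component acts only on
single letters of w. Hence only the values of F on the trees of w matter. -/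
theorem target_congr {X Y : O} (w : SWord Q X Y)
    (h : ∀ t ∈ trees w, ∀ X Y z, F X Y (inc Q t X Y z) = G X Y (inc Q t X Y z)) :
    target A f F X Y (Ev (val w)) = target A f G X Y (Ev (val w)) := by
  rw [target, target, LinearMap.sub_apply, LinearMap.sub_apply]
  refine congrArg (· - _) (congrArg (total A.b (φ X) (φ Y)) ?_)
  refine cohom_Ev_congr (total_tone rfl) (total_tone rfl) (simpLetters Q).el w ?_
  intro Z W u v x hw
  rw [total_components F, total_components G]
  refine congrArg (· + _) ?_
  by_cases hv : v.length = 1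
  · match v, hv with
    | .snoc .nil a, _ =>
      have h1 : pr1 Z W (Ev ((Word.single a).map (simpLetters Q).el)) = inc Q a.t Z W a.z :=
        pr1_tlet _
      refine (congrArg (F Z W) h1).trans (Eq.trans (h a.t ?_ Z W a.z) (congrArg (G Z W) h1).symm)
      rw [← hw]; exact mem_trees u a x
  · rw [pr1_Ev _ (by simpa using hv), map_zero, map_zero]

/-- Coincidence on the summands given by trees with at most `N` internal vertices. -/
def Agree (N : ℕ) (F G : QHom φ (sF Q) A.s) : Prop :=
  ∀ t : PTree, t.verts ≤ N → ∀ X Y z, F X Y (inc Q t X Y z) = G X Y (inc Q t X Y z)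

theorem agree_zero : Agree 0 (step A f₁ f F) (step A f₁ f G) := by
  rintro (_ | ⟨n, hn, c⟩) ht X Y z
  · rw [step_leaf, step_leaf]
  · simp [verts] at ht

/-- On a tree with a lowest vertex `step` uses F only on the children of this vertex, which together
have one internal vertex less. -/
theorem Agree.succ {N : ℕ} (h : Agree N F G) : Agree (N + 1) (step A f₁ f F) (step A f₁ f G) := by
  rintro (_ | ⟨n, hn, c⟩) ht X Y z
  · rw [step_leaf, step_leaf]
  · refine apply_inc_node_eq hn c (fun w hw => ?_) z
    have h2 : 2 ≤ w.length := by rw [← length_trees, hw, List.length_ofFn]; exact hn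
    rw [step_bT _ _ _ _ w h2, step_bT _ _ _ _ w h2]
    refine target_congr w fun t ht' => h t ?_
    rw [hw] at ht'
    obtain ⟨i, rfl⟩ := (List.mem_ofFn' _ _).1 ht'
    rw [verts] at ht
    have := Finset.single_le_sum (f := fun i => (c i).verts) (fun _ _ => Nat.zero_le _)
      (Finset.mem_univ i)
    omega

theorem eq_of_agree (h : ∀ N, Agree N F G) : F = G :=
  funext fun X => funext fun Y => sF_ext Q fun t z => h _ t le_rfl X Y z

theorem eq_of_step_eq (hF : step A f₁ f F = F) (hG : step A f₁ f G = G) : F = G := by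
  refine eq_of_agree fun N => ?_
  induction N with
  | zero => rw [← hF, ← hG]; exact agree_zero
  | succ N ih => rw [← hF, ← hG]; exact ih.succ

variable (A f₁ f)

/-- The iterates stabilize on each summand. One application of `step` settles the generators,
whatever map it starts from, hence the shift by 1 in the exponents. -/
theorem agree_iterate {N M : ℕ} (h : N ≤ M) :
    Agree N ((step A f₁ f)^[N + 1] 0) ((step A f₁ f)^[M + 1] 0) := by
  induction N generalizing M with
  | zero =>
    rw [Function.iterate_succ_apply', Function.iterate_succ_apply']; exact agree_zero
  | succ N ih =>
    obtain ⟨M, rfl⟩ : ∃ m, M = m + 1 := ⟨M - 1, by omega⟩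
    rw [Function.iterate_succ_apply' _ (N + 1), Function.iterate_succ_apply' _ (M + 1)]
    exact (ih (by omega)).succ

/-- The fixed point of `step`. -/
def extension : QHom φ (sF Q) A.s := fun X Y =>
  lift Q fun t => ((step A f₁ f)^[t.verts + 1] 0 : QHom φ (sF Q) A.s) X Y ∘ₗ inc Q t X Y

theorem agree_extension (N : ℕ) :
    Agree N (extension A f₁ f) ((step A f₁ f)^[N + 1] 0) := by
  intro t ht X Y z
  rw [extension, lift_inc]
  exact agree_iterate A f₁ f ht t le_rfl X Y z

theorem step_extension : step A f₁ f (extension A f₁ f) = extension A f₁ f := by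
  refine eq_of_agree fun N t ht X Y z => ?_
  rw [agree_extension A f₁ f N t ht X Y z]
  cases N with
  | zero => exact agree_zero t ht X Y z
  | succ N =>
    rw [Function.iterate_succ_apply' _ (N + 1)]
    exact (agree_extension A f₁ f N).succ t ht X Y z

variable {A f₁ f}

theorem target_mem (hA : A.IsAInfCat) (hf : ∀ n hn, HasDegree (f n hn) 0) (hF : HasDegree F 0)
    {X Y : O} (w : SWord Q X Y) :
    target A f F X Y (Ev (val w)) ∈ A.s.gr (φ X) (φ Y) (sdeg w + 1) := by
  rw [target, LinearMap.sub_apply]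
  refine Submodule.sub_mem _ ?_ ?_
  · exact total_mem (φ := fun X : P => X) hA.b_deg
      (cohom_mem_tgr (components_deg hF hf) rfl (simpLetters Q) w)
  · have h := total_mem (components_deg (φ := φ) (B := A.s) zero_deg hf)
      (coder_mem_tgr b_deg (simpLetters Q) w)
    rw [add_zero] at h
    exact h

theorem step_deg (hA : A.IsAInfCat) (hf₁ : HasDegree f₁ 0) (hf : ∀ n hn, HasDegree (f n hn) 0)
    (hF : HasDegree F 0) : HasDegree (step A f₁ f F) 0 := by
  intro X Y d x hx
  have h1 : Submodule.span k {y | ∃ (t : PTree) (z : (pow Q.s t.leaves).Hom X Y),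
      z ∈ (pow Q.s t.leaves).gr X Y (d - t.verts) ∧ inc Q t X Y z = y} ≤
      (A.s.gr (φ X) (φ Y) (d + 0)).comap (step A f₁ f F X Y) := by
    refine Submodule.span_le.2 ?_
    rintro _ ⟨t, z, hz, rfl⟩
    change step A f₁ f F X Y (inc Q t X Y z) ∈ A.s.gr (φ X) (φ Y) (d + 0)
    match t, z, hz with
    | leaf, z, hz =>
      rw [step_leaf]
      have h := hf₁ X Y _ _ (ofPowOne_deg X Y _ z hz)
      rwa [verts, Nat.cast_zero, sub_zero, add_zero] at h
    | node n hn c, z, hz =>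
      rw [← IT_tin_self, add_zero]
      have h2 : Submodule.span k {y | ∃ w : SWord Q X Y, trees w = List.ofFn c ∧
          qdeg w = d - ((node n hn c).verts : ℤ) ∧ flat w = y} ≤
          (A.s.gr (φ X) (φ Y) d).comap (step A f₁ f F X Y ∘ₗ IT Q (node n hn c) X Y) := by
        refine Submodule.span_le.2 ?_
        rintro _ ⟨w, hw, hd, rfl⟩
        change step A f₁ f F X Y (IT Q (node n hn c) X Y (flat w)) ∈
          A.s.gr (φ X) (φ Y) d
        have h3 : 2 ≤ w.length := by rw [← length_trees, hw, List.length_ofFn]; exact hn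
        have h4 := step_bT A f₁ f F w h3
        rw [bT_val w h3, hw, ← node_eq_nodeL_ofFn hn, map_smul] at h4
        have h5 := congrArg (sg k (sgn w) • ·) h4
        dsimp only at h5
        rw [smul_smul, sg_mul_self, one_smul] at h5
        rw [h5]
        have h6 := target_mem hA hf hF w
        -- The degree 1 of the operations compensates for the new lowest vertex in the shift of the
        -- summand.
        rw [sdeg_eq, hd, hw, vertsL_ofFn, verts, show d - ((1 + ∑ i, (c i).verts : ℕ) : ℤ) +
          ((∑ i, (c i).verts : ℕ) : ℤ) + 1 = d by push_cast; ring] at h6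
        exact Submodule.smul_mem _ _ h6
      exact h2 (tin_mem_span_flat_deg (List.ofFn c) (leavesL_ofFn c).symm hz)
  exact h1 (sF_gr_le Q X Y d hx)

theorem extension_deg (hA : A.IsAInfCat) (hf₁ : HasDegree f₁ 0)
    (hf : ∀ n hn, HasDegree (f n hn) 0) : HasDegree (extension A f₁ f) 0 := by
  have h : ∀ N, HasDegree ((step A f₁ f)^[N] 0) 0 := fun N => by
    induction N with
    | zero => exact zero_deg
    | succ N ih => rw [Function.iterate_succ_apply']; exact step_deg hA hf₁ hf ih
  intro X Y d x hx
  have h1 : Submodule.span k {y | ∃ (t : PTree) (z : (pow Q.s t.leaves).Hom X Y),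
      z ∈ (pow Q.s t.leaves).gr X Y (d - t.verts) ∧ inc Q t X Y z = y} ≤
      (A.s.gr (φ X) (φ Y) (d + 0)).comap (extension A f₁ f X Y) := by
    refine Submodule.span_le.2 ?_
    rintro _ ⟨t, z, hz, rfl⟩
    change extension A f₁ f X Y (inc Q t X Y z) ∈ A.s.gr (φ X) (φ Y) (d + 0)
    rw [agree_extension A f₁ f t.verts t le_rfl X Y z]
    have := h (t.verts + 1) X Y _ _ (inc_mem Q t hz)
    rwa [sub_add_cancel] at this
  exact h1 (sF_gr_le Q X Y d hx)

/-- The relations with several arguments. -/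
theorem apply_bT_Ev (hA : A.IsAInfCat) (h : step A f₁ f F = F) {X Y : O}
    (w : Word (sF Q).Hom X Y) (hw : w.length ≠ 1) :
    F X Y (bT Q X Y (Ev w)) = target A f F X Y (Ev w) := by
  rw [Ev_eq_tin]
  refine LinearMap.eqOn_span' (f := F X Y ∘ₗ bT Q X Y) (g := target A f F X Y) ?_
    (tin_mem_span_length (simpLetters Q) w.length X Y (ev w))
  rintro _ ⟨v, hv, rfl⟩
  rw [LinearMap.comp_apply]
  by_cases h2 : 2 ≤ v.length
  · have h3 := step_bT A f₁ f F v h2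
    rw [h] at h3
    exact h3
  · match v with
    | .nil =>
      rw [Word.map_nil, Ev_nil, bT_tone, map_zero, target, LinearMap.sub_apply,
        LinearMap.comp_apply, LinearMap.comp_apply, coder_tone bT_tone, map_zero,
        cohom_tone (total_tone rfl), total_tone (φ := fun X : P => X) hA.b_zero, sub_zero]
    | .snoc .nil a => exact absurd hv.symm hw
    | .snoc (.snoc v a) c => simp at h2

variable (A f F) in
/-- The failure of `F` and the higher components `f` to form an `A∞`-functor. -/
def defect (X Y : O) : TT (sF Q) X Y →ₗ[k] A.s.Hom (φ X) (φ Y) :=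
  total (components F f) X Y ∘ₗ coder (bT Q) X Y -
    total (φ := fun X : P => X) A.b (φ X) (φ Y) ∘ₗ cohom (total (components F f)) X Y

theorem defect_eq {X Y : O} (z : TT (sF Q) X Y) :
    defect A f F X Y z = F X Y (bT Q X Y z) - target A f F X Y z := (sub_target A f F z).symm

/-- Apply b' to the formula for Φ B − B' Φ with Φ = `cohom f`. The term b' B' vanishes by the
relations of A, and B² = 0 removes f ∘ B from the defect at B z. -/
theorem defect_coder (hA : A.IsAInfCat) (hf : ∀ n hn, HasDegree (f n hn) 0) (hF : HasDegree F 0)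
    {X Y : O} (z : TT (sF Q) X Y) : defect A f F X Y (coder (bT Q) X Y z) =
      -total (φ := fun X : P => X) A.b (φ X) (φ Y)
        (conv (conv (cohom (total (components F f))) (letMap (defect A f F)))
          ((cohom (total (components F f))).pre (lmEps (sF Q))) X Y z) := by
  have h1 := LinearMap.congr_fun (congrFun (congrFun (cohom_pre_coder_sub
    (f := total (components F f)) (total_tone rfl) (letMap_pre_eps_of_even (components_deg hF hf))
      (bT Q) (total (φ := fun X : P => X) A.b)) X) Y) z
  have h2 := congrArg (total (φ := fun X : P => X) A.b (φ X) (φ Y)) h1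
  have h3 : coder (bT Q) X Y (coder (bT Q) X Y z) = 0 := by
    have h4 := LinearMap.congr_fun (congrFun (congrFun
      (coder_pre_coder (bT Q) (letMap_pre_eps_of_odd b_deg)) X) Y) z
    have h5 : (letMap (φ := fun X : O => X) (bT Q)).pre (coder (bT Q)) = 0 :=
      funext fun X => funext fun Y => LinearMap.ext fun z =>
        (congrArg tlet (bT_coder z)).trans (map_zero _)
    rw [h5, conv_zero_right, conv_zero_left] at h4
    exact h4
  have h6 : total (φ := fun X : P => X) A.b (φ X) (φ Y)
      (cohom (total (components F f)) X Y (coder (bT Q) X Y z) -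
        coder (total A.b) (φ X) (φ Y) (cohom (total (components F f)) X Y z)) = _ := h2
  rw [map_sub, hA.total_coder, sub_zero] at h6
  rw [defect, LinearMap.sub_apply, LinearMap.comp_apply, LinearMap.comp_apply, h3, map_zero,
    zero_sub, h6]
  rfl

/-- On generators b₁ is the differential of sQ and F is f₁, so the equation with one argument is the
chain condition on f₁. -/
theorem defect_leaf (hchain : ∀ X Y (x : Q.s.Hom X Y), f₁ X Y (Q.sd X Y x) =
      A.b 1 (φ X) (φ Y) (toPowOne A.s (φ X) (φ Y) (f₁ X Y x)))
    (h : step A f₁ f F = F) {X Y : O} (z : (pow Q.s leaf.leaves).Hom X Y) :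
    defect A f F X Y (tlet (inc Q leaf X Y z)) = 0 := by
  have hl : ∀ z, F X Y (inc Q leaf X Y z) = f₁ X Y (ofPowOne Q.s X Y z) := fun z => by
    rw [← step_leaf A f₁ f F z, h]
  have ht : ∀ x : (sF Q).Hom X Y, total (components F f) X Y (tlet x) = F X Y x := fun x => by
    rw [tlet_eq_tin, total_tin]
    exact congrArg (F X Y) (ofPowOne_psnoc x)
  rw [defect, LinearMap.sub_apply, LinearMap.comp_apply, LinearMap.comp_apply,
    coder_tlet bT_tone, ht, bT_tlet, cohom_tlet (total_tone rfl), ht, hl,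
    tlet_eq_tin, total_tin, ← hchain, sub_eq_zero]
  have h1 : b1 Q X Y (inc Q leaf X Y z) = inc Q leaf X Y (der Q.sd 1 X Y z) := by
    rw [b1_inc]
    refine (congrArg₂ (· + ·) ?_ (Finset.sum_eq_zero fun e _ => e.elim)).trans (add_zero _)
    rw [verts, Nat.cast_zero, sg_zero, one_smul]
    rfl
  rw [h1]
  refine (hl (der Q.sd leaf.leaves X Y z)).trans ?_
  obtain ⟨x, rfl⟩ : ∃ x, z = toPowOne Q.s X Y x := ⟨_, (toPowOne_ofPowOne z).symm⟩
  have h2 : der Q.sd 1 X Y (psnoc (pone Q.s X) x) = psnoc (pone Q.s X) (Q.sd X Y x) := by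
    refine (der_psnoc Q.sd (pone Q.s X) x).trans ?_
    have : der Q.sd 0 X X (pone Q.s X) = 0 := rfl
    rw [this, map_zero, LinearMap.zero_apply]
    exact zero_add _
  have h3 : ofPowOne Q.s X Y (toPowOne Q.s X Y x) = x := ofPowOne_psnoc x
  refine congrArg (f₁ X Y) (Eq.trans ?_ (congrArg (Q.sd X Y) h3).symm)
  exact (congrArg (ofPowOne Q.s X Y) h2).trans (ofPowOne_psnoc _)

/-- Induction on the tree as for `b1_b1_inc`: the recursion makes the defect vanish on words of
length ≠ 1, and `defect_coder` reduces its value at b_n w to its values on the letters of w. -/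
theorem defect_inc (hA : A.IsAInfCat) (hf : ∀ n hn, HasDegree (f n hn) 0) (hF : HasDegree F 0)
    (hchain : ∀ X Y (x : Q.s.Hom X Y), f₁ X Y (Q.sd X Y x) =
      A.b 1 (φ X) (φ Y) (toPowOne A.s (φ X) (φ Y) (f₁ X Y x)))
    (h : step A f₁ f F = F) : ∀ (t : PTree) (X Y : O) (z : (pow Q.s t.leaves).Hom X Y),
      defect A f F X Y (tlet (inc Q t X Y z)) = 0
  | leaf, X, Y, z => defect_leaf hchain h z
  | node n hn c, X, Y, z => by
    have hE : ∀ {X Y : O} (w : Word (sF Q).Hom X Y), w.length ≠ 1 →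
        defect A f F X Y (Ev w) = 0 := fun w hw => by
      rw [defect_eq, sub_eq_zero]; exact apply_bT_Ev hA h w hw
    refine apply_inc_node_eq (g := defect A f F X Y ∘ₗ tlet) (h := 0) hn c (fun w hw => ?_) z
    rw [LinearMap.comp_apply, LinearMap.zero_apply]
    -- B w has the component b w in T¹, and the defect does not see the others; so its value at b w
    -- is its value at B w.
    have h1 := apply_eq_apply_pr1 (g := defect A f F X Y) hE (coder (bT Q) X Y (Ev (val w)))
    rw [pr1_coder] at h1
    rw [← h1, defect_coder hA hf hF, neg_eq_zero]
    refine (congrArg (total A.b (φ X) (φ Y)) ?_).trans (map_zero _)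
    rw [conv_Ev, ssum_val, Word.ssum_congr w (γ := fun _ _ _ => 0), Word.ssum_zero]
    intro W y x hy
    rw [conv_Ev, ssum_val, Word.ssum_congr y (γ := fun _ _ _ => 0), Word.ssum_zero, map_zero,
      LinearMap.zero_apply]
    intro Z u v hv
    refine (congrArg (tmul (cohom (total (components F f)) X Z (Ev (val u)))) ?_).trans (map_zero _)
    refine (congrArg tlet ?_).trans (map_zero tlet)
    by_cases hv1 : v.length = 1
    · match v, hv1 with
      | .snoc .nil a, _ =>
        have h4 : a.t ∈ List.ofFn c := by
          rw [← hw, ← hy, ← hv]; simp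
        obtain ⟨i, hi⟩ := (List.mem_ofFn' _ _).1 h4
        have h5 := defect_inc hA hf hF hchain h (c i) Z W
        rw [hi] at h5
        exact h5 a.z
    · exact hE _ (by simpa using hv1)

theorem defect_eq_zero (hA : A.IsAInfCat) (hf : ∀ n hn, HasDegree (f n hn) 0)
    (hF : HasDegree F 0) (hchain : ∀ X Y (x : Q.s.Hom X Y), f₁ X Y (Q.sd X Y x) =
      A.b 1 (φ X) (φ Y) (toPowOne A.s (φ X) (φ Y) (f₁ X Y x)))
    (h : step A f₁ f F = F) {X Y : O} (z : TT (sF Q) X Y) : defect A f F X Y z = 0 := by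
  rw [apply_eq_apply_pr1 (g := defect A f F X Y) (fun w hw => by
      rw [defect_eq, sub_eq_zero]; exact apply_bT_Ev hA h w hw) z]
  exact LinearMap.congr_fun (f := defect A f F X Y ∘ₗ tlet) (g := 0)
    (sF_ext Q fun t z => defect_inc hA hf hF hchain h t X Y z) _

theorem defect_tin (hA : A.IsAInfCat) (n : ℕ) {X Y : O} (z : (pow (sF Q) n).Hom X Y) :
    defect A f F X Y (tin (sF Q) n X Y z) =
      (∑ p ∈ Finset.HasAntidiagonal.antidiagonal n,
        ∑ q ∈ Finset.HasAntidiagonal.antidiagonal p.1,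
          components F f (q.1 + 1 + p.2) X Y ∘ₗ ins (b Q) n q.1 q.2 p.2 X Y) z -
      (∑ l ∈ Finset.Icc 1 n, A.b l (φ X) (φ Y) ∘ₗ coeff (components F f) l n X Y) z := by
  rw [← total_coder_tin, ← total_cohom_tin _ hA.b_zero]; rfl

/-- The source of uniqueness: the functor equations on words with at least two letters, together
with the values on generators, are already the fixed point equation. -/
theorem step_eq_of_defect
    (hgen : ∀ X Y (x : Q.s.Hom X Y), F X Y (gen Q X Y x) = f₁ X Y x)
    (h : ∀ n, 1 ≤ n → ∀ X Y z, defect A f F X Y (tin (sF Q) n X Y z) = 0) :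
    step A f₁ f F = F := by
  refine funext fun X => funext fun Y => sF_ext Q fun t z => ?_
  match t, z with
  | leaf, z =>
    rw [step_leaf, ← hgen]
    exact congrArg (fun z => F X Y (inc Q leaf X Y z)) (toPowOne_ofPowOne z)
  | node n hn c, z =>
    refine apply_inc_node_eq hn c (fun w hw => ?_) z
    have h2 : 2 ≤ w.length := by rw [← length_trees, hw, List.length_ofFn]; exact hn
    rw [step_bT _ _ _ _ w h2, eq_comm, ← sub_eq_zero, ← defect_eq, Ev_eq_tin]
    exact h _ (by rw [length_val]; omega) X Y _

theorem extension_gen {X Y : O} (x : Q.s.Hom X Y) :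
    extension A f₁ f X Y (gen Q X Y x) = f₁ X Y x := by
  rw [← step_extension]
  refine (step_leaf A f₁ f _ (toPowOne Q.s X Y x)).trans ?_
  exact congrArg (f₁ X Y) (ofPowOne_psnoc x)

theorem isAInfFunctor_extension (hA : A.IsAInfCat) (hf₁ : HasDegree f₁ 0)
    (hf : ∀ n hn, HasDegree (f n hn) 0)
    (hchain : ∀ X Y (x : Q.s.Hom X Y), f₁ X Y (Q.sd X Y x) =
      A.b 1 (φ X) (φ Y) (toPowOne A.s (φ X) (φ Y) (f₁ X Y x))) :
    IsAInfFunctor (freeAInf Q) A φ (components (extension A f₁ f) f) where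
  source := isAInfCat_freeAInf Q
  target := hA
  f_zero := rfl
  f_deg := components_deg (extension_deg hA hf₁ hf) hf
  rel n _ X Y := by
    refine LinearMap.ext fun z => ?_
    have h : ∀ z, defect A f (extension A f₁ f) X Y (tin (sF Q) n X Y z) = 0 := fun z =>
      defect_eq_zero hA hf (extension_deg hA hf₁ hf) hchain (step_extension A f₁ f) _
    simp only [defect_tin hA, sub_eq_zero] at h
    exact (h z).symm

theorem eq_extension {G : QHom φ (sF Q) A.s}
    (hgen : ∀ X Y (x : Q.s.Hom X Y), G X Y (gen Q X Y x) = f₁ X Y x)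
    (hG : IsAInfFunctor (freeAInf Q) A φ (components G f)) : G = extension A f₁ f := by
  refine eq_of_step_eq (step_eq_of_defect hgen fun n hn X Y z => ?_) (step_extension A f₁ f)
  rw [defect_tin hG.target, sub_eq_zero]
  exact (LinearMap.congr_fun (hG.rel n hn X Y) z).symm

end FreeAInf

end

theorem mainTheorem2 {k : Type u} [CommRing k] {O P : Type u} (Q : DGQuiv k O)
    (A : AInfData k P) (hA : A.IsAInfCat) (φ : O → P)
    (f₁ : GQuiv.QHom φ Q.s A.s) (hf₁ : GQuiv.HasDegree f₁ 0)
    (hchain : ∀ X Y (x : Q.s.Hom X Y), f₁ X Y (Q.sd X Y x) =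
      A.b 1 (φ X) (φ Y) (GQuiv.toPowOne A.s (φ X) (φ Y) (f₁ X Y x)))
    (f : ∀ n, 1 < n → GQuiv.QHom φ (GQuiv.pow (freeAInf Q).s n) A.s)
    (hf : ∀ n hn, GQuiv.HasDegree (f n hn) 0) :
    (freeAInf Q).IsAInfCat ∧
    ∃! F : GQuiv.QHom φ (freeAInf Q).s A.s,
      (∀ X Y (x : Q.s.Hom X Y), F X Y (FreeAInf.gen Q X Y x) = f₁ X Y x) ∧
      IsAInfFunctor (freeAInf Q) A φ (components F f) := by
  refine ⟨isAInfCat_freeAInf Q, FreeAInf.extension A f₁ f, ⟨fun X Y x => FreeAInf.extension_gen x,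
    FreeAInf.isAInfFunctor_extension hA hf₁ hf hchain⟩, ?_⟩
  rintro G ⟨hgen, hG⟩
  exact FreeAInf.eq_extension hgen hG
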